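/- **Setting.** Let $K\ge 1$, $d\ge 0$, let $\sigma$ be the logistic function, and for cutoffs $\alpha_1<\dots<\alpha_K$ and $z\in\mathbb R$ let $p_0(\alpha,z)=\sigma(\alpha_1-z)$, $p_K(\alpha,z)=1-\sigma(\alpha_K-z)$ and $p_k(\alpha,z)=\sigma(\alpha_{k+1}-z)-\sigma(\alpha_k-z)$ for $0<k<K$. For $\theta=(\alpha_1,\dots,\alpha_K,\beta,\gamma)$ with $\alpha_1<\dots<\alpha_K$, $\beta\neq0$ and $\gamma\in\mathbb R^d$ put $l_k(\theta;z,x)=p_k\bigl(\alpha,\tfrac1\beta z-\tfrac1\beta\gamma^\top x\bigr)$. Human labels $Y_i^h\in\{0,\dots,K\}$ are observed for input-output pairs $(I_i,O_i)$, with covariates $X_i=g(I_i,O_i)\in\mathbb R^d$ and true latent LLM scores $Z_i^{l,*}=\zeta(I_i,O_i)\in\mathbb R$, where $g,\zeta$ are measurable. Let $\Theta$ be a set of parameters $\theta$ as above. Assume: * **A1.** The $(Y_i^h,X_i,I_i,O_i)$ are i.i.d., and $\mathbb P(Y_i^h=k\mid I_i,O_i)=l_k(\theta^*;Z_i^{l,*},X_i)$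 almost surely for $k=0,\dots,K$. * **A3.** $\theta^*=(\alpha^*,\beta^*,\gamma^*)$ lies in the interior of $\Theta$, and it is the unique root in $\Theta$ of $\theta\mapsto\mathbb E[\nabla_\theta\log l_{Y_i^h}(\theta;Z_i^{l,*},X_i)]$. * **A4.** For all $\theta$ in a neighborhood of $\theta^*$, $\mathbb E\|\nabla_\theta\log l_{Y_i^h}(\theta;Z_i^{l,*},X_i)\|^2<\infty$ and $\mathbb E\|\nabla^2_\theta\log l_{Y_i^h}(\theta;Z_i^{l,*},X_i)\|<\infty$; the Fisher information $\mathcal I(\theta^*)=-\mathbb E[\nabla_\theta^2\log l_{Y_i^h}(\theta^*;Z_i^{l,*},X_i)]$ is positive definite; and $\mathbb E[\nabla_z\nabla_\theta\log l_{Y_i^h}(\theta^*;Z_i^{l,*},X_i)]$ exists and is finite. Given scores $\hat Z^l_1,\dots,\hat Z^l_n$, let the MLE $\hat\theta_n=(\hat\alpha,\hat\beta,\hat\gamma)$ be a random vector that, with probability tending to one, maximizes $\sum_{i=1}^n\sum_{k=0}^K\mathbf 1\{Y_i^h=k\}\log l_k(\theta;\hat Z_i^l,X_i)$ over $\theta\in\Theta$.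 **Theorem.** In each of the cases (a), (b), (c) below, as $n\to\infty$, $$\sqrt n(\hat\theta_n-\theta^*)\xrightarrow{d}\mathcal N\bigl(0,\mathcal I(\theta^*)^{-1}\bigr),\qquad \sqrt n\begin{pmatrix}\hat\beta-\beta^*\\ \hat\gamma-\gamma^*\end{pmatrix}\xrightarrow{d}\mathcal N\bigl(0,\{\mathcal I(\theta^*)^{-1}\}_{(\beta,\gamma)}\bigr),$$ where $\{\cdot\}_{(\beta,\gamma)}$ is the block of the coordinates $(\beta,\gamma)$. (a) The latent scores are known: $\hat Z_i^l=Z_i^{l,*}$. In (b) and (c) the LLM labels also follow an ordered-logit model: $p_{ik}:=\mathbb P(Y_i^l=k\mid I_i,O_i)=p_k(\eta^*,Z_i^{l,*})$ almost surely, for some $\eta^*\in\Theta_\eta:=\{\eta\in\mathbb R^K:0=\eta_1<\dots<\eta_K\}$. (b) Exact (log-)probabilities: with probability tending to one, $(\hat\eta,\hat Z^l_{1:n})$ minimizes $Q_n(\eta,z_{1:n})=\sum_{i=1}^n\sum_{k=0}^K|p_k(\eta,z_i)-p_{ik}|$ over $\Theta_\eta\times\mathbb R^n$. (c) CoT sampling: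 for each $n$, given $(I_1,O_1),\dots,(I_n,O_n)$, the labels $Y^l_{i,1},\dots,Y^l_{i,m_n}$ $(i\le n)$ are independent with $\mathbb P(Y^l_{i,m}=k\mid (I_j,O_j)_{j\le n})=p_{ik}$; $m_n\ge1$ and $n/m_n\to0$; $\hat p_{ik}=m_n^{-1}\sum_{m\le m_n}\mathbf 1\{Y^l_{i,m}=k\}$; and for a constant $M$, with probability tending to one, $(\hat\eta,\hat Z^l_{1:n})$ minimizes $\sum_{i=1}^n\sum_{k=0}^K|p_k(\eta,z_i)-\hat p_{ik}|$ over $\Theta_\eta\times[-M,M]^n$. Moreover, for every $n\ge1$, almost surely: $(\eta^*,Z^{l,*}_{1:n})$ lies in the interior (relative to $\{\eta_1=0\}$) of a compact subset of $\Theta_\eta\times[-M,M]^n$ and is the unique minimizer of $Q_n$ over $\Theta_\eta\times[-M,M]^n$; the matrix $$A_n=\frac{2}{\sqrt{2\pi}}\sum_{i=1}^n\sum_{k=0}^K\frac{\nabla p_k(\eta^*,Z_i^{l,*})\nabla p_k(\eta^*,Z_i^{l,*})^\top}{\sqrt{p_{ik}(1-p_{ik})}}$$ is positive definite, with $p_{ik}=p_k(\eta^*,Z_i^{l,*})$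 and the gradients taken in the free coordinates $(\eta_2,\dots,\eta_K,z_1,\dots,z_n)$; and $S_n=\sum_{i,k}\xi_{ik}\nabla p_k(\eta^*,Z_i^{l,*})$ has finite variance for i.i.d. Rademacher signs $\xi_{ik}$. -/

import Mathlib

open MeasureTheory ProbabilityTheory Filter Topology
open scoped ENNReal

noncomputable section

namespace Bridge

/-! ### The ordered-logit model -/

/-- Probability that an ordered-logit label with cutoffs `α` and latent score `z` is `< j`:
it is `0` for `j = 0`, `σ (α_j - z)` for `1 ≤ j ≤ K` (the cutoff `α_j` of the mathematical text is
`α (j - 1)` here, as `Fin K` starts at `0`), and `1` for `j = K + 1`. -/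
def cumProb {K : ℕ} (α : Fin K → ℝ) (z : ℝ) : ℕ → ℝ
  | 0 => 0
  | j + 1 => if h : j < K then Real.sigmoid (α ⟨j, h⟩ - z) else 1

/-- `p_k(α_1, …, α_K, z)`, the probability of the label `k ∈ {0, …, K}`. -/
def ordProb {K : ℕ} (α : Fin K → ℝ) (z : ℝ) (k : Fin (K + 1)) : ℝ :=
  cumProb α z (k.val + 1) - cumProb α z k.val

/-- Indices of the parameter `θ = (α_1, …, α_K, β, γ_1, …, γ_d)`. -/
abbrev ParamIdx (K d : ℕ) : Type := Fin K ⊕ (Unit ⊕ Fin d)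

/-- The Euclidean space in which `θ = (α, β, γ)` lives. -/
abbrev Param (K d : ℕ) : Type := EuclideanSpace ℝ (ParamIdx K d)

def cutoffs {K d : ℕ} (θ : Param K d) : Fin K → ℝ := fun j => θ (Sum.inl j)

def slope {K d : ℕ} (θ : Param K d) : ℝ := θ (Sum.inr (Sum.inl ()))

def coeffs {K d : ℕ} (θ : Param K d) : Fin d → ℝ := fun j => θ (Sum.inr (Sum.inr j))

/-- The subvector `(β, γ)`. -/
def betaGamma {K d : ℕ} (θ : Param K d) : EuclideanSpace ℝ (Unit ⊕ Fin d) :=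
  WithLp.toLp 2 (fun a => θ (Sum.inr a))

/-- The parameters for which the model makes sense: `α_1 < ⋯ < α_K` and `β ≠ 0`. -/
def paramDomain (K d : ℕ) : Set (Param K d) :=
  {θ | StrictMono (cutoffs θ) ∧ slope θ ≠ 0}

/-- `l_k(θ; z, x) = p_k(α_1, …, α_K, (1/β) z - (1/β) γᵀ x)`. -/
def lik {K d : ℕ} (θ : Param K d) (z : ℝ) (x : EuclideanSpace ℝ (Fin d)) (k : Fin (K + 1)) : ℝ :=
  ordProb (cutoffs θ) ((1 / slope θ) * z - (1 / slope θ) * ∑ j, coeffs θ j * x j) k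

/-- `log l_k(θ; z, x)`. -/
def logLik {K d : ℕ} (θ : Param K d) (z : ℝ) (x : EuclideanSpace ℝ (Fin d))
    (k : Fin (K + 1)) : ℝ :=
  Real.log (lik θ z x k)

/-- The gradient `∇_θ log l_k(θ; z, x)`. -/
def score {K d : ℕ} (θ : Param K d) (z : ℝ) (x : EuclideanSpace ℝ (Fin d))
    (k : Fin (K + 1)) : Param K d :=
  gradient (fun t : Param K d => logLik t z x k) θ

/-- The second derivative `∇²_θ log l_k(θ; z, x)`, as a linear operator (the
derivative of the gradient). -/
def hessLogLik {K d : ℕ} (θ : Param K d) (z : ℝ) (x : EuclideanSpace ℝ (Fin d))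
    (k : Fin (K + 1)) : Param K d →L[ℝ] Param K d :=
  fderiv ℝ (fun t : Param K d => score t z x k) θ

/-- The mixed derivative `∇_z ∇_θ log l_k(θ; z, x)`.  (As `log l_k` does not involve the LLM
cutoffs `η`, the block of the mixed derivative that belongs to `η` vanishes.) -/
def mixedLogLik {K d : ℕ} (θ : Param K d) (z : ℝ) (x : EuclideanSpace ℝ (Fin d))
    (k : Fin (K + 1)) : Param K d :=
  deriv (fun s : ℝ => score θ s x k) z

/-- The log-likelihood
`ℓ_n(θ; z, x) = ∑_{i ≤ n} ∑_{k ≤ K} 1{y_i = k} log l_k(θ; z_i, x_i)`. -/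
def sampleLogLik {K d n : ℕ} (y : Fin n → Fin (K + 1)) (z : Fin n → ℝ)
    (x : Fin n → EuclideanSpace ℝ (Fin d)) (θ : Param K d) : ℝ :=
  ∑ i, ∑ k, (if y i = k then (1 : ℝ) else 0) * logLik θ (z i) (x i) k

/-! ### Conditions on the human labels

The pairs `V i = (I_i, O_i)` are the inputs and outputs, `Y i` is the human label, `X_i = g (V i)`
are the covariates and `Z_i^{l,*} = ζ (V i)` are the true latent LLM scores. -/

section Human

variable {Ω 𝓥 : Type*} [MeasurableSpace Ω] [MeasurableSpace 𝓥] {K d : ℕ}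

/-- The data are i.i.d., and the conditional law of the human label given the pair `(I_i, O_i)` is
the ordered-logit law with the parameter `θs`. -/
structure HumanModel (μ : Measure Ω) (V : ℕ → Ω → 𝓥) (Y : ℕ → Ω → Fin (K + 1))
    (g : 𝓥 → EuclideanSpace ℝ (Fin d)) (ζ : 𝓥 → ℝ) (θs : Param K d) : Prop where
  meas_V : ∀ i, Measurable (V i)
  meas_Y : ∀ i, Measurable (Y i)
  meas_g : Measurable g
  meas_ζ : Measurable ζ
  indep : iIndepFun (fun i ω => (Y i ω, g (V i ω), V i ω)) μ
  ident : ∀ i, IdentDistrib (fun ω => (Y i ω, g (V i ω), V i ω))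
    (fun ω => (Y 0 ω, g (V 0 ω), V 0 ω)) μ μ
  model : ∀ i k, μ[Set.indicator {ω | Y i ω = k} (fun _ => (1 : ℝ)) |
      MeasurableSpace.comap (V i) inferInstance]
    =ᵐ[μ] fun ω => lik θs (ζ (V i ω)) (g (V i ω)) k

/-- `θ` is a root of `θ ↦ E[∇_θ log l_Y(θ; Z, X)]` (in particular the expectation exists). -/
def IsScoreRoot (μ : Measure Ω) (V : ℕ → Ω → 𝓥) (Y : ℕ → Ω → Fin (K + 1))
    (g : 𝓥 → EuclideanSpace ℝ (Fin d)) (ζ : 𝓥 → ℝ) (θ : Param K d) : Prop :=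
  Integrable (fun ω => score θ (ζ (V 0 ω)) (g (V 0 ω)) (Y 0 ω)) μ ∧
    ∫ ω, score θ (ζ (V 0 ω)) (g (V 0 ω)) (Y 0 ω) ∂μ = 0

/-- The true parameter is interior to the parameter space `Θ`, and it is the unique root in `Θ` of
the expected score. -/
structure InteriorUniqueRoot (μ : Measure Ω) (V : ℕ → Ω → 𝓥) (Y : ℕ → Ω → Fin (K + 1))
    (g : 𝓥 → EuclideanSpace ℝ (Fin d)) (ζ : 𝓥 → ℝ) (Θ : Set (Param K d)) (θs : Param K d) :
    Prop where
  subset_domain : Θ ⊆ paramDomain K d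
  mem_interior : θs ∈ interior Θ
  root_iff : ∀ θ ∈ Θ, IsScoreRoot μ V Y g ζ θ ↔ θ = θs

/-- The Fisher information matrix `-E[∇²_θ log l_Y(θ; Z, X)]`. -/
def fisher (μ : Measure Ω) (V : ℕ → Ω → 𝓥) (Y : ℕ → Ω → Fin (K + 1))
    (g : 𝓥 → EuclideanSpace ℝ (Fin d)) (ζ : 𝓥 → ℝ) (θ : Param K d) :
    Matrix (ParamIdx K d) (ParamIdx K d) ℝ :=
  Matrix.of fun a b => - ∫ ω, hessLogLik θ (ζ (V 0 ω)) (g (V 0 ω)) (Y 0 ω)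
    (EuclideanSpace.single b 1) a ∂μ

/-- Near `θs` the second moment of the score and the first moment of the Hessian are finite, the
Fisher information at `θs` is positive definite, and the expected mixed derivative is finite. -/
structure MomentsAndInformation (μ : Measure Ω) (V : ℕ → Ω → 𝓥) (Y : ℕ → Ω → Fin (K + 1))
    (g : 𝓥 → EuclideanSpace ℝ (Fin d)) (ζ : 𝓥 → ℝ) (θs : Param K d) : Prop where
  moments : ∀ᶠ θ in 𝓝 θs,
    MemLp (fun ω => score θ (ζ (V 0 ω)) (g (V 0 ω)) (Y 0 ω)) 2 μ ∧
    Integrable (fun ω => hessLogLik θ (ζ (V 0 ω)) (g (V 0 ω)) (Y 0 ω)) μ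
  information : (fisher μ V Y g ζ θs).PosDef
  mixed : Integrable (fun ω => mixedLogLik θs (ζ (V 0 ω)) (g (V 0 ω)) (Y 0 ω)) μ

end Human

/-! ### Recovering the latent LLM scores

A stage-one parameter `v = (η_1, …, η_K, z_1, …, z_n)` is a function on `Fin K ⊕ Fin n`. -/

section StageOne

variable {K n : ℕ}

def stageEta (v : Fin K ⊕ Fin n → ℝ) : Fin K → ℝ := fun j => v (Sum.inl j)

def stageZ (v : Fin K ⊕ Fin n → ℝ) : Fin n → ℝ := fun i => v (Sum.inr i)

/-- The normalization `η_1 = 0`. -/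
def Normalized (η : Fin K → ℝ) : Prop := ∀ j : Fin K, j.val = 0 → η j = 0

/-- `Θ_η × S^n` with `Θ_η = {η | 0 = η_1 < ⋯ < η_K}`. -/
def stageSet (K n : ℕ) (S : Set ℝ) : Set (Fin K ⊕ Fin n → ℝ) :=
  {v | Normalized (stageEta v) ∧ StrictMono (stageEta v) ∧ ∀ i, stageZ v i ∈ S}

/-- `∑_i ∑_k |p_k(η, z_i) - q_{ik}|`; for `q_{ik}` the LLM probabilities this is `Q_n`, and for the
empirical frequencies it is `Q_{n,m}`. -/
def stageLoss (q : Fin n → Fin (K + 1) → ℝ) (v : Fin K ⊕ Fin n → ℝ) : ℝ :=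
  ∑ i, ∑ k, |ordProb (stageEta v) (stageZ v i) k - q i k|

/-- `v` minimizes the stage-one loss over `Θ_η × S^n`. -/
def IsStageArgmin (S : Set ℝ) (q : Fin n → Fin (K + 1) → ℝ) (v : Fin K ⊕ Fin n → ℝ) : Prop :=
  v ∈ stageSet K n S ∧ IsMinOn (stageLoss q) (stageSet K n S) v

/-- The gradient of `(η, z_{1:n}) ↦ p_k(η, z_i)` at `v`. -/
def gradProb (v : Fin K ⊕ Fin n → ℝ) (i : Fin n) (k : Fin (K + 1)) : Fin K ⊕ Fin n → ℝ :=
  fun a => fderiv ℝ (fun u : Fin K ⊕ Fin n → ℝ => ordProb (stageEta u) (stageZ u i) k) v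
    (Pi.single a 1)

/-- The coordinates that are free under the normalization `η_1 = 0`: all but `η_1`. -/
def IsFree (a : Fin K ⊕ Fin n) : Prop := ∀ j : Fin K, a = Sum.inl j → j.val ≠ 0

/-- The matrix `A_n`, in all the `K + n` coordinates. -/
def matA (v : Fin K ⊕ Fin n → ℝ) : Matrix (Fin K ⊕ Fin n) (Fin K ⊕ Fin n) ℝ :=
  Matrix.of fun a b => 2 / Real.sqrt (2 * Real.pi) *
    ∑ i, ∑ k, gradProb v i k a * gradProb v i k b /
      Real.sqrt (ordProb (stageEta v) (stageZ v i) k *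
        (1 - ordProb (stageEta v) (stageZ v i) k))

/-- The law of independent Rademacher signs `ξ_{ik}`. -/
def rademacherSigns (K n : ℕ) : Measure (Fin n × Fin (K + 1) → ℝ) :=
  Measure.pi fun _ =>
    (2⁻¹ : ℝ≥0∞) • Measure.dirac (1 : ℝ) + (2⁻¹ : ℝ≥0∞) • Measure.dirac (-1 : ℝ)

/-- `S_n = ∑_i ∑_k ξ_{ik} ∇ p_k(η, z_i)`, as a function of the signs. -/
def signSum (v : Fin K ⊕ Fin n → ℝ) (ξ : Fin n × Fin (K + 1) → ℝ) : Fin K ⊕ Fin n → ℝ :=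
  ∑ i, ∑ k, ξ (i, k) • gradProb v i k

/-- The true stage-one parameter `vs` is interior (relative to `η_1 = 0`) to a compact subset of
`Θ_η × S^n`, and it is the unique minimizer of the population loss. -/
structure StageIdentified (S : Set ℝ) (p : Fin n → Fin (K + 1) → ℝ) (vs : Fin K ⊕ Fin n → ℝ) :
    Prop where
  interior_compact : ∃ C, IsCompact C ∧ C ⊆ stageSet K n S ∧ C ∈ 𝓝[{v | Normalized (stageEta v)}] vs
  argmin : IsStageArgmin S p vs
  unique : ∀ v, IsStageArgmin S p v → v = vs

/-- `A_n` is positive definite in the free coordinates, and `Var(S_n)` is finite. -/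
structure StageRegular (vs : Fin K ⊕ Fin n → ℝ) : Prop where
  posDef : ((matA vs).submatrix (Subtype.val : {a : Fin K ⊕ Fin n // IsFree a} → _)
    Subtype.val).PosDef
  finite_var : MemLp (signSum vs) 2 (rademacherSigns K n)

end StageOne

section LLM

variable {Ω 𝓥 : Type*} [MeasurableSpace Ω] [MeasurableSpace 𝓥] {K : ℕ}

/-- The probabilities `p_{ik} = P(Y_i^l = k | I_i, O_i)`, where `κ w` is the law of the LLM label
at the pair `w`. -/
def llmProb (κ : Kernel 𝓥 (Fin (K + 1))) (V : ℕ → Ω → 𝓥) (n : ℕ) (ω : Ω) :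
    Fin n → Fin (K + 1) → ℝ :=
  fun i k => (κ (V i ω)).real {k}

/-- The true stage-one parameter `(η*, Z_{1:n}^{l,*})`. -/
def trueStage (ηs : Fin K → ℝ) (ζ : 𝓥 → ℝ) (V : ℕ → Ω → 𝓥) (n : ℕ) (ω : Ω) :
    Fin K ⊕ Fin n → ℝ :=
  Sum.elim ηs fun i => ζ (V i ω)

/-- The LLM labels follow the ordered-logit model with cutoffs `0 = η_1 < ⋯ < η_K` and latent
scores `Z_i^{l,*} = ζ (V i)`. -/
structure LLMModel (μ : Measure Ω) (V : ℕ → Ω → 𝓥) (κ : Kernel 𝓥 (Fin (K + 1)))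
    (ζ : 𝓥 → ℝ) (ηs : Fin K → ℝ) : Prop where
  strictMono : StrictMono ηs
  normalized : Normalized ηs
  model : ∀ i k, ∀ᵐ ω ∂μ, (κ (V i ω)).real {k} = ordProb ηs (ζ (V i ω)) k

/-- Given the pairs `V 0, …, V (n-1)`, the labels `L i j` (`i < n`, `j < m`) are independent and
`L i j` has the law `κ (V i)`. -/
structure IsCoTSample (μ : Measure Ω) (V : ℕ → Ω → 𝓥) (κ : Kernel 𝓥 (Fin (K + 1))) (n m : ℕ)
    (L : ℕ → ℕ → Ω → Fin (K + 1)) : Prop where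
  meas : ∀ i j, Measurable (L i j)
  cond_law : ∀ y : Fin n → Fin m → Fin (K + 1),
    μ[Set.indicator {ω | ∀ (i : Fin n) (j : Fin m), L i j ω = y i j} (fun _ => (1 : ℝ)) |
        MeasurableSpace.comap (fun ω (i : Fin n) => V i ω) inferInstance]
      =ᵐ[μ] fun ω => ∏ i : Fin n, ∏ j : Fin m, (κ (V i ω)).real {y i j}

/-- The empirical frequencies `p̂_{ik,m}`. -/
def empProb (L : ℕ → ℕ → Ω → Fin (K + 1)) (n m : ℕ) (ω : Ω) : Fin n → Fin (K + 1) → ℝ :=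
  fun i k => (∑ j : Fin m, if L i j ω = k then (1 : ℝ) else 0) / m

end LLM

/-! ### Estimators and limits -/

section Limit

variable {Ω 𝓥 : Type*} [MeasurableSpace Ω] {K d : ℕ}

/-- The event `P n` has probability tending to one. -/
def ProbTendstoOne (μ : Measure Ω) (P : ℕ → Ω → Prop) : Prop :=
  Tendsto (fun n => μ {ω | ¬ P n ω}) atTop (𝓝 0)

/-- `θhat n` is a random variable which, with probability tending to one, maximizes over `Θ` the
log-likelihood of the first `n` labels computed with the latent scores `Zhat n`. -/
def IsMLE (μ : Measure Ω) (V : ℕ → Ω → 𝓥) (Y : ℕ → Ω → Fin (K + 1))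
    (g : 𝓥 → EuclideanSpace ℝ (Fin d)) (Θ : Set (Param K d))
    (Zhat : (n : ℕ) → Ω → Fin n → ℝ) (θhat : ℕ → Ω → Param K d) : Prop :=
  (∀ n, AEMeasurable (θhat n) μ) ∧
  ProbTendstoOne μ fun n ω => θhat n ω ∈ Θ ∧
    IsMaxOn (sampleLogLik (fun i : Fin n => Y i ω) (Zhat n ω) (fun i : Fin n => g (V i ω))) Θ
      (θhat n ω)

/-- `√n (θhat n - θs)` converges in distribution to `N(0, J⁻¹)`, and `√n` times the error of the
`(β, γ)` part converges in distribution to `N(0, {J⁻¹}_{(β,γ)})`. -/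
def AsympNormal (μ : Measure Ω) [IsProbabilityMeasure μ] (J : Matrix (ParamIdx K d) (ParamIdx K d) ℝ)
    (θs : Param K d) (θhat : ℕ → Ω → Param K d) : Prop :=
  TendstoInDistribution (fun (n : ℕ) ω => Real.sqrt n • (θhat n ω - θs)) atTop id (fun _ => μ)
      (multivariateGaussian 0 J⁻¹) ∧
  TendstoInDistribution
    (fun (n : ℕ) ω => Real.sqrt n • (betaGamma (θhat n ω) - betaGamma θs)) atTop id (fun _ => μ)
      (multivariateGaussian 0 (J⁻¹.submatrix Sum.inr Sum.inr))

end Limit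

end Bridge

end

/-!
The proof has two independent halves.

*The estimator.* Asymptotic normality holds for the maximum likelihood estimator computed with any
approximate latent scores `ẑ_i` such that `∑ i, (ẑ_i - z_i)² → 0` in probability
(`Bridge.asympNormal_of_isMLE`). The point is that `θ̂` is only assumed to maximize the likelihood
over `Θ`, without any consistency, compactness or uniform moment assumption. Both gaps are closed by
concavity. In the coordinates `φ = (α, 1/β, γ/β)` (`Bridge.reparam`, an involution of `{β ≠ 0}`) the
latent value is linear in the parameter, and since
`σ(a) - σ(b) = σ(a) σ(-b) (1 - exp (-(a - b)))`, the log-likelihood is a sum of concave functions of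
linear functionals (`Bridge.concaveOn_logF`). In these coordinates:

* The moment conditions are pointwise in the parameter. Along the latent value, the curvature at
  a point of an interval is bounded by the curvature and the squared score at its endpoints
  (`Bridge.exists_curv_le`), so that finitely many parameters near the true one yield an integrable
  envelope (`Bridge.exists_envelope`).
* With this envelope, the log-likelihood at `φ* + n^{-1/2} J h` has a quadratic expansion that is
  uniform for `h` in a ball (`Bridge.probTendstoOne_expansion`). The linear term is the normalized
  sum of the scores, the quadratic term is the Fisher information, and replacing `z_i` by `ẑ_i`
  costs `n^{-1/2} ∑ i, |ẑ_i - z_i| (1 + √D_i)`, which the Cauchy–Schwarz inequality makes negligible.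
* A concave function that is close to a quadratic function on a ball cannot be as large as at the
  quadratic maximizer at a point far from it, inside or outside the ball
  (`Bridge.norm_sub_lt_of_concaveOn`). So any maximizer over `Θ` agrees, up to `o(n^{-1/2})`, with
  `θ*` plus the average of the influence function (`Bridge.tendstoInMeasure_mle`). The central limit
  theorem and the information equality finish the argument.

*The scores.* Because `η₁ = 0`, the probability `σ(-z)` of the label `0` determines `z`. With exact
probabilities the minimal loss is zero, and the scores are recovered without error. With sampled
labels, the minimizer over `[-M, M]` satisfies
`∑ i, (ẑ_i - z_i)² ≤ C ∑ i, ∑ k, (p̂_ik - p_ik)²` for a constant `C` that depends on `K` and `M` only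
(`Bridge.exists_stage_bound`), and the right-hand side has expectation at most `C (K + 1) n / m_n`.
-/

noncomputable section

namespace Bridge

/-! ### Calculus of the logistic function -/

/-- `log σ`, the log-likelihood of a binary logit. -/
def logSig (t : ℝ) : ℝ := Real.log (Real.sigmoid t)

/-- `σ (1 - σ) = σ'`, the variance of a logistic label, and the curvature `-(log σ)''`. -/
def sigVar (t : ℝ) : ℝ := Real.sigmoid t * Real.sigmoid (-t)

/-- `log (1 - exp (-t))`, the term through which the distance of two consecutive cutoffs enters
the log-likelihood. -/
def logGap (t : ℝ) : ℝ := Real.log (1 - Real.exp (-t))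

/-- The derivative of `logGap` on `(0, ∞)`. -/
def logGapDeriv (t : ℝ) : ℝ := (Real.exp t - 1)⁻¹

/-- The second derivative of `logGap` on `(0, ∞)`. -/
def logGapDeriv₂ (t : ℝ) : ℝ := -(Real.exp t / (Real.exp t - 1) ^ 2)

lemma hasDerivAt_sigmoid' (t : ℝ) : HasDerivAt Real.sigmoid (sigVar t) t := by
  have := Real.hasDerivAt_sigmoid t
  rwa [← Real.sigmoid_neg] at this

lemma hasDerivAt_logSig (t : ℝ) : HasDerivAt logSig (Real.sigmoid (-t)) t := by
  have := (hasDerivAt_sigmoid' t).log (Real.sigmoid_pos t).ne'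
  refine this.congr_deriv ?_
  rw [sigVar, mul_div_cancel_left₀ _ (Real.sigmoid_pos t).ne']

lemma sigVar_neg (t : ℝ) : sigVar (-t) = sigVar t := by
  simp [sigVar, mul_comm]

lemma hasDerivAt_sigmoid_neg (t : ℝ) :
    HasDerivAt (fun s => Real.sigmoid (-s)) (-sigVar t) t := by
  have := (hasDerivAt_sigmoid' (-t)).comp t (hasDerivAt_neg t)
  simpa [sigVar_neg, Function.comp_def] using this

lemma sigVar_eq (t : ℝ) : sigVar t = (2 + 2 * Real.cosh t)⁻¹ := by
  rw [sigVar, Real.sigmoid_def, Real.sigmoid_def, ← mul_inv, Real.cosh_eq, neg_neg]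
  congr 1
  have : Real.exp (-t) * Real.exp t = 1 := by rw [← Real.exp_add]; simp
  linear_combination this

lemma sigVar_pos (t : ℝ) : 0 < sigVar t :=
  mul_pos (Real.sigmoid_pos _) (Real.sigmoid_pos _)

lemma sigVar_le (t : ℝ) : sigVar t ≤ 1 / 4 := by
  rw [sigVar_eq, one_div]
  exact inv_anti₀ (by norm_num) (by linarith [Real.one_le_cosh t])

lemma sigVar_anti {s t : ℝ} (h : |s| ≤ |t|) : sigVar t ≤ sigVar s := by
  rw [sigVar_eq, sigVar_eq]
  exact inv_anti₀ (by linarith [Real.one_le_cosh s]) (by linarith [Real.cosh_le_cosh.2 h])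

/-- The curvature of `log σ` changes at most by the factor `exp |s - t|`. -/
lemma sigVar_le_exp_mul (s t : ℝ) : sigVar s ≤ Real.exp |s - t| * sigVar t := by
  rw [sigVar_eq, sigVar_eq, ← div_eq_mul_inv, inv_eq_one_div,
    div_le_div_iff₀ (by linarith [Real.one_le_cosh s]) (by linarith [Real.one_le_cosh t]),
    Real.cosh_eq, Real.cosh_eq]
  have h0 : 1 ≤ Real.exp |s - t| := Real.one_le_exp (abs_nonneg _)
  have h1 : Real.exp t ≤ Real.exp |s - t| * Real.exp s := by
    rw [← Real.exp_add, Real.exp_le_exp]; linarith [neg_abs_le (s - t)]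
  have h2 : Real.exp (-t) ≤ Real.exp |s - t| * Real.exp (-s) := by
    rw [← Real.exp_add, Real.exp_le_exp]; linarith [le_abs_self (s - t)]
  linarith

lemma continuous_sigVar : Continuous sigVar :=
  continuous_sigmoid.mul (continuous_sigmoid.comp continuous_neg)

lemma hasDerivAt_sigVar (t : ℝ) :
    HasDerivAt sigVar (sigVar t * (Real.sigmoid (-t) - Real.sigmoid t)) t := by
  refine ((hasDerivAt_sigmoid' t).mul (hasDerivAt_sigmoid_neg t)).congr_deriv ?_
  ring

lemma abs_sigVar_sub_le (s t : ℝ) : |sigVar s - sigVar t| ≤ |s - t| := by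
  have := Convex.norm_image_sub_le_of_norm_hasDerivWithin_le (f := sigVar) (s := Set.univ)
    (C := 1) (x := t) (y := s) (fun x _ => (hasDerivAt_sigVar x).hasDerivWithinAt)
    (fun x _ => ?_) convex_univ trivial trivial
  · simpa using this
  · rw [Real.norm_eq_abs, abs_mul, abs_of_pos (sigVar_pos x)]
    have h1 := Real.sigmoid_pos x
    have h2 := Real.sigmoid_lt_one x
    have h3 := sigVar_le x
    have : |Real.sigmoid (-x) - Real.sigmoid x| ≤ 1 := by
      rw [Real.sigmoid_neg, abs_le]; constructor <;> linarith
    nlinarith [sigVar_pos x, abs_nonneg (Real.sigmoid (-x) - Real.sigmoid x)]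

lemma abs_sigmoid_sub_le (s t : ℝ) : |Real.sigmoid s - Real.sigmoid t| ≤ |s - t| := by
  have := Convex.norm_image_sub_le_of_norm_hasDerivWithin_le (f := Real.sigmoid) (s := Set.univ)
    (C := 1) (x := t) (y := s) (fun x _ => (hasDerivAt_sigmoid' x).hasDerivWithinAt)
    (fun x _ => ?_) convex_univ trivial trivial
  · simpa using this
  · rw [Real.norm_eq_abs, abs_of_pos (sigVar_pos x)]
    linarith [sigVar_le x]

/-- The probability of an interval of latent values factorizes; this makes the ordered-logit
log-likelihood a sum of concave functions of linear functionals. -/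
lemma sigmoid_sub_sigmoid (a b : ℝ) :
    Real.sigmoid a - Real.sigmoid b =
      Real.sigmoid a * Real.sigmoid (-b) * (1 - Real.exp (-(a - b))) := by
  simp only [Real.sigmoid_def, neg_neg]
  have h1 : Real.exp (-(a - b)) = Real.exp (-a) * Real.exp b := by
    rw [← Real.exp_add]; ring_nf
  have h2 : Real.exp (-b) = (Real.exp b)⁻¹ := Real.exp_neg b
  rw [h1, h2]
  have := Real.exp_pos b
  have := Real.exp_pos (-a)
  field_simp
  ring

lemma concaveOn_logSig : ConcaveOn ℝ Set.univ logSig := by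
  refine Antitone.concaveOn_univ_of_deriv (fun t => (hasDerivAt_logSig t).differentiableAt) ?_
  intro s t hst
  rw [(hasDerivAt_logSig s).deriv, (hasDerivAt_logSig t).deriv]
  exact Real.sigmoid_le (by linarith)

lemma hasDerivAt_logGap {t : ℝ} (ht : 0 < t) : HasDerivAt logGap (logGapDeriv t) t := by
  have h1 : Real.exp (-t) < 1 := by rw [Real.exp_lt_one_iff]; linarith
  have h := ((((hasDerivAt_neg t).exp).const_sub 1).log (by linarith : 1 - Real.exp (-t) ≠ 0))
  refine h.congr_deriv ?_
  have h2 : Real.exp (-t) = (Real.exp t)⁻¹ := Real.exp_neg t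
  have h3 : 1 < Real.exp t := by rw [Real.one_lt_exp_iff]; exact ht
  rw [logGapDeriv, h2]
  have : Real.exp t - 1 ≠ 0 := by linarith
  field_simp

lemma hasDerivAt_logGapDeriv {t : ℝ} (ht : 0 < t) :
    HasDerivAt logGapDeriv (logGapDeriv₂ t) t := by
  have h3 : 1 < Real.exp t := by rw [Real.one_lt_exp_iff]; exact ht
  have h := ((Real.hasDerivAt_exp t).sub_const 1).inv (by linarith : Real.exp t - 1 ≠ 0)
  refine h.congr_deriv ?_
  rw [logGapDeriv₂]; ring

lemma concaveOn_logGap : ConcaveOn ℝ (Set.Ioi 0) logGap := by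
  refine AntitoneOn.concaveOn_of_deriv (convex_Ioi 0)
    (fun t ht => (hasDerivAt_logGap ht).continuousAt.continuousWithinAt)
    (fun t ht => ?_) ?_
  · rw [interior_Ioi] at ht
    exact (hasDerivAt_logGap ht).differentiableAt.differentiableWithinAt
  · rw [interior_Ioi]
    intro s hs t ht hst
    rw [(hasDerivAt_logGap hs).deriv, (hasDerivAt_logGap ht).deriv]
    have h3 : 1 < Real.exp s := by rw [Real.one_lt_exp_iff]; exact hs
    exact inv_anti₀ (by linarith) (by linarith [Real.exp_le_exp.2 hst])

lemma continuousAt_logGapDeriv₂ {t : ℝ} (ht : 0 < t) : ContinuousAt logGapDeriv₂ t := by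
  have h3 : 1 < Real.exp t := by rw [Real.one_lt_exp_iff]; exact ht
  have : (Real.exp t - 1) ^ 2 ≠ 0 := pow_ne_zero _ (by linarith)
  unfold logGapDeriv₂
  fun_prop (disch := assumption)

/-- Second order Taylor formula on `[0, 1]` with the remainder in Lagrange's form. -/
lemma exists_taylor_two {f f' f'' : ℝ → ℝ}
    (hf : ∀ s ∈ Set.Icc (0 : ℝ) 1, HasDerivAt f (f' s) s)
    (hf' : ∀ s ∈ Set.Icc (0 : ℝ) 1, HasDerivAt f' (f'' s) s) :
    ∃ s ∈ Set.Icc (0 : ℝ) 1, f 1 - f 0 = f' 0 + f'' s / 2 := by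
  set c := f 1 - f 0 - f' 0 with hc
  have hg : ∀ s ∈ Set.Icc (0 : ℝ) 1, HasDerivAt
      (fun s => f 1 - f s - (1 - s) * f' s - (1 - s) ^ 2 * c)
      (-(1 - s) * f'' s + 2 * (1 - s) * c) s := by
    intro s hs
    have h1 : HasDerivAt (fun s : ℝ => 1 - s) (-1) s := (hasDerivAt_id s).const_sub 1
    have := (((hf s hs).const_sub (f 1)).sub (h1.mul (hf' s hs))).sub ((h1.pow 2).mul_const c)
    refine this.congr_deriv ?_
    push_cast
    ring
  obtain ⟨s, hs, h⟩ := exists_hasDerivAt_eq_zero (a := (0 : ℝ)) (b := 1) one_pos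
    (fun s hs => (hg s hs).continuousAt.continuousWithinAt) (by simp [hc])
    (fun s hs => hg s (Set.Ioo_subset_Icc_self hs))
  refine ⟨s, Set.Ioo_subset_Icc_self hs, ?_⟩
  have h1 : 1 - s ≠ 0 := by linarith [hs.2]
  have h2 : (1 - s) * (-f'' s + 2 * c) = 0 := by linarith
  have h3 := (mul_eq_zero.1 h2).resolve_left h1
  linarith

/-! ### The log-likelihood in concave coordinates -/

section

variable {K d : ℕ}

/-- The cutoff with index `j` as a linear functional of the parameter (`0` if there is none). -/
def cutFun (K d : ℕ) (j : ℕ) : Param K d →L[ℝ] ℝ :=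
  if h : j < K then EuclideanSpace.proj (Sum.inl ⟨j, h⟩) else 0

/-- The latent value `b z - cᵀ x` as a linear functional of `φ = (α, b, c)`. -/
def latFun (K : ℕ) {d : ℕ} (z : ℝ) (x : EuclideanSpace ℝ (Fin d)) : Param K d →L[ℝ] ℝ :=
  z • EuclideanSpace.proj (Sum.inr (Sum.inl ())) -
    ∑ j, x j • EuclideanSpace.proj (Sum.inr (Sum.inr j))

/-- The signed distance from the latent value to the upper cutoff of the label `k`.  The cutoffs are
numbered from `0`, so that this is the one with index `k`; for `k = K` there is none, and the value
only occurs multiplied by `hasUp k = 0`. -/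
def upFun (z : ℝ) (x : EuclideanSpace ℝ (Fin d)) (k : Fin (K + 1)) : Param K d →L[ℝ] ℝ :=
  cutFun K d k - latFun K z x

/-- The signed distance from the lower cutoff of the label `k`, the one with index `k - 1`, to the
latent value.  For `k = 0` there is none, and the value only occurs multiplied by `hasLo k = 0`. -/
def loFun (z : ℝ) (x : EuclideanSpace ℝ (Fin d)) (k : Fin (K + 1)) : Param K d →L[ℝ] ℝ :=
  latFun K z x - cutFun K d (k - 1)

/-- The distance between the two cutoffs around the label `k`. -/
def gapFun (d : ℕ) (k : Fin (K + 1)) : Param K d →L[ℝ] ℝ :=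
  cutFun K d k - cutFun K d (k - 1)

/-- Indicator that the label `k` has a cutoff above it. -/
def hasUp (k : Fin (K + 1)) : ℝ := if k.val < K then 1 else 0

/-- Indicator that the label `k` has a cutoff below it. -/
def hasLo (k : Fin (K + 1)) : ℝ := if 0 < k.val then 1 else 0

/-- The log-likelihood of the label `k` in the coordinates `φ = (α, b, c) = (α, 1/β, γ/β)`.  It is a
sum of concave functions of linear functionals of `φ`, by `sigmoid_sub_sigmoid`. -/
def logF (z : ℝ) (x : EuclideanSpace ℝ (Fin d)) (k : Fin (K + 1)) (φ : Param K d) : ℝ :=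
  hasUp k * logSig (upFun z x k φ) + hasLo k * logSig (loFun z x k φ) +
    hasUp k * hasLo k * logGap (gapFun d k φ)

/-- The derivative of `logF` at `φ` in the direction `v`. -/
def logF₁ (z : ℝ) (x : EuclideanSpace ℝ (Fin d)) (k : Fin (K + 1)) (φ v : Param K d) : ℝ :=
  hasUp k * (Real.sigmoid (-upFun z x k φ) * upFun z x k v) +
    hasLo k * (Real.sigmoid (-loFun z x k φ) * loFun z x k v) +
    hasUp k * hasLo k * (logGapDeriv (gapFun d k φ) * gapFun d k v)

/-- The second derivative of `logF` at `φ`, a quadratic form in the direction `v`. -/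
def logF₂ (z : ℝ) (x : EuclideanSpace ℝ (Fin d)) (k : Fin (K + 1)) (φ v : Param K d) : ℝ :=
  hasUp k * (-sigVar (upFun z x k φ) * upFun z x k v ^ 2) +
    hasLo k * (-sigVar (loFun z x k φ) * loFun z x k v ^ 2) +
    hasUp k * hasLo k * (logGapDeriv₂ (gapFun d k φ) * gapFun d k v ^ 2)

/-- The parameters with increasing cutoffs. -/
def ordered (K d : ℕ) : Set (Param K d) := {φ | StrictMono (cutoffs φ)}

/-- The change of coordinates `(α, β, γ) ↦ (α, 1/β, γ/β)`, an involution of `{β ≠ 0}`.  In the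
new coordinates the latent value is linear and the log-likelihood is concave. -/
def reparam (θ : Param K d) : Param K d :=
  WithLp.toLp 2 (Sum.elim (fun j => θ (Sum.inl j))
    (Sum.elim (fun _ => 1 / slope θ) (fun j => coeffs θ j / slope θ)))

lemma hasUp_nonneg (k : Fin (K + 1)) : 0 ≤ hasUp k := by unfold hasUp; split_ifs <;> norm_num

lemma hasLo_nonneg (k : Fin (K + 1)) : 0 ≤ hasLo k := by unfold hasLo; split_ifs <;> norm_num

lemma hasUp_le_one (k : Fin (K + 1)) : hasUp k ≤ 1 := by unfold hasUp; split_ifs <;> norm_num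

lemma hasLo_le_one (k : Fin (K + 1)) : hasLo k ≤ 1 := by unfold hasLo; split_ifs <;> norm_num

lemma hasUp_eq (k : Fin (K + 1)) : hasUp k = 0 ∨ hasUp k = 1 := by
  unfold hasUp; split_ifs <;> simp

lemma hasLo_eq (k : Fin (K + 1)) : hasLo k = 0 ∨ hasLo k = 1 := by
  unfold hasLo; split_ifs <;> simp

lemma cutFun_apply {j : ℕ} (h : j < K) (φ : Param K d) : cutFun K d j φ = cutoffs φ ⟨j, h⟩ := by
  simp [cutFun, h, cutoffs]

lemma latFun_apply (z : ℝ) (x : EuclideanSpace ℝ (Fin d)) (φ : Param K d) :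
    latFun K z x φ = slope φ * z - ∑ j, coeffs φ j * x j := by
  simp [latFun, slope, coeffs, mul_comm]

lemma gapFun_pos {φ : Param K d} (hφ : φ ∈ ordered K d) (k : Fin (K + 1))
    (h : hasUp k * hasLo k ≠ 0) : 0 < gapFun d k φ := by
  have h1 : k.val < K := by
    by_contra h'; simp [hasUp, h'] at h
  have h2 : 0 < k.val := by
    by_contra h'; simp [hasLo, h'] at h
  rw [gapFun, sub_apply, cutFun_apply h1,
    cutFun_apply (show k.val - 1 < K by omega), sub_pos]
  exact hφ (Fin.lt_def.2 (show k.val - 1 < k.val by omega))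

lemma cumProb_eq_up (z : ℝ) (x : EuclideanSpace ℝ (Fin d)) (k : Fin (K + 1)) (φ : Param K d) :
    cumProb (cutoffs φ) (latFun K z x φ) (k.val + 1) =
      if k.val < K then Real.sigmoid (upFun z x k φ) else 1 := by
  by_cases h : k.val < K
  · simp [cumProb, h, upFun, cutFun_apply h]
  · simp [cumProb, h]

lemma cumProb_eq_lo (z : ℝ) (x : EuclideanSpace ℝ (Fin d)) (k : Fin (K + 1)) (φ : Param K d) :
    cumProb (cutoffs φ) (latFun K z x φ) k.val =
      if 0 < k.val then Real.sigmoid (-loFun z x k φ) else 0 := by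
  obtain ⟨k, hk⟩ := k
  cases k with
  | zero => simp [cumProb]
  | succ j =>
    have h : j < K := by omega
    simp [cumProb, h, loFun, cutFun_apply h]

/-- The label probabilities in the coordinates `φ`. -/
lemma ordProb_eq_exp {φ : Param K d} (hφ : φ ∈ ordered K d) (z : ℝ)
    (x : EuclideanSpace ℝ (Fin d)) (k : Fin (K + 1)) :
    ordProb (cutoffs φ) (latFun K z x φ) k = Real.exp (logF z x k φ) := by
  rw [ordProb, cumProb_eq_up, cumProb_eq_lo, logF]
  have hgap := gapFun_pos hφ k
  have e (t : ℝ) : Real.exp (logSig t) = Real.sigmoid t := Real.exp_log (Real.sigmoid_pos t)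
  by_cases h1 : k.val < K <;> by_cases h2 : 0 < k.val
  · simp only [hasUp, hasLo, h1, h2, if_true, one_mul] at hgap ⊢
    have hg := hgap one_ne_zero
    rw [sigmoid_sub_sigmoid, Real.exp_add, Real.exp_add, e, e, neg_neg]
    have : upFun z x k φ - -loFun z x k φ = gapFun d k φ := by
      simp [upFun, loFun, gapFun]
    rw [this, logGap, Real.exp_log]
    rw [sub_pos, Real.exp_lt_one_iff]; linarith
  · simp [hasUp, hasLo, h1, h2, e]
  · simp [hasUp, hasLo, h1, h2, e, Real.sigmoid_neg]
  · have := k.2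
    have hK : K = 0 := by omega
    simp [hasUp, hasLo, h1, h2]

lemma sum_exp_logF {φ : Param K d} (hφ : φ ∈ ordered K d) (z : ℝ)
    (x : EuclideanSpace ℝ (Fin d)) : ∑ k : Fin (K + 1), Real.exp (logF z x k φ) = 1 := by
  simp_rw [← ordProb_eq_exp hφ, ordProb]
  rw [Fin.sum_univ_eq_sum_range (fun k => cumProb (cutoffs φ) (latFun K z x φ) (k + 1) -
    cumProb (cutoffs φ) (latFun K z x φ) k), Finset.sum_range_sub]
  simp [cumProb]

lemma latFun_reparam (z : ℝ) (x : EuclideanSpace ℝ (Fin d)) (θ : Param K d) :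
    latFun K z x (reparam θ) =
      (1 / slope θ) * z - (1 / slope θ) * ∑ j, coeffs θ j * x j := by
  rw [latFun_apply, Finset.mul_sum]
  congr 1
  refine Finset.sum_congr rfl fun j _ => ?_
  simp [coeffs, slope, reparam]
  ring

lemma cutoffs_reparam (θ : Param K d) : cutoffs (reparam θ) = cutoffs θ := by
  ext j; simp [cutoffs, reparam]

lemma slope_reparam (θ : Param K d) : slope (reparam θ) = 1 / slope θ := by
  simp [slope, reparam]

lemma reparam_reparam {θ : Param K d} (h : slope θ ≠ 0) : reparam (reparam θ) = θ := by
  ext a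
  rcases a with j | ⟨⟨⟩⟩ | j
  · simp [reparam]
  · simp [reparam, slope]
  · have h' : θ (Sum.inr (Sum.inl ())) ≠ 0 := h
    simp [reparam, slope, coeffs]
    field_simp

/-- The coordinates `φ` represent the log-likelihood of the model. -/
lemma logLik_eq {θ : Param K d} (hθ : StrictMono (cutoffs θ)) (z : ℝ)
    (x : EuclideanSpace ℝ (Fin d)) (k : Fin (K + 1)) :
    logLik θ z x k = logF z x k (reparam θ) := by
  have h : reparam θ ∈ ordered K d := by
    change StrictMono _; rwa [cutoffs_reparam]
  rw [logLik, lik, ← latFun_reparam, ← cutoffs_reparam, ordProb_eq_exp h, Real.log_exp]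

lemma lik_eq {θ : Param K d} (hθ : StrictMono (cutoffs θ)) (z : ℝ)
    (x : EuclideanSpace ℝ (Fin d)) (k : Fin (K + 1)) :
    lik θ z x k = Real.exp (logF z x k (reparam θ)) := by
  have h : reparam θ ∈ ordered K d := by
    change StrictMono _; rwa [cutoffs_reparam]
  rw [lik, ← latFun_reparam, ← cutoffs_reparam, ordProb_eq_exp h]

lemma convex_ordered : Convex ℝ (ordered K d) := by
  intro φ hφ ψ hψ a b ha hb hab i j hij
  have h1 := hφ hij
  have h2 := hψ hij
  simp only [cutoffs, PiLp.add_apply, PiLp.smul_apply, smul_eq_mul] at h1 h2 ⊢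
  rcases ha.eq_or_lt with rfl | ha
  · simp only [zero_add] at hab; subst hab; linarith
  · nlinarith [mul_lt_mul_of_pos_left h1 ha, mul_le_mul_of_nonneg_left h2.le hb]

lemma continuous_slope : Continuous (slope : Param K d → ℝ) := by
  unfold slope; fun_prop

lemma isOpen_ordered : IsOpen (ordered K d) := by
  have : ordered K d = ⋂ i : Fin K, ⋂ j : Fin K, ⋂ _ : i < j, {φ | φ (Sum.inl i) < φ (Sum.inl j)} := by
    ext φ
    simp only [Set.mem_iInter]
    exact ⟨fun h i j hij => h hij, fun h i j hij => h i j hij⟩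
  rw [this]
  refine isOpen_iInter_of_finite fun i => isOpen_iInter_of_finite fun j =>
    isOpen_iInter_of_finite fun _ => isOpen_lt (by fun_prop) (by fun_prop)

lemma concaveOn_logF (z : ℝ) (x : EuclideanSpace ℝ (Fin d)) (k : Fin (K + 1)) :
    ConcaveOn ℝ (ordered K d) (logF z x k) := by
  have hlin (l : Param K d →L[ℝ] ℝ) : ConcaveOn ℝ (ordered K d) (fun φ => logSig (l φ)) :=
    (concaveOn_logSig.comp_linearMap l.toLinearMap).subset (Set.subset_univ _) convex_ordered
  refine ((((hlin (upFun z x k)).smul (hasUp_nonneg k))).add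
    ((hlin (loFun z x k)).smul (hasLo_nonneg k))).add ?_
  by_cases h : hasUp k * hasLo k = 0
  · simp only [h, zero_mul]
    exact concaveOn_const 0 convex_ordered
  · refine ConcaveOn.smul (c := hasUp k * hasLo k) (mul_nonneg (hasUp_nonneg k) (hasLo_nonneg k)) ?_
    exact (concaveOn_logGap.comp_linearMap (gapFun d k).toLinearMap).subset
      (fun φ hφ => gapFun_pos hφ k h) convex_ordered

/-- Chain rule for `logF` along a curve. -/
lemma hasDerivAt_logF (z : ℝ) (x : EuclideanSpace ℝ (Fin d)) (k : Fin (K + 1))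
    {c : ℝ → Param K d} {c' : Param K d} {s : ℝ} (hc : HasDerivAt c c' s)
    (hs : c s ∈ ordered K d) :
    HasDerivAt (fun s => logF z x k (c s)) (logF₁ z x k (c s) c') s := by
  have hl (l : Param K d →L[ℝ] ℝ) : HasDerivAt (fun s => l (c s)) (l c') s :=
    l.hasFDerivAt.comp_hasDerivAt s hc
  refine HasDerivAt.add (HasDerivAt.add ?_ ?_) ?_
  · exact ((hasDerivAt_logSig _).comp s (hl _)).const_mul _
  · exact ((hasDerivAt_logSig _).comp s (hl _)).const_mul _
  · by_cases h : hasUp k * hasLo k = 0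
    · simp only [h, zero_mul]
      exact hasDerivAt_const _ _
    · exact ((hasDerivAt_logGap (gapFun_pos hs k h)).comp s (hl _)).const_mul _

/-- Second derivative of `logF` along a curve. -/
lemma hasDerivAt_logF₁ (z : ℝ) (x : EuclideanSpace ℝ (Fin d)) (k : Fin (K + 1))
    {c c' : ℝ → Param K d} {c'' : Param K d} {s : ℝ} (hc : HasDerivAt c (c' s) s)
    (hc' : HasDerivAt c' c'' s) (hs : c s ∈ ordered K d) :
    HasDerivAt (fun s => logF₁ z x k (c s) (c' s))
      (logF₂ z x k (c s) (c' s) + logF₁ z x k (c s) c'') s := by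
  have hl (l : Param K d →L[ℝ] ℝ) : HasDerivAt (fun s => l (c s)) (l (c' s)) s :=
    l.hasFDerivAt.comp_hasDerivAt s hc
  have hl' (l : Param K d →L[ℝ] ℝ) : HasDerivAt (fun s => l (c' s)) (l c'') s :=
    l.hasFDerivAt.comp_hasDerivAt s hc'
  have hsig (l : Param K d →L[ℝ] ℝ) : HasDerivAt (fun s => Real.sigmoid (-l (c s)) * l (c' s))
      (-sigVar (l (c s)) * l (c' s) ^ 2 + Real.sigmoid (-l (c s)) * l c'') s := by
    refine (((hasDerivAt_sigmoid_neg _).comp s (hl l)).mul (hl' l)).congr_deriv ?_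
    simp only [Function.comp]
    ring
  have hg : HasDerivAt
      (fun s => hasUp k * hasLo k * (logGapDeriv (gapFun d k (c s)) * gapFun d k (c' s)))
      (hasUp k * hasLo k * (logGapDeriv₂ (gapFun d k (c s)) * gapFun d k (c' s) ^ 2 +
        logGapDeriv (gapFun d k (c s)) * gapFun d k c'')) s := by
    by_cases h : hasUp k * hasLo k = 0
    · simp only [h, zero_mul]
      exact hasDerivAt_const _ _
    · refine HasDerivAt.const_mul _ ?_
      refine (((hasDerivAt_logGapDeriv (gapFun_pos hs k h)).comp s (hl _)).mul
        (hl' _)).congr_deriv ?_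
      simp only [Function.comp]
      ring
  refine ((((hsig (upFun z x k)).const_mul (hasUp k)).add
    ((hsig (loFun z x k)).const_mul (hasLo k))).add hg).congr_deriv ?_
  simp only [logF₁, logF₂]
  ring

lemma contDiff_logSig : ContDiff ℝ 2 logSig :=
  (contDiff_sigmoid.of_le le_top).log fun t => (Real.sigmoid_pos t).ne'

lemma contDiffAt_logF (z : ℝ) (x : EuclideanSpace ℝ (Fin d)) (k : Fin (K + 1))
    {φ : Param K d} (hφ : φ ∈ ordered K d) : ContDiffAt ℝ 2 (logF z x k) φ := by
  have hl (l : Param K d →L[ℝ] ℝ) : ContDiffAt ℝ 2 (fun φ => logSig (l φ)) φ :=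
    (contDiff_logSig.comp l.contDiff).contDiffAt
  refine ((contDiffAt_const.mul (hl _)).add (contDiffAt_const.mul (hl _))).add ?_
  by_cases h : hasUp k * hasLo k = 0
  · simp only [h, zero_mul]
    exact contDiffAt_const
  · have hpos := gapFun_pos hφ k h
    refine contDiffAt_const.mul (ContDiffAt.log ?_ ?_)
    · exact (contDiff_const.sub (gapFun d k).contDiff.neg.exp).contDiffAt
    · have : Real.exp (-gapFun d k φ) < 1 := by rw [Real.exp_lt_one_iff]; linarith
      linarith

end

/-! ### The change of coordinates and the score -/

section

variable {K d : ℕ}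

lemma hasDerivAt_param {c : ℝ → Param K d} {c' : Param K d} {s : ℝ}
    (h : ∀ a, HasDerivAt (fun s => c s a) (c' a) s) : HasDerivAt c c' s := by
  have h1 : HasDerivAt (fun s => WithLp.ofLp (c s)) (WithLp.ofLp c') s := hasDerivAt_pi.2 h
  exact ((PiLp.continuousLinearEquiv 2 ℝ (fun _ : ParamIdx K d => ℝ)).symm.toContinuousLinearMap
    |>.hasFDerivAt).comp_hasDerivAt s h1

/-- The derivative of `reparam` at `θ` in the direction `v`. -/
def reparamDeriv (θ v : Param K d) : Param K d :=
  WithLp.toLp 2 (Sum.elim (fun j => v (Sum.inl j))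
    (Sum.elim (fun _ => -slope v / slope θ ^ 2)
      (fun j => coeffs v j / slope θ - coeffs θ j * slope v / slope θ ^ 2)))

/-- The second derivative of `reparam` at `θ`, as a quadratic map in the direction `v`. -/
def reparamDeriv₂ (θ v : Param K d) : Param K d :=
  WithLp.toLp 2 (Sum.elim (fun _ => 0)
    (Sum.elim (fun _ => 2 * slope v ^ 2 / slope θ ^ 3)
      (fun j => -(2 * coeffs v j * slope v / slope θ ^ 2) +
        2 * coeffs θ j * slope v ^ 2 / slope θ ^ 3)))

lemma hasDerivAt_line (φ v : Param K d) (s : ℝ) :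
    HasDerivAt (fun s : ℝ => φ + s • v) v s := by
  simpa using ((hasDerivAt_id s).smul_const v).const_add φ

lemma hasDerivAt_coord_line (φ v : Param K d) (s : ℝ) (a : ParamIdx K d) :
    HasDerivAt (fun s : ℝ => (φ + s • v) a) (v a) s := by
  simpa using ((hasDerivAt_id s).mul_const (v a)).const_add (φ a)

lemma hasDerivAt_reparam_line (θ v : Param K d) (s : ℝ) (h : slope (θ + s • v) ≠ 0) :
    HasDerivAt (fun s : ℝ => reparam (θ + s • v)) (reparamDeriv (θ + s • v) v) s := by
  refine hasDerivAt_param fun a => ?_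
  have hb := hasDerivAt_coord_line θ v s (Sum.inr (Sum.inl ()))
  have h' : (θ + s • v) (Sum.inr (Sum.inl ())) ≠ 0 := h
  rcases a with j | ⟨⟨⟩⟩ | j
  · exact hasDerivAt_coord_line θ v s _
  · refine ((hasDerivAt_const s (1 : ℝ)).div hb h').congr_deriv ?_
    simp [reparamDeriv, slope]
  · refine ((hasDerivAt_coord_line θ v s (Sum.inr (Sum.inr j))).div hb h').congr_deriv ?_
    change _ = v (Sum.inr (Sum.inr j)) / (θ + s • v) (Sum.inr (Sum.inl ())) -
      (θ + s • v) (Sum.inr (Sum.inr j)) * v (Sum.inr (Sum.inl ())) /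
        (θ + s • v) (Sum.inr (Sum.inl ())) ^ 2
    field_simp

lemma hasDerivAt_reparamDeriv_line (θ v : Param K d) (s : ℝ) (h : slope (θ + s • v) ≠ 0) :
    HasDerivAt (fun s : ℝ => reparamDeriv (θ + s • v) v) (reparamDeriv₂ (θ + s • v) v) s := by
  refine hasDerivAt_param fun a => ?_
  have hb := hasDerivAt_coord_line θ v s (Sum.inr (Sum.inl ()))
  have h' : (θ + s • v) (Sum.inr (Sum.inl ())) ≠ 0 := h
  have h2 : (θ + s • v) (Sum.inr (Sum.inl ())) ^ 2 ≠ 0 := pow_ne_zero 2 h'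
  rcases a with j | ⟨⟨⟩⟩ | j
  · exact hasDerivAt_const _ _
  · refine ((hasDerivAt_const s (-slope v)).div (hb.pow 2) h2).congr_deriv ?_
    change _ = 2 * v (Sum.inr (Sum.inl ())) ^ 2 / (θ + s • v) (Sum.inr (Sum.inl ())) ^ 3
    simp only [slope, Pi.pow_apply]
    field_simp
    push_cast
    ring
  · refine (((hasDerivAt_const s (coeffs v j)).div hb h').sub
      (((hasDerivAt_coord_line θ v s (Sum.inr (Sum.inr j))).mul_const (slope v)).div
        (hb.pow 2) h2)).congr_deriv ?_
    change _ = -(2 * v (Sum.inr (Sum.inr j)) * v (Sum.inr (Sum.inl ())) /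
      (θ + s • v) (Sum.inr (Sum.inl ())) ^ 2) +
      2 * (θ + s • v) (Sum.inr (Sum.inr j)) * v (Sum.inr (Sum.inl ())) ^ 2 /
        (θ + s • v) (Sum.inr (Sum.inl ())) ^ 3
    simp only [slope, coeffs, Pi.pow_apply]
    field_simp
    push_cast
    ring

lemma contDiffAt_reparam {θ : Param K d} (h : slope θ ≠ 0) :
    ContDiffAt ℝ 2 (reparam : Param K d → Param K d) θ := by
  rw [contDiffAt_euclidean]
  have hb : ContDiffAt ℝ 2 (slope : Param K d → ℝ) θ := by unfold slope; fun_prop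
  rintro (j | ⟨⟨⟩⟩ | j)
  · change ContDiffAt ℝ 2 (fun θ : Param K d => θ (Sum.inl j)) θ
    fun_prop
  · exact contDiffAt_const.div hb h
  · change ContDiffAt ℝ 2 (fun θ : Param K d => θ (Sum.inr (Sum.inr j)) / slope θ) θ
    exact ContDiffAt.div (by fun_prop) hb h

lemma hasFDerivAt_reparam {θ : Param K d} (h : slope θ ≠ 0) :
    HasFDerivAt (reparam : Param K d → Param K d) (fderiv ℝ reparam θ) θ :=
  ((contDiffAt_reparam h).differentiableAt two_ne_zero).hasFDerivAt

lemma fderiv_reparam {θ : Param K d} (h : slope θ ≠ 0) (v : Param K d) :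
    fderiv ℝ reparam θ v = reparamDeriv θ v := by
  have h1 := hasDerivAt_reparam_line θ v 0 (by simpa using h)
  have h2 := (hasFDerivAt_reparam h).comp_hasDerivAt_of_eq (0 : ℝ) (hasDerivAt_line θ v 0) (by simp)
  have := h2.unique h1
  simpa using this

lemma slope_ne_zero_nhds {θ : Param K d} (h : slope θ ≠ 0) : ∀ᶠ t in 𝓝 θ, slope t ≠ 0 :=
  continuous_slope.continuousAt.eventually_ne h

/-- The derivatives of the involution `reparam` at corresponding points are inverse. -/
lemma fderiv_reparam_reparam {θ : Param K d} (h : slope θ ≠ 0) (v : Param K d) :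
    fderiv ℝ reparam (reparam θ) (fderiv ℝ reparam θ v) = v := by
  have h' : slope (reparam θ) ≠ 0 := by rw [slope_reparam]; exact one_div_ne_zero h
  have h1 := (hasFDerivAt_reparam h').comp θ (hasFDerivAt_reparam h)
  have h2 : HasFDerivAt (reparam ∘ reparam : Param K d → Param K d)
      (ContinuousLinearMap.id ℝ _) θ := by
    refine (hasFDerivAt_id θ).congr_of_eventuallyEq ?_
    filter_upwards [slope_ne_zero_nhds h] with t ht
    exact reparam_reparam ht
  have := h1.unique h2
  exact congrArg (fun L => L v) this

lemma reparam_mem_ordered {θ : Param K d} (h : θ ∈ paramDomain K d) :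
    reparam θ ∈ ordered K d := by
  change StrictMono _
  rw [cutoffs_reparam]
  exact h.1

lemma isOpen_paramDomain : IsOpen (paramDomain K d) :=
  (isOpen_ordered (K := K) (d := d)).inter (isOpen_ne_fun continuous_slope continuous_const)

lemma contDiffAt_logLik (z : ℝ) (x : EuclideanSpace ℝ (Fin d)) (k : Fin (K + 1))
    {θ : Param K d} (h : θ ∈ paramDomain K d) :
    ContDiffAt ℝ 2 (fun t : Param K d => logLik t z x k) θ := by
  refine (((contDiffAt_logF z x k (reparam_mem_ordered h)).comp θ
    (contDiffAt_reparam h.2))).congr_of_eventuallyEq ?_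
  filter_upwards [isOpen_paramDomain.mem_nhds h] with t ht
  exact logLik_eq ht.1 z x k

/-- The score in the coordinates `φ`. -/
lemma inner_score (z : ℝ) (x : EuclideanSpace ℝ (Fin d)) (k : Fin (K + 1))
    {θ : Param K d} (h : θ ∈ paramDomain K d) (v : Param K d) :
    inner ℝ (score θ z x k) v = logF₁ z x k (reparam θ) (reparamDeriv θ v) := by
  have h1 : HasFDerivAt (fun t : Param K d => logLik t z x k) _ θ :=
    ((contDiffAt_logLik z x k h).differentiableAt two_ne_zero).hasFDerivAt
  have h2 := h1.comp_hasDerivAt_of_eq (0 : ℝ) (hasDerivAt_line θ v 0) (by simp)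
  have h0 : θ + (0 : ℝ) • v = θ := by simp
  have h3 := hasDerivAt_logF z x k (hasDerivAt_reparam_line θ v 0 (by rw [h0]; exact h.2))
    (by rw [h0]; exact reparam_mem_ordered h)
  have h4 := h3.congr_of_eventuallyEq (f₁ := (fun t : Param K d => logLik t z x k) ∘
      fun s : ℝ => θ + s • v) (by
    have hc : Tendsto (fun s : ℝ => θ + s • v) (𝓝 0) (𝓝 θ) := by
      simpa using (hasDerivAt_line θ v 0).continuousAt.tendsto
    filter_upwards [hc (isOpen_paramDomain.mem_nhds h)] with s hs
    exact logLik_eq hs.1 z x k)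
  have h5 := h2.unique h4
  rw [h0] at h5
  rw [← h5, score, gradient, InnerProductSpace.toDual_symm_apply]

lemma differentiableAt_score (z : ℝ) (x : EuclideanSpace ℝ (Fin d)) (k : Fin (K + 1))
    {θ : Param K d} (h : θ ∈ paramDomain K d) :
    DifferentiableAt ℝ (fun t : Param K d => score t z x k) θ := by
  have h1 := ((contDiffAt_logLik z x k h).fderiv_right (m := 1) (by norm_num)).differentiableAt
    one_ne_zero
  exact ((InnerProductSpace.toDual ℝ (Param K d)).symm.toContinuousLinearEquiv
    |>.differentiableAt).comp θ h1

/-- The Hessian in the coordinates `φ`. -/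
lemma inner_hessLogLik (z : ℝ) (x : EuclideanSpace ℝ (Fin d)) (k : Fin (K + 1))
    {θ : Param K d} (h : θ ∈ paramDomain K d) (v : Param K d) :
    inner ℝ (hessLogLik θ z x k v) v =
      logF₂ z x k (reparam θ) (reparamDeriv θ v) +
        logF₁ z x k (reparam θ) (reparamDeriv₂ θ v) := by
  have h0 : θ + (0 : ℝ) • v = θ := by simp
  have h2 := (differentiableAt_score z x k h).hasFDerivAt.comp_hasDerivAt_of_eq (0 : ℝ)
    (hasDerivAt_line θ v 0) (by simp)
  have h2' := h2.inner ℝ (hasDerivAt_const (0 : ℝ) v)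
  have hs : slope (θ + (0 : ℝ) • v) ≠ 0 := by rw [h0]; exact h.2
  have h3 := hasDerivAt_logF₁ z x k (hasDerivAt_reparam_line θ v 0 hs)
    (hasDerivAt_reparamDeriv_line θ v 0 hs) (by rw [h0]; exact reparam_mem_ordered h)
  have h4 := h3.congr_of_eventuallyEq (f₁ := fun s : ℝ => inner ℝ (((fun t : Param K d =>
      score t z x k) ∘ fun s : ℝ => θ + s • v) s) v) (by
    have hc : Tendsto (fun s : ℝ => θ + s • v) (𝓝 0) (𝓝 θ) := by
      simpa using (hasDerivAt_line θ v 0).continuousAt.tendsto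
    filter_upwards [hc (isOpen_paramDomain.mem_nhds h)] with s hs
    exact inner_score z x k hs v)
  have h5 := h2'.unique h4
  simpa [hessLogLik, h0] using h5

end

/-! ### Envelopes for the derivatives of the log-likelihood -/

section

variable {K d : ℕ}

/-- Minus the second derivative of `logF` with respect to the latent value. -/
def curv (z : ℝ) (x : EuclideanSpace ℝ (Fin d)) (k : Fin (K + 1)) (φ : Param K d) : ℝ :=
  hasUp k * sigVar (upFun z x k φ) + hasLo k * sigVar (loFun z x k φ)

/-- The derivative of `logF` with respect to the latent value. -/
def latScore (z : ℝ) (x : EuclideanSpace ℝ (Fin d)) (k : Fin (K + 1)) (φ : Param K d) : ℝ :=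
  hasLo k * Real.sigmoid (-loFun z x k φ) - hasUp k * Real.sigmoid (-upFun z x k φ)

/-- The coefficients `(z, -x)` of the latent value as a linear functional of `(b, c)`. -/
def covar (z : ℝ) (x : EuclideanSpace ℝ (Fin d)) : Unit ⊕ Fin d → ℝ :=
  Sum.elim (fun _ => z) (fun j => -x j)

lemma latFun_eq_sum (z : ℝ) (x : EuclideanSpace ℝ (Fin d)) (φ : Param K d) :
    latFun K z x φ = ∑ a, φ (Sum.inr a) * covar z x a := by
  simp [latFun_apply, covar, slope, coeffs, sub_eq_add_neg]

lemma sum_covar_sq (z : ℝ) (x : EuclideanSpace ℝ (Fin d)) :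
    ∑ a, covar z x a ^ 2 = z ^ 2 + ‖x‖ ^ 2 := by
  simp [covar, EuclideanSpace.norm_sq_eq]

lemma cutFun_single (j : ℕ) (a : Unit ⊕ Fin d) (r : ℝ) :
    cutFun K d j (EuclideanSpace.single (Sum.inr a) r) = 0 := by
  by_cases h : j < K
  · simp [cutFun_apply h, cutoffs]
  · simp [cutFun, h]

lemma latFun_single (z : ℝ) (x : EuclideanSpace ℝ (Fin d)) (a : Unit ⊕ Fin d) (r : ℝ) :
    latFun K z x (EuclideanSpace.single (Sum.inr a) r) = r * covar z x a := by
  rw [latFun_eq_sum]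
  simp [PiLp.single_apply]

lemma upFun_single (z : ℝ) (x : EuclideanSpace ℝ (Fin d)) (k : Fin (K + 1)) (a : Unit ⊕ Fin d)
    (r : ℝ) : upFun z x k (EuclideanSpace.single (Sum.inr a) r) = -(r * covar z x a) := by
  simp [upFun, cutFun_single, latFun_single]

lemma loFun_single (z : ℝ) (x : EuclideanSpace ℝ (Fin d)) (k : Fin (K + 1)) (a : Unit ⊕ Fin d)
    (r : ℝ) : loFun z x k (EuclideanSpace.single (Sum.inr a) r) = r * covar z x a := by
  simp [loFun, cutFun_single, latFun_single]

lemma gapFun_single (k : Fin (K + 1)) (a : Unit ⊕ Fin d) (r : ℝ) :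
    gapFun d k (EuclideanSpace.single (Sum.inr a) r : Param K d) = 0 := by
  simp [gapFun, cutFun_single]

lemma logF₁_single (z : ℝ) (x : EuclideanSpace ℝ (Fin d)) (k : Fin (K + 1)) (φ : Param K d)
    (a : Unit ⊕ Fin d) :
    logF₁ z x k φ (EuclideanSpace.single (Sum.inr a) 1) = latScore z x k φ * covar z x a := by
  simp only [logF₁, upFun_single, loFun_single, gapFun_single, latScore]
  ring

lemma logF₂_single (z : ℝ) (x : EuclideanSpace ℝ (Fin d)) (k : Fin (K + 1)) (φ : Param K d)
    (a : Unit ⊕ Fin d) :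
    logF₂ z x k φ (EuclideanSpace.single (Sum.inr a) 1) = -(curv z x k φ * covar z x a ^ 2) := by
  simp only [logF₂, upFun_single, loFun_single, gapFun_single, curv]
  ring

lemma curv_nonneg (z : ℝ) (x : EuclideanSpace ℝ (Fin d)) (k : Fin (K + 1)) (φ : Param K d) :
    0 ≤ curv z x k φ :=
  add_nonneg (mul_nonneg (hasUp_nonneg k) (sigVar_pos _).le)
    (mul_nonneg (hasLo_nonneg k) (sigVar_pos _).le)

lemma curv_le_one (z : ℝ) (x : EuclideanSpace ℝ (Fin d)) (k : Fin (K + 1)) (φ : Param K d) :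
    curv z x k φ ≤ 1 := by
  have h1 := sigVar_le (upFun z x k φ)
  have h2 := sigVar_le (loFun z x k φ)
  have h3 := sigVar_pos (upFun z x k φ)
  have h4 := sigVar_pos (loFun z x k φ)
  have h5 : hasUp k * sigVar (upFun z x k φ) ≤ 1 * sigVar (upFun z x k φ) :=
    mul_le_mul_of_nonneg_right (hasUp_le_one k) h3.le
  have h6 : hasLo k * sigVar (loFun z x k φ) ≤ 1 * sigVar (loFun z x k φ) :=
    mul_le_mul_of_nonneg_right (hasLo_le_one k) h4.le
  rw [curv]
  linarith

/-- On an interval `[a, b]` of latent values the curvature of the log-likelihood is controlled by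
the curvature and the squared score at the two endpoints.  There is one curvature term for each of
the cutoffs `p` and `q`, and it decreases with the distance to its cutoff.  If the cutoff is not
inside the interval, then the term is at most its value at one of the endpoints; if it is, then the
score at one of the endpoints is bounded away from zero. -/
lemma exists_curv_le {e₁ e₂ p q : ℝ} (h₁ : e₁ = 0 ∨ e₁ = 1) (h₂ : e₂ = 0 ∨ e₂ = 1)
    (hpq : e₁ * e₂ ≠ 0 → q < p) :
    ∃ C, 0 ≤ C ∧ ∀ a t b, a ≤ t → t ≤ b →
      e₁ * sigVar (p - t) + e₂ * sigVar (t - q) ≤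
        C * ((e₁ * sigVar (p - a) + e₂ * sigVar (a - q) +
            (e₂ * Real.sigmoid (q - a) - e₁ * Real.sigmoid (a - p)) ^ 2) +
          (e₁ * sigVar (p - b) + e₂ * sigVar (b - q) +
            (e₂ * Real.sigmoid (q - b) - e₁ * Real.sigmoid (b - p)) ^ 2)) := by
  set c := 1 / 2 - e₁ * e₂ * Real.sigmoid (q - p) with hc
  have hhalf : Real.sigmoid 0 = 1 / 2 := by rw [Real.sigmoid_zero]; norm_num
  have h₁0 : 0 ≤ e₁ := by rcases h₁ with h | h <;> rw [h]; norm_num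
  have h₂0 : 0 ≤ e₂ := by rcases h₂ with h | h <;> rw [h]; norm_num
  have hcpos : 0 < c := by
    by_cases h : e₁ * e₂ = 0
    · rw [hc, h]; norm_num
    · have h' : e₁ * e₂ = 1 := by
        rcases h₁ with h₁ | h₁ <;> rcases h₂ with h₂ | h₂ <;> simp_all
      rw [hc, h', one_mul, sub_pos, ← hhalf]
      exact Real.sigmoid_lt (by linarith [hpq h])
  refine ⟨1 + 1 / c ^ 2, by positivity, fun a t b hat htb => ?_⟩
  set Sa := e₂ * Real.sigmoid (q - a) - e₁ * Real.sigmoid (a - p) with hSa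
  set Sb := e₂ * Real.sigmoid (q - b) - e₁ * Real.sigmoid (b - p) with hSb
  have hup : e₁ * sigVar (p - t) ≤
      e₁ * sigVar (p - a) + e₁ * sigVar (p - b) + 1 / c ^ 2 * Sb ^ 2 := by
    have n1 : 0 ≤ 1 / c ^ 2 * Sb ^ 2 := by positivity
    have n2 := mul_nonneg h₁0 (sigVar_pos (p - a)).le
    have n3 := mul_nonneg h₁0 (sigVar_pos (p - b)).le
    rcases le_total b p with hb | hb
    · have := mul_le_mul_of_nonneg_left (sigVar_anti (s := p - b) (t := p - t)
        (by rw [abs_of_nonneg, abs_of_nonneg] <;> linarith)) h₁0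
      linarith
    rcases le_total p a with ha | ha
    · have := mul_le_mul_of_nonneg_left (sigVar_anti (s := p - a) (t := p - t)
        (by rw [abs_of_nonpos, abs_of_nonpos] <;> linarith)) h₁0
      linarith
    rcases h₁ with h | h
    · rw [h]; linarith
    · have hS : Sb ≤ -c := by
        have e1 := mul_le_mul_of_nonneg_left (Real.sigmoid_le (show q - b ≤ q - p by linarith)) h₂0
        have e2 := Real.sigmoid_le (show (0 : ℝ) ≤ b - p by linarith)
        rw [hhalf] at e2
        rw [hSb, hc, h]
        linarith
      have : 1 ≤ 1 / c ^ 2 * Sb ^ 2 := by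
        rw [one_div, ← div_eq_inv_mul, one_le_div (by positivity)]
        nlinarith
      rw [h] at n2 n3 ⊢
      linarith [sigVar_le (p - t)]
  have hlo : e₂ * sigVar (t - q) ≤
      e₂ * sigVar (a - q) + e₂ * sigVar (b - q) + 1 / c ^ 2 * Sa ^ 2 := by
    have n1 : 0 ≤ 1 / c ^ 2 * Sa ^ 2 := by positivity
    have n2 := mul_nonneg h₂0 (sigVar_pos (a - q)).le
    have n3 := mul_nonneg h₂0 (sigVar_pos (b - q)).le
    rcases le_total b q with hb | hb
    · have := mul_le_mul_of_nonneg_left (sigVar_anti (s := b - q) (t := t - q)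
        (by rw [abs_of_nonpos, abs_of_nonpos] <;> linarith)) h₂0
      linarith
    rcases le_total q a with ha | ha
    · have := mul_le_mul_of_nonneg_left (sigVar_anti (s := a - q) (t := t - q)
        (by rw [abs_of_nonneg, abs_of_nonneg] <;> linarith)) h₂0
      linarith
    rcases h₂ with h | h
    · rw [h]; linarith
    · have hS : c ≤ Sa := by
        have e1 := mul_le_mul_of_nonneg_left (Real.sigmoid_le (show a - p ≤ q - p by linarith)) h₁0
        have e2 := Real.sigmoid_le (show (0 : ℝ) ≤ q - a by linarith)
        rw [hhalf] at e2
        rw [hSa, hc, h]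
        linarith
      have : 1 ≤ 1 / c ^ 2 * Sa ^ 2 := by
        rw [one_div, ← div_eq_inv_mul, one_le_div (by positivity)]
        nlinarith
      rw [h] at n2 n3 ⊢
      linarith [sigVar_le (t - q)]
  have m1 := mul_nonneg h₁0 (sigVar_pos (p - a)).le
  have m2 := mul_nonneg h₁0 (sigVar_pos (p - b)).le
  have m3 := mul_nonneg h₂0 (sigVar_pos (a - q)).le
  have m4 := mul_nonneg h₂0 (sigVar_pos (b - q)).le
  have m5 : 0 ≤ 1 / c ^ 2 := by positivity
  have m6 := mul_nonneg m5 (add_nonneg (add_nonneg m1 m2) (add_nonneg m3 m4))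
  nlinarith [sq_nonneg Sa, sq_nonneg Sb]

/-- The curvature changes boundedly when the two functionals change boundedly. -/
lemma curv_le_exp_mul {z z' r : ℝ} {x : EuclideanSpace ℝ (Fin d)} {k : Fin (K + 1)}
    {φ ψ : Param K d} (h₁ : |upFun z x k φ - upFun z' x k ψ| ≤ r)
    (h₂ : |loFun z x k φ - loFun z' x k ψ| ≤ r) :
    curv z x k φ ≤ Real.exp r * curv z' x k ψ := by
  have key {s t : ℝ} (h : |s - t| ≤ r) : sigVar s ≤ Real.exp r * sigVar t :=
    (sigVar_le_exp_mul s t).trans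
      (mul_le_mul_of_nonneg_right (Real.exp_le_exp.2 h) (sigVar_pos t).le)
  have e1 := mul_le_mul_of_nonneg_left (key h₁) (hasUp_nonneg k)
  have e2 := mul_le_mul_of_nonneg_left (key h₂) (hasLo_nonneg k)
  rw [curv, curv]
  linarith

lemma abs_apply_le_norm (φ : Param K d) (a : ParamIdx K d) : |φ a| ≤ ‖φ‖ := by
  simpa using PiLp.norm_apply_le φ a

lemma abs_cutFun_le (j : ℕ) (v : Param K d) : |cutFun K d j v| ≤ ‖v‖ := by
  by_cases h : j < K
  · rw [cutFun_apply h]; exact abs_apply_le_norm v _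
  · simp [cutFun, h]

/-- The value of the curvature at a parameter close to `ψ` is controlled by the curvature and the
squared score at the points `ψ ± r e_a`, where `e_a` are the coordinate directions of `(b, c)`. -/
lemma exists_curv_le_vertices {ψ : Param K d} (hψ : ψ ∈ ordered K d) {r : ℝ} (hr : 0 < r) :
    ∃ C ε : ℝ, 0 ≤ C ∧ 0 < ε ∧ ∀ (z : ℝ) (x : EuclideanSpace ℝ (Fin d)) (k : Fin (K + 1))
      (φ : Param K d), ‖φ - ψ‖ ≤ ε → curv z x k φ ≤ C * ∑ a : Unit ⊕ Fin d,
        ((curv z x k (ψ - EuclideanSpace.single (Sum.inr a) r) +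
            latScore z x k (ψ - EuclideanSpace.single (Sum.inr a) r) ^ 2) +
          (curv z x k (ψ + EuclideanSpace.single (Sum.inr a) r) +
            latScore z x k (ψ + EuclideanSpace.single (Sum.inr a) r) ^ 2)) := by
  have hex (k : Fin (K + 1)) := exists_curv_le (hasUp_eq k) (hasLo_eq k)
    (p := cutFun K d k ψ) (q := cutFun K d (k - 1) ψ) (fun h => by
      have := gapFun_pos hψ k h
      rw [gapFun, sub_apply] at this
      linarith)
  choose C hC0 hC using hex
  have hCsum (k : Fin (K + 1)) : C k ≤ ∑ k, C k :=
    Finset.single_le_sum (fun k _ => hC0 k) (Finset.mem_univ k)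
  have hCs : 0 ≤ ∑ k, C k := Finset.sum_nonneg fun k _ => hC0 k
  refine ⟨Real.exp 1 * ∑ k, C k, min 1 (r / (d + 1)), by positivity, by positivity, ?_⟩
  intro z x k φ hφ
  -- Only the largest covariate matters: moving its coefficient by `± r` moves the latent value by at
  -- least as much as the step from `ψ` to `φ` does.
  obtain ⟨j, -, hj⟩ := Finset.exists_max_image Finset.univ (fun a => |covar z x a|)
    ⟨Sum.inl (), Finset.mem_univ _⟩
  have hlat : |latFun K z x φ - latFun K z x ψ| ≤ r * |covar z x j| := by
    rw [← map_sub, latFun_eq_sum]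
    calc |∑ a, (φ - ψ) (Sum.inr a) * covar z x a|
        ≤ ∑ a : Unit ⊕ Fin d, |(φ - ψ) (Sum.inr a) * covar z x a| := Finset.abs_sum_le_sum_abs _ _
      _ ≤ ∑ _a : Unit ⊕ Fin d, (r / (d + 1)) * |covar z x j| := by
          refine Finset.sum_le_sum fun a _ => ?_
          rw [abs_mul]
          refine mul_le_mul ?_ (hj a (Finset.mem_univ a)) (abs_nonneg _) (by positivity)
          exact (abs_apply_le_norm _ _).trans (hφ.trans (min_le_right _ _))
      _ = r * |covar z x j| := by
          simp
          field_simp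
          ring
  set t := latFun K z x φ
  set t₀ := latFun K z x ψ with ht₀
  set m := r * |covar z x j| with hm
  -- Replace the cutoffs of `φ` by those of `ψ`, at the cost of the factor `exp 1`.
  have hcut (j : ℕ) : |cutFun K d j φ - cutFun K d j ψ| ≤ 1 := by
    rw [← map_sub]
    exact (abs_cutFun_le _ _).trans (hφ.trans (min_le_left _ _))
  have h1 : curv z x k φ ≤ Real.exp 1 *
      (hasUp k * sigVar (cutFun K d k ψ - t) + hasLo k * sigVar (t - cutFun K d (k - 1) ψ)) := by
    have key {s t : ℝ} (h : |s - t| ≤ 1) : sigVar s ≤ Real.exp 1 * sigVar t :=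
      (sigVar_le_exp_mul s t).trans
        (mul_le_mul_of_nonneg_right (Real.exp_le_exp.2 h) (sigVar_pos t).le)
    have e1 := mul_le_mul_of_nonneg_left (key (s := upFun z x k φ) (t := cutFun K d k ψ - t)
      (by simpa [upFun, t] using hcut k)) (hasUp_nonneg k)
    have e2 := mul_le_mul_of_nonneg_left (key (s := loFun z x k φ)
      (t := t - cutFun K d (k - 1) ψ)
      (by simpa [loFun, t, abs_sub_comm] using hcut (k - 1))) (hasLo_nonneg k)
    rw [curv]
    linarith
  have h2 := hC k (t₀ - m) t (t₀ + m) (by linarith [neg_abs_le (t - t₀)])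
    (by linarith [le_abs_self (t - t₀)])
  set E : Param K d → ℝ := fun φ => curv z x k φ + latScore z x k φ ^ 2 with hE
  have hE0 (φ) : 0 ≤ E φ := add_nonneg (curv_nonneg _ _ _ _) (sq_nonneg _)
  have hEp (s : ℝ) : E (ψ + EuclideanSpace.single (Sum.inr j) s) =
      hasUp k * sigVar (cutFun K d k ψ - (t₀ + s * covar z x j)) +
        hasLo k * sigVar (t₀ + s * covar z x j - cutFun K d (k - 1) ψ) +
      (hasLo k * Real.sigmoid (cutFun K d (k - 1) ψ - (t₀ + s * covar z x j)) -
        hasUp k * Real.sigmoid (t₀ + s * covar z x j - cutFun K d k ψ)) ^ 2 := by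
    simp only [hE, curv, latScore, map_add, upFun_single, loFun_single]
    simp only [upFun, loFun, sub_apply, ← ht₀]
    have e1 : cutFun K d k ψ - t₀ + -(s * covar z x j) =
        cutFun K d k ψ - (t₀ + s * covar z x j) := by ring
    have e2 : t₀ - cutFun K d (k - 1) ψ + s * covar z x j =
        t₀ + s * covar z x j - cutFun K d (k - 1) ψ := by ring
    rw [e1, e2, neg_sub, neg_sub]
  have hEm : ψ - EuclideanSpace.single (Sum.inr j) r =
      ψ + EuclideanSpace.single (Sum.inr j) (-r) := by
    ext a; simp [PiLp.single_apply]; split_ifs <;> ring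
  have h3 : hasUp k * sigVar (cutFun K d k ψ - t) + hasLo k * sigVar (t - cutFun K d (k - 1) ψ) ≤
      C k * (E (ψ - EuclideanSpace.single (Sum.inr j) r) +
        E (ψ + EuclideanSpace.single (Sum.inr j) r)) := by
    rw [hEm, hEp, hEp]
    rcases abs_cases (covar z x j) with ⟨h, -⟩ | ⟨h, -⟩
    · rw [hm, h] at h2
      convert h2 using 3; ring_nf
    · rw [hm, h] at h2
      rw [add_comm (_ + _ ^ 2)]
      convert h2 using 3 <;> ring_nf
  have h4 : E (ψ - EuclideanSpace.single (Sum.inr j) r) +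
        E (ψ + EuclideanSpace.single (Sum.inr j) r) ≤ ∑ a : Unit ⊕ Fin d,
      (E (ψ - EuclideanSpace.single (Sum.inr a) r) +
        E (ψ + EuclideanSpace.single (Sum.inr a) r)) :=
    Finset.single_le_sum (f := fun a : Unit ⊕ Fin d =>
      E (ψ - EuclideanSpace.single (Sum.inr a) r) + E (ψ + EuclideanSpace.single (Sum.inr a) r))
      (fun a _ => add_nonneg (hE0 _) (hE0 _)) (Finset.mem_univ j)
  have h5 : C k * (E (ψ - EuclideanSpace.single (Sum.inr j) r) +
      E (ψ + EuclideanSpace.single (Sum.inr j) r)) ≤ (∑ k, C k) * ∑ a : Unit ⊕ Fin d,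
      (E (ψ - EuclideanSpace.single (Sum.inr a) r) +
        E (ψ + EuclideanSpace.single (Sum.inr a) r)) :=
    mul_le_mul (hCsum k) h4 (add_nonneg (hE0 _) (hE0 _)) hCs
  rw [mul_assoc]
  exact h1.trans (mul_le_mul_of_nonneg_left (h3.trans h5) (Real.exp_pos 1).le)

/-! ### Moments near the true parameter -/

lemma measurable_upFun (k : Fin (K + 1)) (φ : Param K d) :
    Measurable fun p : ℝ × EuclideanSpace ℝ (Fin d) => upFun p.1 p.2 k φ := by
  simp only [upFun, sub_apply, latFun_apply]; fun_prop

lemma measurable_loFun (k : Fin (K + 1)) (φ : Param K d) :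
    Measurable fun p : ℝ × EuclideanSpace ℝ (Fin d) => loFun p.1 p.2 k φ := by
  simp only [loFun, sub_apply, latFun_apply]; fun_prop

lemma measurable_sigmoid : Measurable Real.sigmoid := continuous_sigmoid.measurable

lemma measurable_sigVar : Measurable sigVar := continuous_sigVar.measurable

lemma measurable_logF₁ (k : Fin (K + 1)) (φ v : Param K d) :
    Measurable fun p : ℝ × EuclideanSpace ℝ (Fin d) => logF₁ p.1 p.2 k φ v := by
  have h1 := measurable_upFun k φ
  have h2 := measurable_upFun k v
  have h3 := measurable_loFun k φ
  have h4 := measurable_loFun k v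
  have h5 := measurable_sigmoid.comp h1.neg
  have h6 := measurable_sigmoid.comp h3.neg
  exact (((h5.mul h2).const_mul _).add ((h6.mul h4).const_mul _)).add_const _

lemma measurable_logF₂ (k : Fin (K + 1)) (φ v : Param K d) :
    Measurable fun p : ℝ × EuclideanSpace ℝ (Fin d) => logF₂ p.1 p.2 k φ v := by
  have h1 := measurable_upFun k φ
  have h2 := measurable_upFun k v
  have h3 := measurable_loFun k φ
  have h4 := measurable_loFun k v
  have h5 := (measurable_sigVar.comp h1).neg
  have h6 := (measurable_sigVar.comp h3).neg
  exact (((h5.mul (h2.pow_const 2)).const_mul _).add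
    ((h6.mul (h4.pow_const 2)).const_mul _)).add_const _

lemma measurable_curv (k : Fin (K + 1)) (φ : Param K d) :
    Measurable fun p : ℝ × EuclideanSpace ℝ (Fin d) => curv p.1 p.2 k φ :=
  ((measurable_sigVar.comp (measurable_upFun k φ)).const_mul _).add
    ((measurable_sigVar.comp (measurable_loFun k φ)).const_mul _)

lemma measurable_latScore (k : Fin (K + 1)) (φ : Param K d) :
    Measurable fun p : ℝ × EuclideanSpace ℝ (Fin d) => latScore p.1 p.2 k φ :=
  ((measurable_sigmoid.comp (measurable_loFun k φ).neg).const_mul _).sub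
    ((measurable_sigmoid.comp (measurable_upFun k φ).neg).const_mul _)

section Human

variable {Ω 𝓥 : Type*} [MeasurableSpace Ω]
  {μ : Measure Ω} {V : ℕ → Ω → 𝓥} {Y : ℕ → Ω → Fin (K + 1)}
  {g : 𝓥 → EuclideanSpace ℝ (Fin d)} {ζ : 𝓥 → ℝ} {θs : Param K d}

/-- In the coordinates `φ` the first derivatives of the log-likelihood are square integrable and
the second derivatives are integrable, at every parameter close to the true one. -/
lemma eventually_moments [IsFiniteMeasure μ] (hθ : θs ∈ paramDomain K d)
    (hmom : MomentsAndInformation μ V Y g ζ θs) :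
    ∀ᶠ φ in 𝓝 (reparam θs), ∀ v : Param K d,
      MemLp (fun ω => logF₁ (ζ (V 0 ω)) (g (V 0 ω)) (Y 0 ω) φ v) 2 μ ∧
      Integrable (fun ω => logF₂ (ζ (V 0 ω)) (g (V 0 ω)) (Y 0 ω) φ v) μ := by
  have hs : slope (reparam θs) ≠ 0 := by rw [slope_reparam]; exact one_div_ne_zero hθ.2
  have hcont : Tendsto (reparam : Param K d → Param K d) (𝓝 (reparam θs)) (𝓝 θs) := by
    have := (contDiffAt_reparam hs).continuousAt.tendsto
    rwa [reparam_reparam hθ.2] at this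
  filter_upwards [hcont.eventually hmom.moments, hcont (isOpen_paramDomain.mem_nhds hθ),
    slope_ne_zero_nhds hs] with φ hφ hdom hsφ
  set θ := reparam φ
  have hφθ : reparam θ = φ := reparam_reparam hsφ
  replace hdom : θ ∈ paramDomain K d := hdom
  have hJ (v : Param K d) : reparamDeriv θ (fderiv ℝ reparam φ v) = v := by
    rw [← fderiv_reparam hdom.2, fderiv_reparam_reparam hsφ]
  have hm1 (v : Param K d) :
      MemLp (fun ω => logF₁ (ζ (V 0 ω)) (g (V 0 ω)) (Y 0 ω) φ v) 2 μ := by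
    have h := hφ.1.inner_const (𝕜 := ℝ) (fderiv ℝ reparam φ v)
    simp_rw [inner_score _ _ _ hdom, hφθ, hJ] at h
    exact h
  refine fun v => ⟨hm1 v, ?_⟩
  have h := ((hφ.2.apply_continuousLinearMap (fderiv ℝ reparam φ v)).inner_const (𝕜 := ℝ)
    (fderiv ℝ reparam φ v)).sub
      ((hm1 (reparamDeriv₂ θ (fderiv ℝ reparam φ v))).integrable one_le_two)
  simp_rw [Pi.sub_def, inner_hessLogLik _ _ _ hdom, hφθ, hJ, add_sub_cancel_right] at h
  exact h

lemma HumanModel.measurable_obs [MeasurableSpace 𝓥] (hm : HumanModel μ V Y g ζ θs)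
    {f : ℝ → EuclideanSpace ℝ (Fin d) → Fin (K + 1) → ℝ}
    (hf : ∀ k, Measurable fun p : ℝ × EuclideanSpace ℝ (Fin d) => f p.1 p.2 k) (i : ℕ) :
    Measurable fun ω => f (ζ (V i ω)) (g (V i ω)) (Y i ω) := by
  have h : Measurable fun p : Fin (K + 1) × (ℝ × EuclideanSpace ℝ (Fin d)) =>
      f p.2.1 p.2.2 p.1 := measurable_from_prod_countable_right fun k => hf k
  exact h.comp ((hm.meas_Y i).prodMk
    ((hm.meas_ζ.comp (hm.meas_V i)).prodMk (hm.meas_g.comp (hm.meas_V i))))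

lemma integrable_curv_latScore {φ : Param K d}
    (h : ∀ v : Param K d,
      MemLp (fun ω => logF₁ (ζ (V 0 ω)) (g (V 0 ω)) (Y 0 ω) φ v) 2 μ ∧
      Integrable (fun ω => logF₂ (ζ (V 0 ω)) (g (V 0 ω)) (Y 0 ω) φ v) μ) :
    Integrable (fun ω => (ζ (V 0 ω) ^ 2 + ‖g (V 0 ω)‖ ^ 2) *
      (curv (ζ (V 0 ω)) (g (V 0 ω)) (Y 0 ω) φ +
        latScore (ζ (V 0 ω)) (g (V 0 ω)) (Y 0 ω) φ ^ 2)) μ := by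
  have h1 : Integrable (fun ω => ∑ a : Unit ⊕ Fin d,
      (-logF₂ (ζ (V 0 ω)) (g (V 0 ω)) (Y 0 ω) φ (EuclideanSpace.single (Sum.inr a) 1) +
        logF₁ (ζ (V 0 ω)) (g (V 0 ω)) (Y 0 ω) φ (EuclideanSpace.single (Sum.inr a) 1) ^ 2)) μ :=
    integrable_finsetSum _ fun a _ => (h _).2.neg.add (h _).1.integrable_sq
  refine h1.congr (ae_of_all _ fun ω => ?_)
  simp only [logF₁_single, logF₂_single]
  rw [← sum_covar_sq, Finset.sum_mul]
  exact Finset.sum_congr rfl fun a _ => by ring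

/-- The curvature of the log-likelihood, weighted by the squared size of the covariates, has an
integrable envelope near the true parameter.  The moment conditions are only pointwise in the
parameter; a uniform bound follows because the curvature near the true parameter is controlled by
the values at finitely many parameters. -/
lemma exists_envelope [IsFiniteMeasure μ] (hθ : θs ∈ paramDomain K d)
    (hmom : MomentsAndInformation μ V Y g ζ θs) :
    ∃ (ε : ℝ) (D : ℝ → EuclideanSpace ℝ (Fin d) → Fin (K + 1) → ℝ), 0 < ε ∧
      (∀ k, Measurable fun p : ℝ × EuclideanSpace ℝ (Fin d) => D p.1 p.2 k) ∧
      (∀ z x k, 0 ≤ D z x k) ∧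
      Integrable (fun ω => D (ζ (V 0 ω)) (g (V 0 ω)) (Y 0 ω)) μ ∧
      ∀ z x k φ, ‖φ - reparam θs‖ ≤ ε → (z ^ 2 + ‖x‖ ^ 2) * curv z x k φ ≤ D z x k := by
  obtain ⟨r, hr, hball⟩ := Metric.eventually_nhds_iff_ball.1 (eventually_moments hθ hmom)
  obtain ⟨C, ε, hC, hε, hcurv⟩ := exists_curv_le_vertices (reparam_mem_ordered hθ)
    (half_pos hr)
  set ψ := reparam θs with hψ
  set e : Unit ⊕ Fin d → Param K d := fun a => EuclideanSpace.single (Sum.inr a) (r / 2) with he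
  have hnorm (a) : ‖e a‖ < r := by
    simp [he, abs_of_pos hr]; linarith
  have hint1 (a) := integrable_curv_latScore (hball (ψ - e a) (by simpa using hnorm a))
  have hint2 (a) := integrable_curv_latScore (hball (ψ + e a) (by simpa using hnorm a))
  refine ⟨ε, fun z x k => C * ∑ a, ((z ^ 2 + ‖x‖ ^ 2) *
    (curv z x k (ψ - e a) + latScore z x k (ψ - e a) ^ 2) + (z ^ 2 + ‖x‖ ^ 2) *
    (curv z x k (ψ + e a) + latScore z x k (ψ + e a) ^ 2)), hε, fun k => ?_, fun z x k => ?_, ?_, ?_⟩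
  · refine Measurable.const_mul (Finset.measurable_sum _ fun a _ => ?_) C
    have hT : Measurable fun p : ℝ × EuclideanSpace ℝ (Fin d) => p.1 ^ 2 + ‖p.2‖ ^ 2 := by fun_prop
    exact (hT.mul ((measurable_curv k _).add ((measurable_latScore k _).pow_const 2))).add
      (hT.mul ((measurable_curv k _).add ((measurable_latScore k _).pow_const 2)))
  · refine mul_nonneg hC (Finset.sum_nonneg fun a _ => ?_)
    have h1 := curv_nonneg z x k (ψ - e a)
    have h2 := curv_nonneg z x k (ψ + e a)
    positivity
  · exact (integrable_finsetSum _ fun a _ => (hint1 a).add (hint2 a)).const_mul C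
  · intro z x k φ hφ
    refine (mul_le_mul_of_nonneg_left (hcurv z x k φ hφ) (by positivity)).trans_eq ?_
    simp_rw [← mul_add, ← Finset.mul_sum]
    simp only [he]
    ring

end Human

end

/-! ### Taylor and perturbation bounds -/

section

variable {K d : ℕ}

/-- The size of an observation, which bounds the norms of `upFun` and `loFun`. -/
def obsSize (z : ℝ) (x : EuclideanSpace ℝ (Fin d)) : ℝ := 1 + |z| + ‖x‖

lemma one_le_obsSize (z : ℝ) (x : EuclideanSpace ℝ (Fin d)) : 1 ≤ obsSize z x := by
  rw [obsSize]; linarith [abs_nonneg z, norm_nonneg x]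

lemma abs_latFun_le (z : ℝ) (x : EuclideanSpace ℝ (Fin d)) (v : Param K d) :
    |latFun K z x v| ≤ (|z| + ‖x‖) * ‖v‖ := by
  have h1 : |slope v * z| ≤ ‖v‖ * |z| := by
    rw [abs_mul]
    exact mul_le_mul_of_nonneg_right (abs_apply_le_norm v _) (abs_nonneg _)
  have h2 : |∑ j, coeffs v j * x j| ≤ ‖v‖ * ‖x‖ := by
    set c : EuclideanSpace ℝ (Fin d) := WithLp.toLp 2 (coeffs v) with hc
    have e : ∑ j, coeffs v j * x j = inner ℝ x c := by
      simp [PiLp.inner_apply, hc]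
    have hcv : ‖c‖ ≤ ‖v‖ := by
      rw [EuclideanSpace.norm_eq, EuclideanSpace.norm_eq]
      refine Real.sqrt_le_sqrt ?_
      simp only [hc, Fintype.sum_sum_type, coeffs]
      have : 0 ≤ ∑ j : Fin K, ‖v (Sum.inl j)‖ ^ 2 := by positivity
      have : 0 ≤ ∑ j : Unit, ‖v (Sum.inr (Sum.inl j))‖ ^ 2 := by positivity
      linarith
    rw [e, mul_comm]
    exact (abs_real_inner_le_norm x c).trans
      (mul_le_mul_of_nonneg_left hcv (norm_nonneg _))
  rw [latFun_apply]
  calc |slope v * z - ∑ j, coeffs v j * x j| ≤ |slope v * z| + |∑ j, coeffs v j * x j| :=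
        abs_sub _ _
    _ ≤ (|z| + ‖x‖) * ‖v‖ := by linarith

lemma abs_upFun_le (z : ℝ) (x : EuclideanSpace ℝ (Fin d)) (k : Fin (K + 1)) (v : Param K d) :
    |upFun z x k v| ≤ obsSize z x * ‖v‖ := by
  have h1 := abs_cutFun_le k v
  have h2 := abs_latFun_le z x v
  rw [upFun, sub_apply, obsSize]
  linarith [abs_sub (cutFun K d k v) (latFun K z x v)]

lemma abs_loFun_le (z : ℝ) (x : EuclideanSpace ℝ (Fin d)) (k : Fin (K + 1)) (v : Param K d) :
    |loFun z x k v| ≤ obsSize z x * ‖v‖ := by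
  have h1 := abs_cutFun_le (k - 1) v
  have h2 := abs_latFun_le z x v
  rw [loFun, sub_apply, obsSize]
  linarith [abs_sub (latFun K z x v) (cutFun K d (k - 1) v)]

lemma abs_gapFun_le (k : Fin (K + 1)) (v : Param K d) : |gapFun d k v| ≤ 2 * ‖v‖ := by
  have h1 := abs_cutFun_le k v
  have h2 := abs_cutFun_le (k - 1) v
  rw [gapFun, sub_apply]
  linarith [abs_sub (cutFun K d k v) (cutFun K d (k - 1) v)]

lemma obsSize_sq_le (z : ℝ) (x : EuclideanSpace ℝ (Fin d)) :
    obsSize z x ^ 2 ≤ 3 * (1 + (z ^ 2 + ‖x‖ ^ 2)) := by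
  rw [obsSize, ← sq_abs z]
  nlinarith [sq_nonneg (1 - |z|), sq_nonneg (1 - ‖x‖), sq_nonneg (|z| - ‖x‖)]

/-- The part of the second derivative that comes from the cutoffs alone is continuous, uniformly in
the observation. -/
lemma exists_gap_modulus {ψ : Param K d} (hψ : ψ ∈ ordered K d) {κ : ℝ} (hκ : 0 < κ) :
    ∃ δ > 0, ∀ (k : Fin (K + 1)) (u : Param K d), ‖u‖ ≤ δ →
      hasUp k * hasLo k * |logGapDeriv₂ (gapFun d k (ψ + u)) - logGapDeriv₂ (gapFun d k ψ)| ≤ κ := by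
  have h (k : Fin (K + 1)) : ∀ᶠ u in 𝓝 (0 : Param K d),
      hasUp k * hasLo k * |logGapDeriv₂ (gapFun d k (ψ + u)) - logGapDeriv₂ (gapFun d k ψ)| < κ := by
    by_cases h0 : hasUp k * hasLo k = 0
    · simp [h0, hκ]
    · have hc : ContinuousAt (fun u : Param K d => logGapDeriv₂ (gapFun d k (ψ + u))) 0 := by
        have h1 : ContinuousAt (fun u : Param K d => gapFun d k (ψ + u)) 0 :=
          ((gapFun d k).continuous.comp (continuous_const.add continuous_id)).continuousAt
        refine ContinuousAt.comp (g := logGapDeriv₂) ?_ h1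
        simpa using continuousAt_logGapDeriv₂ (gapFun_pos hψ k h0)
      have hc' : ContinuousAt (fun u : Param K d => hasUp k * hasLo k *
          |logGapDeriv₂ (gapFun d k (ψ + u)) - logGapDeriv₂ (gapFun d k ψ)|) 0 :=
        continuousAt_const.mul (hc.sub continuousAt_const).abs
      exact hc'.eventually (gt_mem_nhds (by simpa using hκ))
  obtain ⟨δ, hδ, hball⟩ := Metric.eventually_nhds_iff_ball.1 (eventually_all.2 h)
  refine ⟨δ / 2, half_pos hδ, fun k u hu => (hball u ?_ k).le⟩
  simp only [Metric.mem_ball, dist_zero_right]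
  linarith

/-- Modulus of continuity of the second derivative. -/
lemma abs_logF₂_sub_le (z : ℝ) (x : EuclideanSpace ℝ (Fin d)) (k : Fin (K + 1))
    (φ ψ v : Param K d) :
    |logF₂ z x k φ v - logF₂ z x k ψ v| ≤
      (hasUp k * |sigVar (upFun z x k φ) - sigVar (upFun z x k ψ)| +
        hasLo k * |sigVar (loFun z x k φ) - sigVar (loFun z x k ψ)|) *
          (obsSize z x ^ 2 * ‖v‖ ^ 2) +
      hasUp k * hasLo k * |logGapDeriv₂ (gapFun d k φ) - logGapDeriv₂ (gapFun d k ψ)| *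
        (2 ^ 2 * ‖v‖ ^ 2) := by
  have hsq (r m : ℝ) (h : |r| ≤ m * ‖v‖) : r ^ 2 ≤ m ^ 2 * ‖v‖ ^ 2 := by
    rw [← mul_pow, ← sq_abs r]
    exact pow_le_pow_left₀ (abs_nonneg _) h 2
  have s1 := hsq _ _ (abs_upFun_le z x k v)
  have s2 := hsq _ _ (abs_loFun_le z x k v)
  have s3 := hsq _ _ (abs_gapFun_le k v)
  have hU := hasUp_nonneg k
  have hL := hasLo_nonneg k
  have e : logF₂ z x k φ v - logF₂ z x k ψ v =
      -(hasUp k * ((sigVar (upFun z x k φ) - sigVar (upFun z x k ψ)) * upFun z x k v ^ 2)) +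
      -(hasLo k * ((sigVar (loFun z x k φ) - sigVar (loFun z x k ψ)) * loFun z x k v ^ 2)) +
      hasUp k * hasLo k * ((logGapDeriv₂ (gapFun d k φ) - logGapDeriv₂ (gapFun d k ψ)) *
        gapFun d k v ^ 2) := by
    simp only [logF₂]; ring
  rw [e]
  refine (abs_add_three _ _ _).trans ?_
  simp only [abs_neg, abs_mul, abs_of_nonneg hU, abs_of_nonneg hL, abs_sq]
  have t1 := mul_le_mul_of_nonneg_left s1 (mul_nonneg hU
    (abs_nonneg (sigVar (upFun z x k φ) - sigVar (upFun z x k ψ))))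
  have t2 := mul_le_mul_of_nonneg_left s2 (mul_nonneg hL
    (abs_nonneg (sigVar (loFun z x k φ) - sigVar (loFun z x k ψ))))
  have t3 := mul_le_mul_of_nonneg_left s3 (mul_nonneg (mul_nonneg hU hL)
    (abs_nonneg (logGapDeriv₂ (gapFun d k φ) - logGapDeriv₂ (gapFun d k ψ))))
  linarith

/-- Second order expansion of the log-likelihood of one observation at `ψ`.  The remainder is
controlled both by the third power of the size of the observation, with a small factor, and by the
envelope `D` of the curvature. -/
lemma exists_taylor_bound {ψ : Param K d} (hψ : ψ ∈ ordered K d) {ε : ℝ} (hε : 0 < ε)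
    {D : ℝ → EuclideanSpace ℝ (Fin d) → Fin (K + 1) → ℝ}
    (hD : ∀ z x k φ, ‖φ - ψ‖ ≤ ε → (z ^ 2 + ‖x‖ ^ 2) * curv z x k φ ≤ D z x k)
    {κ : ℝ} (hκ : 0 < κ) :
    ∃ δ > 0, ∀ z x k v τ, ‖v‖ ≤ τ → τ ≤ δ →
      |logF z x k (ψ + v) - logF z x k ψ - logF₁ z x k ψ v - logF₂ z x k ψ v / 2| ≤
        ‖v‖ ^ 2 * (κ + min (2 * τ * obsSize z x ^ 3) (6 * (1 + D z x k))) := by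
  obtain ⟨δ₁, hδ₁, hgap⟩ := exists_gap_modulus hψ (κ := κ / 2) (half_pos hκ)
  obtain ⟨δ₂, hδ₂, hball⟩ := Metric.isOpen_iff.1 isOpen_ordered ψ hψ
  refine ⟨min (min δ₁ ε) (δ₂ / 2), by positivity, fun z x k v τ hv hτ => ?_⟩
  have hseg (s : ℝ) (hs : s ∈ Set.Icc (0 : ℝ) 1) : ‖s • v‖ ≤ ‖v‖ := by
    rw [norm_smul, Real.norm_eq_abs, abs_of_nonneg hs.1]
    exact mul_le_of_le_one_left (norm_nonneg _) hs.2
  have hτ1 : τ ≤ δ₁ := hτ.trans ((min_le_left _ _).trans (min_le_left _ _))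
  have hτ2 : τ ≤ ε := hτ.trans ((min_le_left _ _).trans (min_le_right _ _))
  have hτ3 : τ ≤ δ₂ / 2 := hτ.trans (min_le_right _ _)
  have hord (s : ℝ) (hs : s ∈ Set.Icc (0 : ℝ) 1) : ψ + s • v ∈ ordered K d := by
    apply hball
    simp only [Metric.mem_ball, dist_self_add_left]
    linarith [hseg s hs]
  obtain ⟨s, hs, hT⟩ := exists_taylor_two
    (fun s hs => hasDerivAt_logF z x k (hasDerivAt_line ψ v s) (hord s hs))
    (fun s hs => hasDerivAt_logF₁ z x k (c' := fun _ => v) (hasDerivAt_line ψ v s)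
      (hasDerivAt_const s v) (hord s hs))
  have hzero (φ : Param K d) : logF₁ z x k φ 0 = 0 := by simp [logF₁]
  simp only [one_smul, zero_smul, add_zero, hzero] at hT
  rw [hT]
  have e : logF₁ z x k ψ v + logF₂ z x k (ψ + s • v) v / 2 - logF₁ z x k ψ v -
      logF₂ z x k ψ v / 2 = (logF₂ z x k (ψ + s • v) v - logF₂ z x k ψ v) / 2 := by ring
  rw [e]
  set u := s • v with hu
  have hun : ‖u‖ ≤ τ := (hseg s hs).trans hv
  set T := obsSize z x with hTdef
  have hT1 : 1 ≤ T := one_le_obsSize z x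
  set a := |sigVar (upFun z x k (ψ + u)) - sigVar (upFun z x k ψ)| with ha
  set b := |sigVar (loFun z x k (ψ + u)) - sigVar (loFun z x k ψ)| with hb
  set c := |logGapDeriv₂ (gapFun d k (ψ + u)) - logGapDeriv₂ (gapFun d k ψ)| with hc
  have hU := hasUp_nonneg k
  have hL := hasLo_nonneg k
  have hmain := abs_logF₂_sub_le z x k (ψ + u) ψ v
  rw [← ha, ← hb, ← hc, ← hTdef] at hmain
  have hab1 : (hasUp k * a + hasLo k * b) * T ^ 2 ≤ 2 * τ * T ^ 3 := by
    have h1 : a ≤ T * τ := by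
      refine (abs_sigVar_sub_le _ _).trans ?_
      rw [← map_sub, add_sub_cancel_left]
      exact (abs_upFun_le z x k u).trans (mul_le_mul_of_nonneg_left hun (by linarith))
    have h2 : b ≤ T * τ := by
      refine (abs_sigVar_sub_le _ _).trans ?_
      rw [← map_sub, add_sub_cancel_left]
      exact (abs_loFun_le z x k u).trans (mul_le_mul_of_nonneg_left hun (by linarith))
    have h3 : hasUp k * a ≤ 1 * (T * τ) :=
      mul_le_mul (hasUp_le_one k) h1 (abs_nonneg _) zero_le_one
    have h4 : hasLo k * b ≤ 1 * (T * τ) :=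
      mul_le_mul (hasLo_le_one k) h2 (abs_nonneg _) zero_le_one
    have h5 := mul_le_mul_of_nonneg_right (add_le_add h3 h4) (sq_nonneg T)
    linarith
  have hab2 : (hasUp k * a + hasLo k * b) * T ^ 2 ≤ 6 * (1 + D z x k) := by
    have h0 : hasUp k * a + hasLo k * b ≤ curv z x k (ψ + u) + curv z x k ψ := by
      have t1 : a ≤ sigVar (upFun z x k (ψ + u)) + sigVar (upFun z x k ψ) := by
        refine (abs_sub _ _).trans_eq ?_
        rw [abs_of_pos (sigVar_pos _), abs_of_pos (sigVar_pos _)]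
      have t2 : b ≤ sigVar (loFun z x k (ψ + u)) + sigVar (loFun z x k ψ) := by
        refine (abs_sub _ _).trans_eq ?_
        rw [abs_of_pos (sigVar_pos _), abs_of_pos (sigVar_pos _)]
      have t3 := mul_le_mul_of_nonneg_left t1 hU
      have t4 := mul_le_mul_of_nonneg_left t2 hL
      rw [curv, curv]
      linarith
    have h1 := hD z x k (ψ + u) (by simpa using hun.trans hτ2)
    have h2 := hD z x k ψ (by simpa using hε.le)
    have h3 := curv_le_one z x k (ψ + u)
    have h4 := curv_le_one z x k ψ
    have h5 := curv_nonneg z x k (ψ + u)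
    have h6 := curv_nonneg z x k ψ
    have h7 := mul_le_mul_of_nonneg_right h0 (sq_nonneg T)
    have h8 := mul_le_mul_of_nonneg_left (obsSize_sq_le z x) (add_nonneg h5 h6)
    linarith
  have hg := hgap k u (hun.trans hτ1)
  rw [← hc] at hg
  have hmin := le_min hab1 hab2
  have hv2 := sq_nonneg ‖v‖
  have hm0 : 0 ≤ (hasUp k * a + hasLo k * b) * T ^ 2 := by positivity
  rw [abs_div, abs_two]
  have f1 := mul_le_mul_of_nonneg_right hmin hv2
  have f2 := mul_le_mul_of_nonneg_right hg hv2
  have f3 := mul_nonneg (hm0.trans hmin) hv2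
  linarith

/-- The increment of the log-likelihood changes little when the latent score is perturbed. -/
lemma exists_perturb_bound {ψ : Param K d} {ε : ℝ} (hε : 0 < ε)
    {D : ℝ → EuclideanSpace ℝ (Fin d) → Fin (K + 1) → ℝ}
    (hD : ∀ z x k φ, ‖φ - ψ‖ ≤ ε → (z ^ 2 + ‖x‖ ^ 2) * curv z x k φ ≤ D z x k) :
    ∃ C δ : ℝ, 0 ≤ C ∧ 0 < δ ∧ ∀ z z' x k v, ‖v‖ ≤ δ → |z' - z| ≤ 1 →
      |(logF z' x k (ψ + v) - logF z' x k ψ) - (logF z x k (ψ + v) - logF z x k ψ)| ≤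
        C * ‖v‖ * |z' - z| * (1 + √(D z x k)) := by
  refine ⟨2 + ‖ψ‖ * (2 * Real.exp (‖ψ‖ + 1)), min 1 ε, by positivity, by positivity, ?_⟩
  intro z z' x k v hv hz
  have hv1 : ‖v‖ ≤ 1 := hv.trans (min_le_left _ _)
  have hv2 : ‖v‖ ≤ ε := hv.trans (min_le_right _ _)
  set Δ := z' - z with hΔ
  have hline (s : ℝ) : HasDerivAt (fun s : ℝ => z + s * Δ) Δ s := by
    simpa using ((hasDerivAt_id s).mul_const Δ).const_add z
  -- The derivative in the latent score.
  have hder (φ : Param K d) (s : ℝ) : HasDerivAt (fun s : ℝ => logF (z + s * Δ) x k φ)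
      (slope φ * latScore (z + s * Δ) x k φ * Δ) s := by
    have hlat : HasDerivAt (fun s : ℝ => latFun K (z + s * Δ) x φ) (slope φ * Δ) s := by
      simp only [latFun_apply]
      exact ((hline s).const_mul (slope φ)).sub_const _
    have hup : HasDerivAt (fun s : ℝ => upFun (z + s * Δ) x k φ) (-(slope φ * Δ)) s := by
      simp only [upFun, sub_apply]
      exact hlat.const_sub _
    have hlo : HasDerivAt (fun s : ℝ => loFun (z + s * Δ) x k φ) (slope φ * Δ) s := by
      simp only [loFun, sub_apply]
      exact hlat.sub_const _
    refine (((((hasDerivAt_logSig _).comp s hup).const_mul (hasUp k)).add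
      (((hasDerivAt_logSig _).comp s hlo).const_mul (hasLo k))).add_const
        (hasUp k * hasLo k * logGap (gapFun d k φ))).congr_deriv ?_
    rw [latScore]
    ring
  obtain ⟨s, hs, hmvt⟩ := exists_hasDerivAt_eq_slope
    (fun s : ℝ => logF (z + s * Δ) x k (ψ + v) - logF (z + s * Δ) x k ψ) _ zero_lt_one
    (fun s _ => ((hder (ψ + v) s).sub (hder ψ s)).continuousAt.continuousWithinAt)
    (fun s _ => (hder (ψ + v) s).sub (hder ψ s))
  have hz1 : z + 1 * Δ = z' := by rw [hΔ]; ring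
  have hz0 : z + 0 * Δ = z := by ring
  rw [hz1, hz0, sub_zero, div_one] at hmvt
  rw [← hmvt]
  set y := z + s * Δ with hy
  have hyz : |y - z| ≤ 1 := by
    rw [hy, add_sub_cancel_left, abs_mul, abs_of_pos hs.1]
    exact mul_le_one₀ hs.2.le (abs_nonneg _) hz
  -- The derivative in the parameter.
  have hder' (t : ℝ) : HasDerivAt (fun t : ℝ => latScore y x k (ψ + t • v))
      (hasLo k * (-sigVar (loFun y x k (ψ + t • v)) * loFun y x k v) -
        hasUp k * (-sigVar (upFun y x k (ψ + t • v)) * upFun y x k v)) t := by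
    have hl (l : Param K d →L[ℝ] ℝ) : HasDerivAt (fun t : ℝ => Real.sigmoid (-l (ψ + t • v)))
        (-sigVar (l (ψ + t • v)) * l v) t :=
      (hasDerivAt_sigmoid_neg _).comp t (l.hasFDerivAt.comp_hasDerivAt t (hasDerivAt_line ψ v t))
    exact ((hl _).const_mul _).sub ((hl _).const_mul _)
  obtain ⟨t, ht, hmvt'⟩ := exists_hasDerivAt_eq_slope (fun t : ℝ => latScore y x k (ψ + t • v)) _
    zero_lt_one (fun t _ => (hder' t).continuousAt.continuousWithinAt) (fun t _ => hder' t)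
  simp only [one_smul, zero_smul, add_zero, sub_zero, div_one] at hmvt'
  have htv : ‖t • v‖ ≤ ‖v‖ := by
    rw [norm_smul, Real.norm_eq_abs, abs_of_pos ht.1]
    exact mul_le_of_le_one_left (norm_nonneg _) ht.2.le
  set φ := ψ + t • v with hφ
  have hφn : ‖φ‖ ≤ ‖ψ‖ + 1 := (norm_add_le _ _).trans (by linarith)
  have hU := hasUp_nonneg k
  have hL := hasLo_nonneg k
  set T := obsSize z x with hTdef
  have hT1 : 1 ≤ T := one_le_obsSize z x
  have hTy : obsSize y x ≤ T + 1 := by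
    have := abs_add_le (y - z) z
    rw [sub_add_cancel] at this
    rw [hTdef, obsSize, obsSize]; linarith
  have hcurv : curv y x k φ ≤ Real.exp (‖ψ‖ + 1) * curv z x k φ := by
    have hlat : |latFun K y x φ - latFun K z x φ| ≤ ‖ψ‖ + 1 := by
      rw [latFun_apply, latFun_apply]
      have e : slope φ * y - ∑ j, coeffs φ j * x j - (slope φ * z - ∑ j, coeffs φ j * x j) =
        slope φ * (y - z) := by ring
      rw [e, abs_mul]
      exact (mul_le_of_le_one_right (abs_nonneg _) hyz).trans
        ((abs_apply_le_norm φ _).trans hφn)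
    refine curv_le_exp_mul ?_ ?_
    · simp only [upFun, sub_apply]
      rwa [sub_sub_sub_cancel_left, abs_sub_comm]
    · simp only [loFun, sub_apply]
      rwa [sub_sub_sub_cancel_right]
  have hDz := hD z x k φ (by simpa [hφ] using htv.trans hv2)
  have hc0 := curv_nonneg z x k φ
  have hc1 := curv_le_one z x k φ
  have hTc : (T + 1) * curv z x k φ ≤ 2 * (1 + √(D z x k)) := by
    have key (a : ℝ) (ha : 0 ≤ a) (h : a ^ 2 ≤ z ^ 2 + ‖x‖ ^ 2) : a * curv z x k φ ≤ √(D z x k) := by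
      refine Real.le_sqrt_of_sq_le (le_trans ?_ hDz)
      have h1 := mul_le_mul_of_nonneg_right h hc0
      have h2 := mul_le_of_le_one_right (mul_nonneg (sq_nonneg a) hc0) hc1
      linarith
    have k1 := key |z| (abs_nonneg z) (by rw [sq_abs]; linarith [sq_nonneg ‖x‖])
    have k2 := key ‖x‖ (norm_nonneg x) (by linarith [sq_nonneg z])
    rw [hTdef, obsSize]
    linarith
  have hdiff : |latScore y x k (ψ + v) - latScore y x k ψ| ≤
      2 * Real.exp (‖ψ‖ + 1) * ‖v‖ * (1 + √(D z x k)) := by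
    rw [← hmvt']
    have h1 : |hasLo k * (-sigVar (loFun y x k φ) * loFun y x k v) -
        hasUp k * (-sigVar (upFun y x k φ) * upFun y x k v)| ≤
        curv y x k φ * (obsSize y x * ‖v‖) := by
      refine (abs_sub _ _).trans ?_
      simp only [abs_mul, abs_neg, abs_of_nonneg hU, abs_of_nonneg hL, abs_of_pos (sigVar_pos _)]
      have t1 := mul_le_mul_of_nonneg_left (abs_upFun_le y x k v)
        (mul_nonneg hU (sigVar_pos (upFun y x k φ)).le)
      have t2 := mul_le_mul_of_nonneg_left (abs_loFun_le y x k v)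
        (mul_nonneg hL (sigVar_pos (loFun y x k φ)).le)
      rw [curv]
      linarith
    have h2 : curv y x k φ * (obsSize y x * ‖v‖) ≤
        (Real.exp (‖ψ‖ + 1) * curv z x k φ) * ((T + 1) * ‖v‖) :=
      mul_le_mul hcurv (mul_le_mul_of_nonneg_right hTy (norm_nonneg _))
        (mul_nonneg (zero_le_one.trans (one_le_obsSize y x)) (norm_nonneg _))
        (mul_nonneg (Real.exp_pos _).le hc0)
    have h3 := mul_le_mul_of_nonneg_left hTc
      (mul_nonneg (Real.exp_pos (‖ψ‖ + 1)).le (norm_nonneg v))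
    linarith
  have hls : |latScore y x k (ψ + v)| ≤ 2 := by
    rw [latScore]
    refine (abs_sub _ _).trans ?_
    rw [abs_mul, abs_mul, abs_of_nonneg hU, abs_of_nonneg hL, abs_of_pos (Real.sigmoid_pos _),
      abs_of_pos (Real.sigmoid_pos _)]
    have t1 := mul_le_one₀ (hasUp_le_one k) (Real.sigmoid_pos _).le
      (Real.sigmoid_le_one (-upFun y x k (ψ + v)))
    have t2 := mul_le_one₀ (hasLo_le_one k) (Real.sigmoid_pos _).le
      (Real.sigmoid_le_one (-loFun y x k (ψ + v)))
    linarith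
  have hslope : slope (ψ + v) = slope ψ + slope v := rfl
  have e : slope (ψ + v) * latScore y x k (ψ + v) * Δ - slope ψ * latScore y x k ψ * Δ =
      (slope v * latScore y x k (ψ + v) +
        slope ψ * (latScore y x k (ψ + v) - latScore y x k ψ)) * Δ := by
    rw [hslope]; ring
  have hsD : 0 ≤ √(D z x k) := Real.sqrt_nonneg _
  have hfin : |slope v * latScore y x k (ψ + v) +
      slope ψ * (latScore y x k (ψ + v) - latScore y x k ψ)| ≤
      (2 + ‖ψ‖ * (2 * Real.exp (‖ψ‖ + 1))) * ‖v‖ * (1 + √(D z x k)) := by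
    refine (abs_add_le _ _).trans ?_
    rw [abs_mul, abs_mul]
    have t1 : |slope v| * |latScore y x k (ψ + v)| ≤ ‖v‖ * 2 :=
      mul_le_mul (abs_apply_le_norm v _) hls (abs_nonneg _) (norm_nonneg _)
    have t2 := mul_le_mul (abs_apply_le_norm ψ (Sum.inr (Sum.inl ()))) hdiff (abs_nonneg _)
      (norm_nonneg _)
    have t3 := mul_nonneg (norm_nonneg v) hsD
    change _ + |ψ (Sum.inr (Sum.inl ()))| * _ ≤ _
    linarith
  rw [e, abs_mul]
  refine (mul_le_mul_of_nonneg_right hfin (abs_nonneg _)).trans_eq ?_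
  ring

end

/-! ### The central limit theorem and the information equality -/

section

/-- The multivariate central limit theorem, by the Cramér–Wold device. -/
lemma tendstoInDistribution_multivariateGaussian {Ω ι : Type*} [MeasurableSpace Ω]
    {μ : Measure Ω} [IsProbabilityMeasure μ] [Fintype ι] [DecidableEq ι]
    {X : ℕ → Ω → EuclideanSpace ℝ ι} {S : Matrix ι ι ℝ} (hS : S.PosSemidef)
    (hindep : iIndepFun X μ) (hident : ∀ i, IdentDistrib (X i) (X 0) μ μ)
    (hL2 : ∀ t, MemLp (fun ω => inner ℝ (X 0 ω) t) 2 μ)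
    (hmean : ∀ t, ∫ ω, inner ℝ (X 0 ω) t ∂μ = 0)
    (hvar : ∀ t : EuclideanSpace ℝ ι,
      ∫ ω, inner ℝ (X 0 ω) t ^ 2 ∂μ = t.ofLp ⬝ᵥ S.mulVec t.ofLp) :
    TendstoInDistribution (fun (n : ℕ) ω => (√n)⁻¹ • ∑ i ∈ Finset.range n, X i ω) atTop id
      (fun _ => μ) (multivariateGaussian 0 S) where
  forall_aemeasurable n := by
    have h (i : ℕ) : AEMeasurable (X i) μ := (hident i).aemeasurable_fst
    have hs : AEMeasurable (fun ω => ∑ i ∈ Finset.range n, X i ω) μ :=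
      Finset.aemeasurable_fun_sum _ fun i _ => h i
    exact hs.const_smul ((√n)⁻¹ : ℝ)
  tendsto := by
    have hX (i : ℕ) : AEMeasurable (X i) μ := (hident i).aemeasurable_fst
    refine ProbabilityMeasure.tendsto_iff_tendsto_charFun.2 fun t => ?_
    have hinner : Measurable fun x : EuclideanSpace ℝ ι => inner ℝ x t := by fun_prop
    have hv : Var[fun ω => inner ℝ (X 0 ω) t; μ] = t.ofLp ⬝ᵥ S.mulVec t.ofLp := by
      rw [variance_eq_sub (hL2 t), hmean t, ← hvar t]
      simp
    have hv0 : 0 ≤ t.ofLp ⬝ᵥ S.mulVec t.ofLp := by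
      rw [← hv]; exact variance_nonneg _ _
    have hclt := tendstoInDistribution_inv_sqrt_mul_sum_sub (P := μ)
      (X := fun i ω => inner ℝ (X i ω) t) (Y := id)
      (P' := gaussianReal 0 Var[fun ω => inner ℝ (X 0 ω) t; μ].toNNReal)
      HasLaw.id (hL2 t) (hindep.comp (fun _ x => inner ℝ x t) fun _ => hinner)
      (fun i => (hident i).comp hinner)
    have h1 := ProbabilityMeasure.tendsto_iff_tendsto_charFun.1 hclt.tendsto 1
    simp only [ProbabilityMeasure.coe_mk, Measure.map_id] at h1 ⊢
    rw [charFun_multivariateGaussian hS]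
    rw [charFun_gaussianReal, hv, Real.coe_toNNReal _ hv0] at h1
    convert h1 using 1
    · ext n
      rw [charFun_apply, charFun_apply, integral_map, integral_map]
      · congr 1
        ext ω
        simp [hmean t, inner_smul_left, sum_inner]
      · have := fun i => hinner.comp_aemeasurable (hX i)
        simp only [Function.comp_def] at this
        exact ((Finset.aemeasurable_fun_sum _ fun i _ => this i).sub_const _).const_mul _
      · exact (by fun_prop : Continuous fun x : ℝ =>
          Complex.exp (inner ℝ x (1 : ℝ) * Complex.I)).aestronglyMeasurable
      · have hs : AEMeasurable (fun ω => ∑ i ∈ Finset.range n, X i ω) μ :=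
          Finset.aemeasurable_fun_sum _ fun i _ => hX i
        exact hs.const_smul ((√n)⁻¹ : ℝ)
      · exact (by fun_prop : Continuous fun x : EuclideanSpace ℝ ι =>
          Complex.exp (inner ℝ x t * Complex.I)).aestronglyMeasurable
    · congr 2
      simp

variable {K d : ℕ}

lemma hasDerivAt_exp_logF (z : ℝ) (x : EuclideanSpace ℝ (Fin d)) (k : Fin (K + 1))
    (ψ v : Param K d) (s : ℝ) (hs : ψ + s • v ∈ ordered K d) :
    HasDerivAt (fun s : ℝ => Real.exp (logF z x k (ψ + s • v)))
      (Real.exp (logF z x k (ψ + s • v)) * logF₁ z x k (ψ + s • v) v) s :=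
  (hasDerivAt_logF z x k (hasDerivAt_line ψ v s) hs).exp

lemma eventually_line_mem_ordered {ψ : Param K d} (hψ : ψ ∈ ordered K d) (v : Param K d) :
    ∀ᶠ s in 𝓝 (0 : ℝ), ψ + s • v ∈ ordered K d := by
  have hc : Tendsto (fun s : ℝ => ψ + s • v) (𝓝 0) (𝓝 ψ) := by
    simpa using (hasDerivAt_line ψ v 0).continuousAt.tendsto
  exact hc (isOpen_ordered.mem_nhds hψ)

/-- The conditional expectation of the score given the covariates vanishes. -/
lemma sum_exp_logF_mul_logF₁ {ψ : Param K d} (hψ : ψ ∈ ordered K d) (v : Param K d) (z : ℝ)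
    (x : EuclideanSpace ℝ (Fin d)) :
    ∑ k, Real.exp (logF z x k ψ) * logF₁ z x k ψ v = 0 := by
  have h1 : HasDerivAt (fun s : ℝ => ∑ k, Real.exp (logF z x k (ψ + s • v)))
      (∑ k, Real.exp (logF z x k (ψ + (0 : ℝ) • v)) * logF₁ z x k (ψ + (0 : ℝ) • v) v) 0 :=
    HasDerivAt.fun_sum fun k _ => hasDerivAt_exp_logF z x k ψ v 0 (by simpa using hψ)
  have h2 : HasDerivAt (fun s : ℝ => ∑ k, Real.exp (logF z x k (ψ + s • v))) 0 0 := by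
    refine (hasDerivAt_const (0 : ℝ) (1 : ℝ)).congr_of_eventuallyEq ?_
    filter_upwards [eventually_line_mem_ordered hψ v] with s hs
    exact sum_exp_logF hs z x
  simpa using h1.unique h2

/-- The conditional information equality given the covariates. -/
lemma sum_exp_logF_mul_logF₂ {ψ : Param K d} (hψ : ψ ∈ ordered K d) (v : Param K d) (z : ℝ)
    (x : EuclideanSpace ℝ (Fin d)) :
    ∑ k, Real.exp (logF z x k ψ) * (logF₁ z x k ψ v ^ 2 + logF₂ z x k ψ v) = 0 := by
  have h0 : ψ + (0 : ℝ) • v = ψ := by simp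
  have hzero (k : Fin (K + 1)) : logF₁ z x k ψ (0 : Param K d) = 0 := by simp [logF₁]
  have h1 : HasDerivAt (fun s : ℝ => ∑ k, Real.exp (logF z x k (ψ + s • v)) *
        logF₁ z x k (ψ + s • v) v)
      (∑ k, Real.exp (logF z x k ψ) * (logF₁ z x k ψ v ^ 2 + logF₂ z x k ψ v)) 0 := by
    refine HasDerivAt.fun_sum fun k _ => ?_
    have ho : ψ + (0 : ℝ) • v ∈ ordered K d := by rwa [h0]
    refine ((hasDerivAt_exp_logF z x k ψ v 0 ho).mul (hasDerivAt_logF₁ z x k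
      (c' := fun _ => v) (hasDerivAt_line ψ v 0) (hasDerivAt_const 0 v) ho)).congr_deriv ?_
    rw [h0, hzero]
    ring
  have h2 : HasDerivAt (fun s : ℝ => ∑ k, Real.exp (logF z x k (ψ + s • v)) *
        logF₁ z x k (ψ + s • v) v) 0 0 := by
    refine (hasDerivAt_const (0 : ℝ) (0 : ℝ)).congr_of_eventuallyEq ?_
    filter_upwards [eventually_line_mem_ordered hψ v] with s hs
    exact sum_exp_logF_mul_logF₁ hs v z x
  exact h1.unique h2

section Human

variable {Ω 𝓥 : Type*} [MeasurableSpace Ω] [MeasurableSpace 𝓥]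
  {μ : Measure Ω} [IsProbabilityMeasure μ] {V : ℕ → Ω → 𝓥} {Y : ℕ → Ω → Fin (K + 1)}
  {g : 𝓥 → EuclideanSpace ℝ (Fin d)} {ζ : 𝓥 → ℝ} {θs : Param K d}

/-- A function of an observation whose conditional mean given the covariates vanishes has mean
zero. -/
lemma HumanModel.integral_eq_zero (hm : HumanModel μ V Y g ζ θs) (hθ : θs ∈ paramDomain K d)
    {f : ℝ → EuclideanSpace ℝ (Fin d) → Fin (K + 1) → ℝ}
    (hf : ∀ k, Measurable fun p : ℝ × EuclideanSpace ℝ (Fin d) => f p.1 p.2 k)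
    (hint : Integrable (fun ω => f (ζ (V 0 ω)) (g (V 0 ω)) (Y 0 ω)) μ)
    (hsum : ∀ z x, ∑ k, Real.exp (logF z x k (reparam θs)) * f z x k = 0) :
    ∫ ω, f (ζ (V 0 ω)) (g (V 0 ω)) (Y 0 ω) ∂μ = 0 := by
  have hmle := (hm.meas_V 0).comap_le
  set ind : Fin (K + 1) → Ω → ℝ := fun k => Set.indicator {ω | Y 0 ω = k} (fun _ => (1 : ℝ))
    with hind
  have hmeas (k : Fin (K + 1)) : MeasurableSet {ω | Y 0 ω = k} :=
    hm.meas_Y 0 (measurableSet_singleton k)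
  have hind_int (k) : Integrable (ind k) μ := (integrable_const (1 : ℝ)).indicator (hmeas k)
  have hprod (k) : ind k * (fun ω => f (ζ (V 0 ω)) (g (V 0 ω)) k) =
      Set.indicator {ω | Y 0 ω = k} (fun ω => f (ζ (V 0 ω)) (g (V 0 ω)) (Y 0 ω)) := by
    ext ω
    by_cases h : Y 0 ω = k
    · simp [hind, h]
    · simp [hind, h]
  have hprod_int (k) : Integrable (ind k * (fun ω => f (ζ (V 0 ω)) (g (V 0 ω)) k)) μ := by
    rw [hprod]; exact hint.indicator (hmeas k)
  have hfm (k) : StronglyMeasurable[MeasurableSpace.comap (V 0) inferInstance] (fun ω => f (ζ (V 0 ω)) (g (V 0 ω)) k) := by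
    have h1 : Measurable fun w : 𝓥 => f (ζ w) (g w) k :=
      (hf k).comp (hm.meas_ζ.prodMk hm.meas_g)
    exact (h1.comp (comap_measurable (V 0))).stronglyMeasurable
  have hce (k) : μ[ind k * (fun ω => f (ζ (V 0 ω)) (g (V 0 ω)) k) |
      MeasurableSpace.comap (V 0) inferInstance] =ᵐ[μ]
      fun ω => Real.exp (logF (ζ (V 0 ω)) (g (V 0 ω)) k (reparam θs)) *
        f (ζ (V 0 ω)) (g (V 0 ω)) k := by
    refine (condExp_mul_of_stronglyMeasurable_right (hfm k) (hprod_int k) (hind_int k)).trans ?_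
    filter_upwards [hm.model 0 k] with ω hω
    rw [Pi.mul_apply, hω, lik_eq hθ.1]
  have hce_int (k) := (integrable_condExp (m := MeasurableSpace.comap (V 0) inferInstance)
    (f := ind k * (fun ω => f (ζ (V 0 ω)) (g (V 0 ω)) k)) (μ := μ)).congr (hce k)
  calc ∫ ω, f (ζ (V 0 ω)) (g (V 0 ω)) (Y 0 ω) ∂μ
      = ∫ ω, ∑ k, (ind k * (fun ω => f (ζ (V 0 ω)) (g (V 0 ω)) k)) ω ∂μ := by
        congr 1
        ext ω
        simp [hind, Set.indicator_apply]
    _ = ∑ k, ∫ ω, (ind k * (fun ω => f (ζ (V 0 ω)) (g (V 0 ω)) k)) ω ∂μ :=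
        integral_finsetSum _ fun k _ => hprod_int k
    _ = ∑ k, ∫ ω, Real.exp (logF (ζ (V 0 ω)) (g (V 0 ω)) k (reparam θs)) *
          f (ζ (V 0 ω)) (g (V 0 ω)) k ∂μ := by
        refine Finset.sum_congr rfl fun k _ => ?_
        rw [← integral_condExp hmle]
        exact integral_congr_ae (hce k)
    _ = ∫ ω, ∑ k, Real.exp (logF (ζ (V 0 ω)) (g (V 0 ω)) k (reparam θs)) *
          f (ζ (V 0 ω)) (g (V 0 ω)) k ∂μ := (integral_finsetSum _ fun k _ => hce_int k).symm
    _ = 0 := by simp [hsum]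

omit [MeasurableSpace 𝓥] in
lemma moments_self (hθ : θs ∈ paramDomain K d) (hmom : MomentsAndInformation μ V Y g ζ θs)
    (v : Param K d) :
    MemLp (fun ω => logF₁ (ζ (V 0 ω)) (g (V 0 ω)) (Y 0 ω) (reparam θs) v) 2 μ ∧
      Integrable (fun ω => logF₂ (ζ (V 0 ω)) (g (V 0 ω)) (Y 0 ω) (reparam θs) v) μ :=
  (eventually_moments hθ hmom).self_of_nhds v

lemma integral_logF₁ (hm : HumanModel μ V Y g ζ θs) (hθ : θs ∈ paramDomain K d)
    (hmom : MomentsAndInformation μ V Y g ζ θs) (v : Param K d) :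
    ∫ ω, logF₁ (ζ (V 0 ω)) (g (V 0 ω)) (Y 0 ω) (reparam θs) v ∂μ = 0 :=
  hm.integral_eq_zero hθ (f := fun z x k => logF₁ z x k (reparam θs) v)
    (fun k => measurable_logF₁ k _ v) ((moments_self hθ hmom v).1.integrable one_le_two)
    (fun z x => sum_exp_logF_mul_logF₁ (reparam_mem_ordered hθ) v z x)

/-- The information equality, in the coordinates `φ`. -/
lemma integral_logF₁_sq (hm : HumanModel μ V Y g ζ θs) (hθ : θs ∈ paramDomain K d)
    (hmom : MomentsAndInformation μ V Y g ζ θs) (v : Param K d) :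
    ∫ ω, logF₁ (ζ (V 0 ω)) (g (V 0 ω)) (Y 0 ω) (reparam θs) v ^ 2 ∂μ =
      -∫ ω, logF₂ (ζ (V 0 ω)) (g (V 0 ω)) (Y 0 ω) (reparam θs) v ∂μ := by
  have h1 := (moments_self hθ hmom v).1.integrable_sq
  have h2 := (moments_self hθ hmom v).2
  have h := hm.integral_eq_zero hθ
    (f := fun z x k => logF₁ z x k (reparam θs) v ^ 2 + logF₂ z x k (reparam θs) v)
    (fun k => ((measurable_logF₁ k _ v).pow_const 2).add (measurable_logF₂ k _ v)) (h1.add h2)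
    (fun z x => sum_exp_logF_mul_logF₂ (reparam_mem_ordered hθ) v z x)
  rw [integral_add h1 h2] at h
  linarith

/-- The Fisher information as the quadratic form of the expected second derivative in the
coordinates `φ`. -/
lemma fisher_quadratic (hm : HumanModel μ V Y g ζ θs) (hθ : θs ∈ paramDomain K d)
    (hmom : MomentsAndInformation μ V Y g ζ θs) (h : Param K d) :
    h.ofLp ⬝ᵥ (fisher μ V Y g ζ θs).mulVec h.ofLp =
      -∫ ω, logF₂ (ζ (V 0 ω)) (g (V 0 ω)) (Y 0 ω) (reparam θs) (reparamDeriv θs h) ∂μ := by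
  have hH := hmom.moments.self_of_nhds.2
  set H : Ω → Param K d →L[ℝ] Param K d :=
    fun ω => hessLogLik θs (ζ (V 0 ω)) (g (V 0 ω)) (Y 0 ω) with hHdef
  have hent (a b) : Integrable (fun ω => H ω (EuclideanSpace.single b 1) a) μ := by
    exact (EuclideanSpace.proj (𝕜 := ℝ) a : Param K d →L[ℝ] ℝ).integrable_comp
      (hH.apply_continuousLinearMap (EuclideanSpace.single b 1))
  have e1 (ω : Ω) : inner ℝ (H ω h) h =
      ∑ a, ∑ b, h a * (H ω (EuclideanSpace.single b 1) a * h b) := by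
    have hh : h = ∑ b, h b • EuclideanSpace.single b (1 : ℝ) := by
      ext a; simp [-Fintype.sum_sum_type, Pi.single_apply]
    have : H ω h = ∑ b, h b • H ω (EuclideanSpace.single b 1) := by
      conv_lhs => rw [hh]
      simp [-Fintype.sum_sum_type]
    rw [PiLp.inner_apply, this]
    refine Finset.sum_congr rfl fun a _ => ?_
    simp [-Fintype.sum_sum_type, Finset.mul_sum, mul_comm]
  have e2 : h.ofLp ⬝ᵥ (fisher μ V Y g ζ θs).mulVec h.ofLp = -∫ ω, inner ℝ (H ω h) h ∂μ := by
    simp_rw [e1]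
    rw [integral_finsetSum _ fun a _ => integrable_finsetSum _ fun b _ =>
      ((hent a b).mul_const _).const_mul _, dotProduct, ← Finset.sum_neg_distrib]
    refine Finset.sum_congr rfl fun a _ => ?_
    rw [integral_finsetSum _ fun b _ => ((hent a b).mul_const _).const_mul _, Matrix.mulVec,
      dotProduct, Finset.mul_sum, ← Finset.sum_neg_distrib]
    refine Finset.sum_congr rfl fun b _ => ?_
    rw [integral_const_mul, integral_mul_const]
    simp [fisher, hHdef]
  rw [e2]
  congr 1
  simp_rw [hHdef, inner_hessLogLik _ _ _ hθ]
  rw [integral_add (moments_self hθ hmom _).2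
    ((moments_self hθ hmom _).1.integrable one_le_two), integral_logF₁ hm hθ hmom, add_zero]

end Human

end

/-! ### Limits in probability and averages over the sample -/

section

section Prob

variable {Ω : Type*} [MeasurableSpace Ω] {μ : Measure Ω}

lemma ProbTendstoOne.mono_eventually {P Q : ℕ → Ω → Prop} (hP : ProbTendstoOne μ P)
    (h : ∀ᶠ n in atTop, ∀ ω, P n ω → Q n ω) : ProbTendstoOne μ Q := by
  refine tendsto_of_tendsto_of_tendsto_of_le_of_le' tendsto_const_nhds hP
    (Eventually.of_forall fun _ => zero_le) ?_
  filter_upwards [h] with n hn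
  exact measure_mono fun ω hω hPω => hω (hn ω hPω)

lemma ProbTendstoOne.mono {P Q : ℕ → Ω → Prop} (hP : ProbTendstoOne μ P)
    (h : ∀ n ω, P n ω → Q n ω) : ProbTendstoOne μ Q :=
  hP.mono_eventually (Eventually.of_forall h)

lemma ProbTendstoOne.and {P Q : ℕ → Ω → Prop} (hP : ProbTendstoOne μ P)
    (hQ : ProbTendstoOne μ Q) : ProbTendstoOne μ fun n ω => P n ω ∧ Q n ω := by
  have h := hP.add hQ
  rw [add_zero] at h
  refine tendsto_of_tendsto_of_tendsto_of_le_of_le tendsto_const_nhds h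
    (fun _ => zero_le) fun n => ?_
  refine (measure_mono fun ω hω => ?_).trans (measure_union_le _ _)
  simp only [Set.mem_ofPred_eq, Set.mem_union, not_and_or] at hω ⊢
  exact hω

lemma probTendstoOne_of_ae {P : ℕ → Ω → Prop} (h : ∀ᶠ n in atTop, ∀ᵐ ω ∂μ, P n ω) :
    ProbTendstoOne μ P := by
  refine tendsto_const_nhds.congr' ?_
  filter_upwards [h] with n hn
  exact (ae_iff.1 hn).symm

/-- Markov's inequality: nonnegative variables with expectations tending to zero tend to zero in
probability. -/
lemma probTendstoOne_of_integral {X : ℕ → Ω → ℝ} (h0 : ∀ n, 0 ≤ᵐ[μ] X n)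
    (hint : ∀ n, Integrable (X n) μ) (h : Tendsto (fun n => ∫ ω, X n ω ∂μ) atTop (𝓝 0))
    {η : ℝ} (hη : 0 < η) : ProbTendstoOne μ fun n ω => X n ω < η := by
  have h1 : Tendsto (fun n => ENNReal.ofReal ((∫ ω, X n ω ∂μ) / η)) atTop (𝓝 0) := by
    have := ENNReal.tendsto_ofReal (h.div_const η)
    simpa using this
  refine tendsto_of_tendsto_of_tendsto_of_le_of_le tendsto_const_nhds h1
    (fun _ => zero_le) fun n => ?_
  have h2 : μ {ω | ¬ X n ω < η} ≤ (∫⁻ ω, ENNReal.ofReal (X n ω) ∂μ) / ENNReal.ofReal η := by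
    refine (measure_mono fun ω hω => ?_).trans
      (meas_ge_le_lintegral_div (hint n).aemeasurable.ennreal_ofReal
        (ENNReal.ofReal_pos.2 hη).ne' ENNReal.ofReal_ne_top)
    exact ENNReal.ofReal_le_ofReal (not_lt.1 hω)
  rwa [← ofReal_integral_eq_lintegral_ofReal (hint n) (h0 n), ← ENNReal.ofReal_div_of_pos hη] at h2

lemma probTendstoOne_of_tendsto_ae [IsFiniteMeasure μ] {X : ℕ → Ω → ℝ} {c : ℝ}
    (hX : ∀ n, AEStronglyMeasurable (X n) μ)
    (h : ∀ᵐ ω ∂μ, Tendsto (fun n => X n ω) atTop (𝓝 c)) {η : ℝ} (hη : c < η) :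
    ProbTendstoOne μ fun n ω => X n ω < η := by
  have h1 := (tendstoInMeasure_of_tendsto_ae (g := fun _ => c) hX h)
  have h2 := tendstoInMeasure_iff_norm.1 h1 (η - c) (by linarith)
  refine tendsto_of_tendsto_of_tendsto_of_le_of_le tendsto_const_nhds h2
    (fun _ => zero_le) fun n => measure_mono fun ω hω => ?_
  simp only [Set.mem_ofPred_eq, not_lt, Real.norm_eq_abs] at hω ⊢
  exact (by linarith : η - c ≤ X n ω - c).trans (le_abs_self _)

end Prob

variable {K d : ℕ}

section Human

variable {Ω 𝓥 : Type*} [MeasurableSpace Ω] [MeasurableSpace 𝓥]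
  {μ : Measure Ω} {V : ℕ → Ω → 𝓥} {Y : ℕ → Ω → Fin (K + 1)}
  {g : 𝓥 → EuclideanSpace ℝ (Fin d)} {ζ : 𝓥 → ℝ} {θs : Param K d}

/-- A function of an observation, as a function of the triple `(Y_i, X_i, V_i)`. -/
lemma HumanModel.measurable_triple (hm : HumanModel μ V Y g ζ θs) {β : Type*} [MeasurableSpace β]
    {f : ℝ → EuclideanSpace ℝ (Fin d) → Fin (K + 1) → β}
    (hf : ∀ k, Measurable fun p : ℝ × EuclideanSpace ℝ (Fin d) => f p.1 p.2 k) :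
    Measurable fun t : Fin (K + 1) × EuclideanSpace ℝ (Fin d) × 𝓥 => f (ζ t.2.2) t.2.1 t.1 := by
  have h : Measurable fun p : Fin (K + 1) × (ℝ × EuclideanSpace ℝ (Fin d)) =>
      f p.2.1 p.2.2 p.1 := measurable_from_prod_countable_right fun k => hf k
  exact h.comp (measurable_fst.prodMk
    ((hm.meas_ζ.comp (measurable_snd.comp measurable_snd)).prodMk
      (measurable_fst.comp measurable_snd)))

lemma HumanModel.identDistrib (hm : HumanModel μ V Y g ζ θs) {β : Type*} [MeasurableSpace β]
    {f : ℝ → EuclideanSpace ℝ (Fin d) → Fin (K + 1) → β}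
    (hf : ∀ k, Measurable fun p : ℝ × EuclideanSpace ℝ (Fin d) => f p.1 p.2 k) (i : ℕ) :
    IdentDistrib (fun ω => f (ζ (V i ω)) (g (V i ω)) (Y i ω))
      (fun ω => f (ζ (V 0 ω)) (g (V 0 ω)) (Y 0 ω)) μ μ :=
  (hm.ident i).comp (hm.measurable_triple hf)

lemma HumanModel.iIndepFun (hm : HumanModel μ V Y g ζ θs) {β : Type*} [MeasurableSpace β]
    {f : ℝ → EuclideanSpace ℝ (Fin d) → Fin (K + 1) → β}
    (hf : ∀ k, Measurable fun p : ℝ × EuclideanSpace ℝ (Fin d) => f p.1 p.2 k) :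
    iIndepFun (fun i ω => f (ζ (V i ω)) (g (V i ω)) (Y i ω)) μ :=
  hm.indep.comp _ fun _ => hm.measurable_triple hf

/-- The strong law of large numbers for functions of the observations. -/
lemma HumanModel.tendsto_average (hm : HumanModel μ V Y g ζ θs)
    {f : ℝ → EuclideanSpace ℝ (Fin d) → Fin (K + 1) → ℝ}
    (hf : ∀ k, Measurable fun p : ℝ × EuclideanSpace ℝ (Fin d) => f p.1 p.2 k)
    (hint : Integrable (fun ω => f (ζ (V 0 ω)) (g (V 0 ω)) (Y 0 ω)) μ) :
    ∀ᵐ ω ∂μ, Tendsto (fun n : ℕ =>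
      (∑ i ∈ Finset.range n, f (ζ (V i ω)) (g (V i ω)) (Y i ω)) / n) atTop
      (𝓝 (∫ ω, f (ζ (V 0 ω)) (g (V 0 ω)) (Y 0 ω) ∂μ)) :=
  strong_law_ae_real (fun i ω => f (ζ (V i ω)) (g (V i ω)) (Y i ω)) hint
    (fun _ _ hij => (hm.iIndepFun hf).indepFun hij) (hm.identDistrib hf)

lemma HumanModel.aestronglyMeasurable_average (hm : HumanModel μ V Y g ζ θs)
    {f : ℝ → EuclideanSpace ℝ (Fin d) → Fin (K + 1) → ℝ}
    (hf : ∀ k, Measurable fun p : ℝ × EuclideanSpace ℝ (Fin d) => f p.1 p.2 k) (n : ℕ) :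
    AEStronglyMeasurable (fun ω =>
      (∑ i ∈ Finset.range n, f (ζ (V i ω)) (g (V i ω)) (Y i ω)) / n) μ :=
  ((Finset.measurable_sum _ fun i _ => hm.measurable_obs hf i).div_const _).aestronglyMeasurable

/-- The bilinear form of the second derivative of `logF`. -/
def logF₂Bilin (z : ℝ) (x : EuclideanSpace ℝ (Fin d)) (k : Fin (K + 1)) (φ v w : Param K d) : ℝ :=
  (logF₂ z x k φ (v + w) - logF₂ z x k φ v - logF₂ z x k φ w) / 2

lemma logF₂Bilin_eq (z : ℝ) (x : EuclideanSpace ℝ (Fin d)) (k : Fin (K + 1))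
    (φ v w : Param K d) : logF₂Bilin z x k φ v w =
      hasUp k * (-sigVar (upFun z x k φ)) * (upFun z x k v * upFun z x k w) +
      hasLo k * (-sigVar (loFun z x k φ)) * (loFun z x k v * loFun z x k w) +
      hasUp k * hasLo k * logGapDeriv₂ (gapFun d k φ) * (gapFun d k v * gapFun d k w) := by
  simp only [logF₂Bilin, logF₂, map_add]
  ring

lemma param_eq_sum (h : Param K d) : h = ∑ b, h b • EuclideanSpace.single b (1 : ℝ) := by
  ext a; simp [-Fintype.sum_sum_type, Pi.single_apply]

lemma logF₂_eq_sum (z : ℝ) (x : EuclideanSpace ℝ (Fin d)) (k : Fin (K + 1))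
    (φ : Param K d) (L : Param K d →L[ℝ] Param K d) (h : Param K d) :
    logF₂ z x k φ (L h) = ∑ p : ParamIdx K d × ParamIdx K d, h p.1 * h p.2 *
      logF₂Bilin z x k φ (L (EuclideanSpace.single p.1 1)) (L (EuclideanSpace.single p.2 1)) := by
  have hl (l : Param K d →L[ℝ] ℝ) (c : ℝ) : c * l (L h) ^ 2 =
      ∑ p : ParamIdx K d × ParamIdx K d, h p.1 * h p.2 * (c *
        (l (L (EuclideanSpace.single p.1 1)) * l (L (EuclideanSpace.single p.2 1)))) := by
    have e : l (L h) = ∑ a, h a * l (L (EuclideanSpace.single a 1)) := by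
      conv_lhs => rw [param_eq_sum h]
      simp [-Fintype.sum_sum_type]
    rw [e, sq, Finset.sum_mul_sum, Finset.mul_sum, Fintype.sum_prod_type]
    refine Finset.sum_congr rfl fun a _ => ?_
    rw [Finset.mul_sum]
    exact Finset.sum_congr rfl fun b _ => by ring
  simp_rw [logF₂Bilin_eq, mul_add, Finset.sum_add_distrib, ← hl]
  simp only [logF₂]
  ring

/-- The averaged second derivative converges to minus the Fisher information, uniformly for
directions in a ball. -/
lemma probTendstoOne_average_logF₂ [IsProbabilityMeasure μ] (hm : HumanModel μ V Y g ζ θs)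
    (hθ : θs ∈ paramDomain K d) (hmom : MomentsAndInformation μ V Y g ζ θs) (R : ℝ) {η : ℝ}
    (hη : 0 < η) :
    ProbTendstoOne μ fun n ω => ∀ h : Param K d, ‖h‖ ≤ R →
      |(∑ i ∈ Finset.range n, logF₂ (ζ (V i ω)) (g (V i ω)) (Y i ω) (reparam θs)
          (fderiv ℝ reparam θs h)) / n +
        h.ofLp ⬝ᵥ (fisher μ V Y g ζ θs).mulVec h.ofLp| ≤ η := by
  set ψ := reparam θs with hψ
  set J := fderiv ℝ (reparam : Param K d → Param K d) θs with hJ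
  set b : ParamIdx K d × ParamIdx K d → ℝ → EuclideanSpace ℝ (Fin d) → Fin (K + 1) → ℝ :=
    fun p z x k => logF₂Bilin z x k ψ (J (EuclideanSpace.single p.1 1))
      (J (EuclideanSpace.single p.2 1)) with hb
  have hbm (p) (k) : Measurable fun q : ℝ × EuclideanSpace ℝ (Fin d) => b p q.1 q.2 k :=
    (((measurable_logF₂ k _ _).sub (measurable_logF₂ k _ _)).sub
      (measurable_logF₂ k _ _)).div_const _
  have hbint (p) : Integrable (fun ω => b p (ζ (V 0 ω)) (g (V 0 ω)) (Y 0 ω)) μ :=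
    (((moments_self hθ hmom _).2.sub (moments_self hθ hmom _).2).sub
      (moments_self hθ hmom _).2).div_const _
  set A : ParamIdx K d × ParamIdx K d → ℕ → Ω → ℝ := fun p n ω =>
    (∑ i ∈ Finset.range n, b p (ζ (V i ω)) (g (V i ω)) (Y i ω)) / n with hA
  set B : ParamIdx K d × ParamIdx K d → ℝ := fun p =>
    ∫ ω, b p (ζ (V 0 ω)) (g (V 0 ω)) (Y 0 ω) ∂μ with hB
  have hlim : ∀ᵐ ω ∂μ, Tendsto (fun n => R ^ 2 * ∑ p, |A p n ω - B p|) atTop (𝓝 0) := by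
    have := ae_all_iff.2 fun p => hm.tendsto_average (hbm p) (hbint p)
    filter_upwards [this] with ω hω
    have h1 (p) : Tendsto (fun n => |A p n ω - B p|) atTop (𝓝 0) := by
      have h : Tendsto (fun n => A p n ω) atTop (𝓝 (B p)) := hω p
      simpa using (h.sub_const (B p)).abs
    have h2 := (tendsto_finsetSum Finset.univ fun p _ => h1 p).const_mul (R ^ 2)
    simpa using h2
  have hmeas (n : ℕ) : AEStronglyMeasurable (fun ω => R ^ 2 * ∑ p, |A p n ω - B p|) μ := by
    refine AEStronglyMeasurable.const_mul ?_ _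
    refine Finset.aestronglyMeasurable_fun_sum _ fun p _ => ?_
    exact ((hm.aestronglyMeasurable_average (hbm p) n).sub aestronglyMeasurable_const).norm
  refine (probTendstoOne_of_tendsto_ae hmeas hlim hη).mono fun n ω hω h hh => ?_
  have e1 : (∑ i ∈ Finset.range n, logF₂ (ζ (V i ω)) (g (V i ω)) (Y i ω) ψ (J h)) / n =
      ∑ p : ParamIdx K d × ParamIdx K d, h p.1 * h p.2 * A p n ω := by
    simp_rw [logF₂_eq_sum]
    rw [Finset.sum_comm, Finset.sum_div]
    refine Finset.sum_congr rfl fun p _ => ?_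
    rw [← Finset.mul_sum, mul_div_assoc]
  have e2 : h.ofLp ⬝ᵥ (fisher μ V Y g ζ θs).mulVec h.ofLp =
      -∑ p : ParamIdx K d × ParamIdx K d, h p.1 * h p.2 * B p := by
    rw [fisher_quadratic hm hθ hmom, ← fderiv_reparam hθ.2]
    simp_rw [logF₂_eq_sum]
    rw [integral_finsetSum _ fun p _ => (hbint p).const_mul _]
    simp_rw [integral_const_mul]
    rfl
  rw [e1, e2, ← sub_eq_add_neg, ← Finset.sum_sub_distrib]
  refine (Finset.abs_sum_le_sum_abs _ _).trans (le_trans ?_ hω.le)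
  rw [Finset.mul_sum]
  refine Finset.sum_le_sum fun p _ => ?_
  rw [← mul_sub, abs_mul, abs_mul]
  refine mul_le_mul_of_nonneg_right ?_ (abs_nonneg _)
  rw [sq]
  exact mul_le_mul ((abs_apply_le_norm h _).trans hh) ((abs_apply_le_norm h _).trans hh)
    (abs_nonneg _) ((norm_nonneg h).trans hh)

/-- The average of the bound on the Taylor remainders tends to zero in probability. -/
lemma probTendstoOne_average_min [IsProbabilityMeasure μ] (hm : HumanModel μ V Y g ζ θs)
    {D : ℝ → EuclideanSpace ℝ (Fin d) → Fin (K + 1) → ℝ}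
    (hDm : ∀ k, Measurable fun p : ℝ × EuclideanSpace ℝ (Fin d) => D p.1 p.2 k)
    (hD0 : ∀ z x k, 0 ≤ D z x k)
    (hDint : Integrable (fun ω => D (ζ (V 0 ω)) (g (V 0 ω)) (Y 0 ω)) μ)
    {τ : ℕ → ℝ} (hτ0 : ∀ n, 0 ≤ τ n) (hτ : Tendsto τ atTop (𝓝 0)) {η : ℝ} (hη : 0 < η) :
    ProbTendstoOne μ fun n ω => (∑ i ∈ Finset.range n,
      min (2 * τ n * obsSize (ζ (V i ω)) (g (V i ω)) ^ 3)
        (6 * (1 + D (ζ (V i ω)) (g (V i ω)) (Y i ω)))) / n < η := by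
  set f : ℕ → ℝ → EuclideanSpace ℝ (Fin d) → Fin (K + 1) → ℝ := fun n z x k =>
    min (2 * τ n * obsSize z x ^ 3) (6 * (1 + D z x k)) with hf
  have hfm (n k) : Measurable fun p : ℝ × EuclideanSpace ℝ (Fin d) => f n p.1 p.2 k := by
    refine Measurable.min ?_ (((hDm k).const_add 1).const_mul 6)
    have : Continuous fun p : ℝ × EuclideanSpace ℝ (Fin d) => obsSize p.1 p.2 := by
      unfold obsSize; fun_prop
    exact ((this.measurable.pow_const 3).const_mul _)
  have hf0 (n z x k) : 0 ≤ f n z x k := by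
    have h1 := one_le_obsSize z x
    have h2 := hD0 z x k
    have h3 := hτ0 n
    exact le_min (by positivity) (by positivity)
  have hle (n z x k) : f n z x k ≤ 6 * (1 + D z x k) := min_le_right _ _
  have hbound : Integrable (fun ω => 6 * (1 + D (ζ (V 0 ω)) (g (V 0 ω)) (Y 0 ω))) μ :=
    ((integrable_const 1).add hDint).const_mul 6
  have hint0 (n) : Integrable (fun ω => f n (ζ (V 0 ω)) (g (V 0 ω)) (Y 0 ω)) μ :=
    hbound.mono' (hm.measurable_obs (hfm n) 0).aestronglyMeasurable
      (ae_of_all _ fun ω => by rw [Real.norm_eq_abs, abs_of_nonneg (hf0 _ _ _ _)]; exact hle _ _ _ _)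
  have hinti (n i) : Integrable (fun ω => f n (ζ (V i ω)) (g (V i ω)) (Y i ω)) μ :=
    (hm.identDistrib (hfm n) i).integrable_iff.2 (hint0 n)
  have hlim : Tendsto (fun n => ∫ ω, f n (ζ (V 0 ω)) (g (V 0 ω)) (Y 0 ω) ∂μ) atTop (𝓝 0) := by
    have h0 : ∫ _ω : Ω, (0 : ℝ) ∂μ = 0 := by simp
    rw [← h0]
    refine tendsto_integral_of_dominated_convergence _
      (fun n => (hm.measurable_obs (hfm n) 0).aestronglyMeasurable) hbound
      (fun n => ae_of_all _ fun ω => ?_) (ae_of_all _ fun ω => ?_)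
    · rw [Real.norm_eq_abs, abs_of_nonneg (hf0 _ _ _ _)]; exact hle _ _ _ _
    · have h1 : Tendsto (fun n => 2 * τ n * obsSize (ζ (V 0 ω)) (g (V 0 ω)) ^ 3) atTop (𝓝 0) := by
        simpa using (hτ.const_mul 2).mul_const (obsSize (ζ (V 0 ω)) (g (V 0 ω)) ^ 3)
      exact tendsto_of_tendsto_of_tendsto_of_le_of_le tendsto_const_nhds h1
        (fun n => hf0 _ _ _ _) (fun n => min_le_left _ _)
  refine probTendstoOne_of_integral (X := fun n ω => (∑ i ∈ Finset.range n,
    f n (ζ (V i ω)) (g (V i ω)) (Y i ω)) / n) (fun n => ae_of_all _ fun ω =>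
      div_nonneg (Finset.sum_nonneg fun i _ => hf0 _ _ _ _) (Nat.cast_nonneg n))
    (fun n => (integrable_finsetSum _ fun i _ => hinti n i).div_const _) ?_ hη
  refine hlim.congr' ?_
  filter_upwards [eventually_gt_atTop 0] with n hn
  rw [integral_div, integral_finsetSum _ fun i _ => hinti n i]
  simp_rw [fun i => (hm.identDistrib (hfm n) i).integral_eq]
  have : (n : ℝ) ≠ 0 := by positivity
  simp [this]

/-- The effect of replacing the latent scores by approximations with `∑ (ẑ_i - z_i)² → 0`. -/
lemma probTendstoOne_perturb [IsProbabilityMeasure μ] (hm : HumanModel μ V Y g ζ θs)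
    {D : ℝ → EuclideanSpace ℝ (Fin d) → Fin (K + 1) → ℝ}
    (hDm : ∀ k, Measurable fun p : ℝ × EuclideanSpace ℝ (Fin d) => D p.1 p.2 k)
    (hD0 : ∀ z x k, 0 ≤ D z x k)
    (hDint : Integrable (fun ω => D (ζ (V 0 ω)) (g (V 0 ω)) (Y 0 ω)) μ)
    {Zhat : (n : ℕ) → Ω → Fin n → ℝ}
    (hZ : ∀ δ > 0, ProbTendstoOne μ fun n ω => ∑ i, (Zhat n ω i - ζ (V i ω)) ^ 2 < δ)
    {η : ℝ} (hη : 0 < η) :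
    ProbTendstoOne μ fun n ω => (∑ i, |Zhat n ω i - ζ (V i ω)| *
      (1 + √(D (ζ (V i ω)) (g (V i ω)) (Y i ω)))) / √n < η := by
  set E := ∫ ω, D (ζ (V 0 ω)) (g (V 0 ω)) (Y 0 ω) ∂μ with hE
  have hE0 : 0 ≤ E := integral_nonneg fun ω => hD0 _ _ _
  have hav := probTendstoOne_of_tendsto_ae (hm.aestronglyMeasurable_average hDm)
    (hm.tendsto_average hDm hDint) (lt_add_one E)
  refine ((hZ (η ^ 2 / (4 * (E + 2))) (by positivity)).and hav).mono_eventually ?_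
  filter_upwards [eventually_gt_atTop 0] with n hn ω ⟨h1, h2⟩
  have hn' : (0 : ℝ) < n := by positivity
  have hCS := Finset.sum_mul_sq_le_sq_mul_sq (Finset.univ : Finset (Fin n))
    (fun i => |Zhat n ω i - ζ (V i ω)|) (fun i => 1 + √(D (ζ (V i ω)) (g (V i ω)) (Y i ω)))
  simp_rw [sq_abs] at hCS
  have h3 : ∑ i : Fin n, (1 + √(D (ζ (V i ω)) (g (V i ω)) (Y i ω))) ^ 2 ≤ 2 * n * (E + 2) := by
    calc ∑ i : Fin n, (1 + √(D (ζ (V i ω)) (g (V i ω)) (Y i ω))) ^ 2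
        ≤ ∑ i : Fin n, 2 * (1 + D (ζ (V i ω)) (g (V i ω)) (Y i ω)) := by
          refine Finset.sum_le_sum fun i _ => ?_
          have := Real.sq_sqrt (hD0 (ζ (V i ω)) (g (V i ω)) (Y i ω))
          nlinarith [sq_nonneg (1 - √(D (ζ (V i ω)) (g (V i ω)) (Y i ω)))]
      _ = 2 * (n + ∑ i ∈ Finset.range n, D (ζ (V i ω)) (g (V i ω)) (Y i ω)) := by
          rw [← Finset.mul_sum, Finset.sum_add_distrib,
            Fin.sum_univ_eq_sum_range (fun i => D (ζ (V i ω)) (g (V i ω)) (Y i ω)) n]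
          simp
      _ ≤ 2 * n * (E + 2) := by
          rw [div_lt_iff₀ hn'] at h2
          linarith
  rw [div_lt_iff₀ (Real.sqrt_pos.2 hn')]
  refine lt_of_pow_lt_pow_left₀ 2 (by positivity) (hCS.trans_lt ?_)
  have h4 : 0 ≤ ∑ i : Fin n, (Zhat n ω i - ζ (V i ω)) ^ 2 :=
    Finset.sum_nonneg fun i _ => sq_nonneg _
  calc _ ≤ (η ^ 2 / (4 * (E + 2))) * (2 * n * (E + 2)) :=
        mul_le_mul h1.le h3 (Finset.sum_nonneg fun i _ => sq_nonneg _) (by positivity)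
    _ < (η * √n) ^ 2 := by
        rw [mul_pow, Real.sq_sqrt hn'.le]
        field_simp
        norm_num

end Human

end

/-! ### The local quadratic expansion -/

section

variable {K d : ℕ}

lemma logF₁_smul (z : ℝ) (x : EuclideanSpace ℝ (Fin d)) (k : Fin (K + 1)) (φ v : Param K d)
    (r : ℝ) : logF₁ z x k φ (r • v) = r * logF₁ z x k φ v := by
  simp only [logF₁, map_smul, smul_eq_mul]; ring

lemma logF₂_smul (z : ℝ) (x : EuclideanSpace ℝ (Fin d)) (k : Fin (K + 1)) (φ v : Param K d)
    (r : ℝ) : logF₂ z x k φ (r • v) = r ^ 2 * logF₂ z x k φ v := by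
  simp only [logF₂, map_smul, smul_eq_mul]; ring

/-- The increment of the log-likelihood of `n` labels when the parameter moves from `ψ = reparam θ`
to `ψ + n^{-1/2} J h`, where `J` is the derivative of `reparam` at `θ`. -/
def increment {n : ℕ} (y : Fin n → Fin (K + 1)) (z : Fin n → ℝ)
    (x : Fin n → EuclideanSpace ℝ (Fin d)) (θ h : Param K d) : ℝ :=
  ∑ i, (logF (z i) (x i) (y i) (reparam θ + fderiv ℝ reparam θ ((√n)⁻¹ • h)) -
    logF (z i) (x i) (y i) (reparam θ))

section Human

variable {Ω 𝓥 : Type*} [MeasurableSpace Ω] [MeasurableSpace 𝓥]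
  {μ : Measure Ω} [IsProbabilityMeasure μ] {V : ℕ → Ω → 𝓥} {Y : ℕ → Ω → Fin (K + 1)}
  {g : 𝓥 → EuclideanSpace ℝ (Fin d)} {ζ : 𝓥 → ℝ} {θs : Param K d}

lemma tendsto_div_sqrt (c : ℝ) : Tendsto (fun n : ℕ => c / √n) atTop (𝓝 0) :=
  tendsto_const_nhds.div_atTop (Real.tendsto_sqrt_atTop.comp tendsto_natCast_atTop_atTop)

/-- Local quadratic expansion of the log-likelihood, uniformly for local parameters in a ball, also
when the latent scores are replaced by approximations. -/
lemma probTendstoOne_expansion (hm : HumanModel μ V Y g ζ θs) (hθ : θs ∈ paramDomain K d)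
    (hmom : MomentsAndInformation μ V Y g ζ θs) {Zhat : (n : ℕ) → Ω → Fin n → ℝ}
    (hZ : ∀ δ > 0, ProbTendstoOne μ fun n ω => ∑ i, (Zhat n ω i - ζ (V i ω)) ^ 2 < δ)
    {R : ℝ} (hR : 0 < R) {η : ℝ} (hη : 0 < η) :
    ProbTendstoOne μ fun n ω => ∀ h : Param K d, ‖h‖ ≤ R →
      |increment (fun i : Fin n => Y i ω) (Zhat n ω) (fun i : Fin n => g (V i ω)) θs h -
        ((√n)⁻¹ * ∑ i ∈ Finset.range n, logF₁ (ζ (V i ω)) (g (V i ω)) (Y i ω) (reparam θs)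
            (fderiv ℝ reparam θs h) -
          h.ofLp ⬝ᵥ (fisher μ V Y g ζ θs).mulVec h.ofLp / 2)| ≤ η := by
  obtain ⟨ε, D, hε, hDm, hD0, hDint, hD⟩ := exists_envelope hθ hmom
  obtain ⟨C, δ₂, hC, hδ₂, hpert⟩ := exists_perturb_bound hε hD
  set ψ := reparam θs with hψ
  set J := fderiv ℝ (reparam : Param K d → Param K d) θs with hJ
  set c := ‖J‖ * R + 1 with hc
  have hc0 : 0 < c := by positivity
  set κ := η / (4 * c ^ 2) with hκ
  have hκ0 : 0 < κ := by positivity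
  obtain ⟨δ₁, hδ₁, htay⟩ := exists_taylor_bound (reparam_mem_ordered hθ) hε hD hκ0
  have hτ := tendsto_div_sqrt c
  have hev1 := hτ.eventually (gt_mem_nhds hδ₁)
  have hev2 := hτ.eventually (gt_mem_nhds hδ₂)
  have hp1 := probTendstoOne_average_min hm hDm hD0 hDint
    (fun n => div_nonneg hc0.le (Real.sqrt_nonneg n)) hτ hκ0
  have hp2 := probTendstoOne_perturb hm hDm hD0 hDint hZ (η := η / (4 * (C * c + 1)))
    (by positivity)
  have hp3 := probTendstoOne_average_logF₂ hm hθ hmom R (half_pos hη)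
  refine ((hp1.and hp2).and (hp3.and (hZ 1 one_pos))).mono_eventually ?_
  filter_upwards [hev1, hev2, eventually_gt_atTop 0] with n hn1 hn2 hn0 ω ⟨⟨h1, h2⟩, h3, h4⟩ h hh
  have hn : (0 : ℝ) < n := by positivity
  have hsn : 0 < √n := Real.sqrt_pos.2 hn
  have hsq : √n ^ 2 = n := Real.sq_sqrt hn.le
  set v := J ((√n)⁻¹ • h) with hv
  have hvn : ‖v‖ ≤ c / √n := by
    rw [hv, map_smul, norm_smul, norm_inv, Real.norm_eq_abs, abs_of_pos hsn, ← div_eq_inv_mul]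
    refine div_le_div_of_nonneg_right ?_ hsn.le
    exact (J.le_opNorm h).trans ((mul_le_mul_of_nonneg_left hh (norm_nonneg _)).trans
      (by linarith))
  have hvn2 : ‖v‖ ^ 2 ≤ c ^ 2 / n := by
    rw [← hsq, ← div_pow]; exact pow_le_pow_left₀ (norm_nonneg _) hvn 2
  have hΔ (i : Fin n) : |Zhat n ω i - ζ (V i ω)| ≤ 1 := by
    have := Finset.single_le_sum (f := fun i => (Zhat n ω i - ζ (V i ω)) ^ 2)
      (fun i _ => sq_nonneg _) (Finset.mem_univ i)
    rw [← sq_le_one_iff_abs_le_one]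
    exact this.trans h4.le
  -- The three error terms.
  set p : Fin n → ℝ := fun i =>
    (logF (Zhat n ω i) (g (V i ω)) (Y i ω) (ψ + v) - logF (Zhat n ω i) (g (V i ω)) (Y i ω) ψ) -
      (logF (ζ (V i ω)) (g (V i ω)) (Y i ω) (ψ + v) - logF (ζ (V i ω)) (g (V i ω)) (Y i ω) ψ)
    with hp
  set t : ℕ → ℝ := fun i => logF (ζ (V i ω)) (g (V i ω)) (Y i ω) (ψ + v) -
    logF (ζ (V i ω)) (g (V i ω)) (Y i ω) ψ - logF₁ (ζ (V i ω)) (g (V i ω)) (Y i ω) ψ v -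
      logF₂ (ζ (V i ω)) (g (V i ω)) (Y i ω) ψ v / 2 with ht
  have hpsum : |∑ i, p i| ≤ η / 4 := by
    set S := ∑ i, |Zhat n ω i - ζ (V i ω)| *
      (1 + √(D (ζ (V i ω)) (g (V i ω)) (Y i ω))) with hS
    have hS0 : 0 ≤ S := Finset.sum_nonneg fun i _ =>
      mul_nonneg (abs_nonneg _) (by positivity)
    calc |∑ i, p i| ≤ ∑ i, |p i| := Finset.abs_sum_le_sum_abs _ _
      _ ≤ ∑ i, C * (c / √n) * (|Zhat n ω i - ζ (V i ω)| *
            (1 + √(D (ζ (V i ω)) (g (V i ω)) (Y i ω)))) := by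
          refine Finset.sum_le_sum fun i _ => ?_
          refine (hpert _ _ _ _ v (hvn.trans hn2.le) (hΔ i)).trans ?_
          rw [mul_assoc (C * ‖v‖)]
          refine mul_le_mul_of_nonneg_right (mul_le_mul_of_nonneg_left hvn hC) ?_
          exact mul_nonneg (abs_nonneg _) (by positivity)
      _ = C * c * (S / √n) := by rw [← Finset.mul_sum]; ring
      _ ≤ (C * c + 1) * (η / (4 * (C * c + 1))) := by
          refine mul_le_mul (by linarith) h2.le (by positivity) (by positivity)
      _ = η / 4 := by field_simp
  have htsum : |∑ i ∈ Finset.range n, t i| ≤ η / 2 := by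
    set m : ℕ → ℝ := fun i => min (2 * (c / √n) * obsSize (ζ (V i ω)) (g (V i ω)) ^ 3)
        (6 * (1 + D (ζ (V i ω)) (g (V i ω)) (Y i ω))) with hmdef
    have hm0 (i) : 0 ≤ m i := by
      have h1 := one_le_obsSize (ζ (V i ω)) (g (V i ω))
      have h2 := hD0 (ζ (V i ω)) (g (V i ω)) (Y i ω)
      exact le_min (by positivity) (by positivity)
    calc |∑ i ∈ Finset.range n, t i| ≤ ∑ i ∈ Finset.range n, |t i| :=
          Finset.abs_sum_le_sum_abs _ _
      _ ≤ ∑ i ∈ Finset.range n, c ^ 2 / n * (κ + m i) := by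
          refine Finset.sum_le_sum fun i _ => ?_
          refine (htay _ _ _ v (c / √n) hvn hn1.le).trans ?_
          exact mul_le_mul_of_nonneg_right hvn2 (add_nonneg hκ0.le (hm0 i))
      _ = c ^ 2 * (κ + (∑ i ∈ Finset.range n, m i) / n) := by
          rw [← Finset.mul_sum, Finset.sum_add_distrib]
          simp
          field_simp
      _ ≤ c ^ 2 * (κ + κ) := by
          refine mul_le_mul_of_nonneg_left ?_ (sq_nonneg c)
          linarith
      _ = η / 2 := by rw [hκ]; field_simp; norm_num
  have e1 : increment (fun i : Fin n => Y i ω) (Zhat n ω) (fun i : Fin n => g (V i ω)) θs h =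
      ∑ i, p i + ∑ i ∈ Finset.range n, t i +
        ∑ i ∈ Finset.range n, (logF₁ (ζ (V i ω)) (g (V i ω)) (Y i ω) ψ v +
          logF₂ (ζ (V i ω)) (g (V i ω)) (Y i ω) ψ v / 2) := by
    rw [add_assoc, ← Finset.sum_add_distrib, ← Fin.sum_univ_eq_sum_range (n := n)
      (fun i => t i + (logF₁ (ζ (V i ω)) (g (V i ω)) (Y i ω) ψ v +
          logF₂ (ζ (V i ω)) (g (V i ω)) (Y i ω) ψ v / 2)), ← Finset.sum_add_distrib, increment]
    refine Finset.sum_congr rfl fun i _ => ?_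
    simp only [hp, ht, hv]
    ring
  have e2 : ∑ i ∈ Finset.range n, (logF₁ (ζ (V i ω)) (g (V i ω)) (Y i ω) ψ v +
      logF₂ (ζ (V i ω)) (g (V i ω)) (Y i ω) ψ v / 2) =
      (√n)⁻¹ * ∑ i ∈ Finset.range n, logF₁ (ζ (V i ω)) (g (V i ω)) (Y i ω) ψ (J h) +
      (∑ i ∈ Finset.range n, logF₂ (ζ (V i ω)) (g (V i ω)) (Y i ω) ψ (J h)) / n / 2 := by
    rw [hv, map_smul]
    simp_rw [logF₁_smul, logF₂_smul]
    rw [Finset.sum_add_distrib, ← Finset.mul_sum, ← Finset.sum_div, ← Finset.mul_sum, inv_pow, hsq]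
    ring
  have h3' := abs_le.1 (h3 h hh)
  have hp' := abs_le.1 hpsum
  have ht' := abs_le.1 htsum
  rw [e1, e2, abs_le]
  constructor <;> linarith [h3'.1, h3'.2, hp'.1, hp'.2, ht'.1, ht'.2]

end Human

/-- If a concave function is, on a ball, uniformly close to a quadratic function with maximizer `k₀`,
then every point at which the function is at least as large as at `k₀` is close to `k₀`. -/
lemma norm_sub_lt_of_concaveOn {E : Type*} [NormedAddCommGroup E] [NormedSpace ℝ E] {s : Set E}
    {F Q : E → ℝ} {k₀ k : E} {c η δ R l : ℝ} (hF : ConcaveOn ℝ s F)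
    (hs : Metric.closedBall 0 R ⊆ s) (hδ : 0 < δ) (hk₀ : ‖k₀‖ + δ ≤ R)
    (hQ0 : Q 0 = 0) (hQ : ∀ v, l * ‖v‖ ^ 2 ≤ Q v) (hη : 4 * η < l * δ ^ 2)
    (happrox : ∀ h, ‖h‖ ≤ R → |F h - (c - Q (h - k₀) / 2)| ≤ η)
    (hk : k ∈ s) (hge : F k₀ ≤ F k) : ‖k - k₀‖ < δ := by
  by_contra! hcon
  set r := δ / ‖k - k₀‖ with hr
  have hpos : 0 < ‖k - k₀‖ := hδ.trans_le hcon
  have hr0 : 0 ≤ r := by positivity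
  have hr1 : r ≤ 1 := (div_le_one hpos).2 hcon
  have hk₀s : k₀ ∈ s := hs (by simpa using by linarith)
  set h := (1 - r) • k₀ + r • k with hh
  have hdiff : h - k₀ = r • (k - k₀) := by rw [hh]; module
  have hnorm : ‖h - k₀‖ = δ := by
    rw [hdiff, norm_smul, Real.norm_eq_abs, abs_of_nonneg hr0, hr, div_mul_cancel₀ _ hpos.ne']
  have hFh : F k₀ ≤ F h := by
    have := hF.2 hk₀s hk (by linarith : 0 ≤ 1 - r) hr0 (by ring)
    simp only [smul_eq_mul] at this
    nlinarith
  have h1 := (abs_le.1 (happrox h (by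
    have := norm_add_le (h - k₀) k₀
    rw [sub_add_cancel, hnorm] at this
    linarith))).2
  have h2 := (abs_le.1 (happrox k₀ (by linarith))).1
  rw [sub_self, hQ0] at h2
  have h3 := hQ (h - k₀)
  rw [hnorm] at h3
  linarith

lemma exists_posDef_lower_bound {ι : Type*} [Fintype ι] [Nonempty ι] [DecidableEq ι]
    {S : Matrix ι ι ℝ} (hS : S.PosDef) :
    ∃ l > 0, ∀ v : EuclideanSpace ℝ ι, l * ‖v‖ ^ 2 ≤ v.ofLp ⬝ᵥ S.mulVec v.ofLp := by
  have hcont : Continuous fun v : EuclideanSpace ℝ ι => v.ofLp ⬝ᵥ S.mulVec v.ofLp := by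
    simp_rw [← Matrix.inner_toEuclideanCLM]
    fun_prop
  obtain ⟨u, hu, hmin⟩ := (isCompact_sphere (0 : EuclideanSpace ℝ ι) 1).exists_isMinOn
    (NormedSpace.sphere_nonempty.2 zero_le_one) hcont.continuousOn
  have hu0 : u ≠ 0 := by
    rintro rfl; simp at hu
  refine ⟨u.ofLp ⬝ᵥ S.mulVec u.ofLp, ?_, fun v => ?_⟩
  · have := hS.dotProduct_mulVec_pos (x := u.ofLp) (by simpa using hu0)
    simpa using this
  · rcases eq_or_ne v 0 with rfl | hv
    · simp
    have hvn : ‖v‖ ≠ 0 := norm_ne_zero_iff.2 hv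
    have h1 : (‖v‖⁻¹ • v) ∈ Metric.sphere (0 : EuclideanSpace ℝ ι) 1 := by
      simp [norm_smul, hvn]
    have h2 := isMinOn_iff.1 hmin _ h1
    simp only [WithLp.ofLp_smul, Matrix.mulVec_smul, smul_dotProduct, dotProduct_smul,
      smul_eq_mul] at h2
    have h3 : v.ofLp ⬝ᵥ S.mulVec v.ofLp =
      ‖v‖ ^ 2 * (‖v‖⁻¹ * (‖v‖⁻¹ * (v.ofLp ⬝ᵥ S.mulVec v.ofLp))) := by
      field_simp
    rw [h3, mul_comm]
    exact mul_le_mul_of_nonneg_left h2 (sq_nonneg _)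

/-- Variables that converge in distribution are bounded in probability. -/
lemma exists_norm_bound_of_tendstoInDistribution {Ω E : Type*} [MeasurableSpace Ω]
    {μ : Measure Ω} [IsProbabilityMeasure μ] [NormedAddCommGroup E]
    [MeasurableSpace E] [BorelSpace E] {X : ℕ → Ω → E} {ν : Measure E} [IsProbabilityMeasure ν]
    (hX : TendstoInDistribution X atTop id (fun _ => μ) ν) {ε : ℝ≥0∞} (hε : 0 < ε) :
    ∃ R : ℝ, 0 < R ∧ ∀ᶠ n in atTop, μ {ω | R ≤ ‖X n ω‖} ≤ ε := by
  have hcl (R : ℝ) : IsClosed {x : E | R ≤ ‖x‖} := isClosed_le continuous_const continuous_norm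
  have hlim : Tendsto (fun m : ℕ => ν {x : E | (m : ℝ) ≤ ‖x‖}) atTop (𝓝 0) := by
    have h1 := tendsto_measure_iInter_atTop (μ := ν) (s := fun m : ℕ => {x : E | (m : ℝ) ≤ ‖x‖})
      (fun m => (hcl m).measurableSet.nullMeasurableSet)
      (fun m m' h x hx => le_trans (by exact_mod_cast h) (Set.mem_ofPred_eq ▸ hx))
      ⟨0, measure_ne_top _ _⟩
    have h2 : ⋂ m : ℕ, {x : E | (m : ℝ) ≤ ‖x‖} = ∅ := by
      ext x
      simp only [Set.mem_iInter, Set.mem_ofPred_eq, Set.mem_empty_iff_false, iff_false, not_forall,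
        not_le]
      exact exists_nat_gt _
    rwa [h2, measure_empty] at h1
  obtain ⟨m, hm, hm0⟩ := ((hlim.eventually (gt_mem_nhds hε)).and (eventually_gt_atTop 0)).exists
  refine ⟨m, by positivity, ?_⟩
  have hsup := ProbabilityMeasure.limsup_measure_closed_le_of_tendsto hX.tendsto (hcl m)
  have h3 := Filter.eventually_lt_of_limsup_lt (hsup.trans_lt (by simpa using hm))
  filter_upwards [h3] with n hn
  rw [ProbabilityMeasure.coe_mk, Measure.map_apply_of_aemeasurable (hX.forall_aemeasurable n)
    (hcl m).measurableSet] at hn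
  exact hn.le

end

/-! ### Asymptotic normality of the maximum likelihood estimator -/

section

variable {K d : ℕ}

/-- The quadratic form of a symmetric matrix, completed to a square. -/
lemma inner_sub_quadratic {ι : Type*} [Fintype ι] [DecidableEq ι] {S : Matrix ι ι ℝ}
    (hS : S.IsHermitian) (k h : EuclideanSpace ℝ ι) :
    inner ℝ k (Matrix.toEuclideanCLM (𝕜 := ℝ) S h) - h.ofLp ⬝ᵥ S.mulVec h.ofLp / 2 =
      k.ofLp ⬝ᵥ S.mulVec k.ofLp / 2 - (h - k).ofLp ⬝ᵥ S.mulVec (h - k).ofLp / 2 := by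
  have hsymm : k.ofLp ⬝ᵥ S.mulVec h.ofLp = h.ofLp ⬝ᵥ S.mulVec k.ofLp := by
    have hT : S.transpose = S := by simpa using hS.eq
    rw [Matrix.dotProduct_mulVec, ← Matrix.mulVec_transpose, hT, dotProduct_comm]
  rw [Matrix.inner_toEuclideanCLM]
  simp only [WithLp.ofLp_sub, Matrix.mulVec_sub, sub_dotProduct, dotProduct_sub]
  rw [hsymm]
  ring

lemma inner_toEuclideanCLM_comm {ι : Type*} [Fintype ι] [DecidableEq ι] {S : Matrix ι ι ℝ}
    (hS : S.IsHermitian) (x y : EuclideanSpace ℝ ι) :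
    inner ℝ (Matrix.toEuclideanCLM (𝕜 := ℝ) S x) y =
      inner ℝ x (Matrix.toEuclideanCLM (𝕜 := ℝ) S y) := by
  have hT : S.transpose = S := by simpa using hS.eq
  rw [real_inner_comm, Matrix.inner_toEuclideanCLM, Matrix.inner_toEuclideanCLM,
    Matrix.dotProduct_mulVec, ← Matrix.mulVec_transpose, hT, dotProduct_comm]

/-- The log-likelihood increment is concave in the local parameter. -/
lemma concaveOn_increment {n : ℕ} (y : Fin n → Fin (K + 1)) (z : Fin n → ℝ)
    (x : Fin n → EuclideanSpace ℝ (Fin d)) (θ : Param K d) :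
    ConcaveOn ℝ {h | reparam θ + fderiv ℝ reparam θ ((√n)⁻¹ • h) ∈ ordered K d}
      (increment y z x θ) := by
  set A : Param K d →ᵃ[ℝ] Param K d :=
    (AffineMap.const ℝ (Param K d) (reparam θ)) +
      ((√n)⁻¹ • (fderiv ℝ reparam θ).toLinearMap).toAffineMap with hA
  have hAapp (h : Param K d) :
      A h = reparam θ + fderiv ℝ reparam θ ((√n)⁻¹ • h) := by
    simp [hA]
  have hset : {h | reparam θ + fderiv ℝ reparam θ ((√n)⁻¹ • h) ∈ ordered K d} =
      A ⁻¹' ordered K d := by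
    ext h; simp [hAapp]
  have hconv : Convex ℝ (A ⁻¹' ordered K d) := convex_ordered.affine_preimage A
  rw [hset]
  have hfun : increment y z x θ =
      ∑ i, fun h => logF (z i) (x i) (y i) (A h) - logF (z i) (x i) (y i) (reparam θ) := by
    ext h
    simp only [increment, Finset.sum_apply, hAapp]
  rw [hfun]
  refine Finset.sum_induction _ (fun f => ConcaveOn ℝ (A ⁻¹' ordered K d) f)
    (fun _ _ h1 h2 => h1.add h2) (concaveOn_const 0 hconv) fun i _ => ?_
  exact ((concaveOn_logF (z i) (x i) (y i)).comp_affineMap A).sub (convexOn_const _ hconv)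

lemma sampleLogLik_eq {n : ℕ} (y : Fin n → Fin (K + 1)) (z : Fin n → ℝ)
    (x : Fin n → EuclideanSpace ℝ (Fin d)) {θ : Param K d} (hθ : θ ∈ paramDomain K d) :
    sampleLogLik y z x θ = ∑ i, logF (z i) (x i) (y i) (reparam θ) := by
  refine Finset.sum_congr rfl fun i _ => ?_
  simp [logLik_eq hθ.1]

/-- At the scale `n^{-1/2}`, the local parameters of a ball correspond to points of any given
neighborhood of the center. -/
lemma eventually_forall_norm_le_local {E : Type*} [NormedAddCommGroup E] [NormedSpace ℝ E]
    {p : E → Prop} {ψ : E} (hp : ∀ᶠ φ in 𝓝 ψ, p φ) (J : E →L[ℝ] E) (R : ℝ) :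
    ∀ᶠ n : ℕ in atTop, ∀ h : E, ‖h‖ ≤ R → p (ψ + J ((√n)⁻¹ • h)) := by
  obtain ⟨r, hr, hball⟩ := Metric.eventually_nhds_iff.1 hp
  filter_upwards [(tendsto_div_sqrt (‖J‖ * R)).eventually (gt_mem_nhds hr)] with n hn h hh
  refine hball ?_
  rw [dist_eq_norm, add_sub_cancel_left, map_smul, norm_smul, norm_inv, Real.norm_eq_abs,
    abs_of_nonneg (Real.sqrt_nonneg _), ← div_eq_inv_mul]
  refine lt_of_le_of_lt (div_le_div_of_nonneg_right ?_ (Real.sqrt_nonneg _)) hn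
  exact (J.le_opNorm h).trans (mul_le_mul_of_nonneg_left hh (norm_nonneg _))

section Human

variable {Ω 𝓥 : Type*} [MeasurableSpace Ω] [MeasurableSpace 𝓥]
  {μ : Measure Ω} {V : ℕ → Ω → 𝓥} {Y : ℕ → Ω → Fin (K + 1)}
  {g : 𝓥 → EuclideanSpace ℝ (Fin d)} {ζ : 𝓥 → ℝ} {θs : Param K d}

/-- The influence function `S⁻¹ ∇_θ log l_k(θ; z, x)` of the maximum likelihood estimator, where `S`
stands for the information matrix. -/
def influence (S : Matrix (ParamIdx K d) (ParamIdx K d) ℝ) (θ : Param K d) (z : ℝ)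
    (x : EuclideanSpace ℝ (Fin d)) (k : Fin (K + 1)) : Param K d :=
  Matrix.toEuclideanCLM (𝕜 := ℝ) S⁻¹ (score θ z x k)

lemma inner_influence {S : Matrix (ParamIdx K d) (ParamIdx K d) ℝ} (hS : S.PosDef)
    {θ : Param K d} (hθ : θ ∈ paramDomain K d) (z : ℝ) (x : EuclideanSpace ℝ (Fin d))
    (k : Fin (K + 1)) (t : Param K d) :
    inner ℝ (influence S θ z x k) t =
      logF₁ z x k (reparam θ) (reparamDeriv θ (Matrix.toEuclideanCLM (𝕜 := ℝ) S⁻¹ t)) := by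
  rw [influence, inner_toEuclideanCLM_comm hS.isHermitian.inv, inner_score z x k hθ]

lemma measurable_influence {S : Matrix (ParamIdx K d) (ParamIdx K d) ℝ} (hS : S.PosDef)
    {θ : Param K d} (hθ : θ ∈ paramDomain K d) (k : Fin (K + 1)) :
    Measurable fun p : ℝ × EuclideanSpace ℝ (Fin d) => influence S θ p.1 p.2 k := by
  have h : Measurable fun p : ℝ × EuclideanSpace ℝ (Fin d) =>
      (influence S θ p.1 p.2 k).ofLp := by
    refine measurable_pi_lambda _ fun a => ?_
    have h1 (p : ℝ × EuclideanSpace ℝ (Fin d)) : (influence S θ p.1 p.2 k).ofLp a =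
        inner ℝ (influence S θ p.1 p.2 k) (EuclideanSpace.single a 1) := by
      simp [EuclideanSpace.inner_single_right]
    simp_rw [h1, inner_influence hS hθ]
    exact measurable_logF₁ k _ _
  exact (WithLp.measurable_toLp 2 _).comp h

lemma toEuclideanCLM_inv_apply {ι : Type*} [Fintype ι] [DecidableEq ι] {S : Matrix ι ι ℝ}
    (hS : S.PosDef) (h : EuclideanSpace ℝ ι) :
    Matrix.toEuclideanCLM (𝕜 := ℝ) S⁻¹ (Matrix.toEuclideanCLM (𝕜 := ℝ) S h) = h := by
  rw [← mul_apply_eq_comp, ← map_mul,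
    Matrix.nonsing_inv_mul _ ((Matrix.isUnit_iff_isUnit_det _).1 hS.isUnit), map_one]
  rfl

variable [IsProbabilityMeasure μ]

/-- The central limit theorem for the influence function. -/
lemma tendstoInDistribution_influence (hm : HumanModel μ V Y g ζ θs) (hθ : θs ∈ paramDomain K d)
    (hmom : MomentsAndInformation μ V Y g ζ θs) :
    TendstoInDistribution (fun (n : ℕ) ω => (√n)⁻¹ • ∑ i ∈ Finset.range n,
        influence (fisher μ V Y g ζ θs) θs (ζ (V i ω)) (g (V i ω)) (Y i ω)) atTop id
      (fun _ => μ) (multivariateGaussian 0 (fisher μ V Y g ζ θs)⁻¹) := by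
  have hI := hmom.information
  have hmeas := measurable_influence hI hθ
  refine tendstoInDistribution_multivariateGaussian hI.inv.posSemidef (hm.iIndepFun hmeas)
    (hm.identDistrib hmeas) (fun t => ?_) (fun t => ?_) (fun t => ?_)
  · simp_rw [inner_influence hI hθ]
    exact (moments_self hθ hmom _).1
  · simp_rw [inner_influence hI hθ]
    exact integral_logF₁ hm hθ hmom _
  · simp_rw [inner_influence hI hθ]
    rw [integral_logF₁_sq hm hθ hmom, ← fisher_quadratic hm hθ hmom,
      ← Matrix.inner_toEuclideanCLM, ← Matrix.inner_toEuclideanCLM,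
      inner_toEuclideanCLM_comm hI.isHermitian.inv, toEuclideanCLM_inv_apply hI]

lemma inner_sum_influence {S : Matrix (ParamIdx K d) (ParamIdx K d) ℝ} (hS : S.PosDef)
    {θ : Param K d} (hθ : θ ∈ paramDomain K d) {n : ℕ} (z : ℕ → ℝ)
    (x : ℕ → EuclideanSpace ℝ (Fin d)) (y : ℕ → Fin (K + 1)) (h : Param K d) :
    inner ℝ ((√n)⁻¹ • ∑ i ∈ Finset.range n, influence S θ (z i) (x i) (y i))
        (Matrix.toEuclideanCLM (𝕜 := ℝ) S h) =
      (√n)⁻¹ * ∑ i ∈ Finset.range n,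
        logF₁ (z i) (x i) (y i) (reparam θ) (fderiv ℝ reparam θ h) := by
  rw [real_inner_smul_left, sum_inner]
  simp_rw [inner_influence hS hθ, toEuclideanCLM_inv_apply hS, fderiv_reparam hθ.2]

/-- The maximum likelihood estimator is asymptotically linear: `√n (θ̂ - θ*)` differs from the
normalized sum of the influence function by a term tending to zero in probability. -/
lemma tendstoInMeasure_mle (hm : HumanModel μ V Y g ζ θs) {Θ : Set (Param K d)}
    (hroot : InteriorUniqueRoot μ V Y g ζ Θ θs) (hmom : MomentsAndInformation μ V Y g ζ θs)
    {Zhat : (n : ℕ) → Ω → Fin n → ℝ}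
    (hZ : ∀ δ > 0, ProbTendstoOne μ fun n ω => ∑ i, (Zhat n ω i - ζ (V i ω)) ^ 2 < δ)
    {θhat : ℕ → Ω → Param K d} (hmle : IsMLE μ V Y g Θ Zhat θhat) :
    TendstoInMeasure μ ((fun (n : ℕ) ω => √n • (θhat n ω - θs)) -
      fun (n : ℕ) ω => (√n)⁻¹ • ∑ i ∈ Finset.range n,
        influence (fisher μ V Y g ζ θs) θs (ζ (V i ω)) (g (V i ω)) (Y i ω)) atTop 0 := by
  have hθ : θs ∈ paramDomain K d := hroot.subset_domain (interior_subset hroot.mem_interior)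
  have hI := hmom.information
  set S := fisher μ V Y g ζ θs with hSdef
  set k₀ : ℕ → Ω → Param K d := fun n ω => (√n)⁻¹ • ∑ i ∈ Finset.range n,
    influence S θs (ζ (V i ω)) (g (V i ω)) (Y i ω) with hk₀
  set ψ := reparam θs with hψ
  set J := fderiv ℝ (reparam : Param K d → Param K d) θs with hJ
  set J' := fderiv ℝ (reparam : Param K d → Param K d) ψ with hJ'
  have hψs : slope ψ ≠ 0 := by rw [hψ, slope_reparam]; exact one_div_ne_zero hθ.2
  have hJJ' (v : Param K d) : J (J' v) = v := by
    have := fderiv_reparam_reparam hψs v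
    rwa [hψ, reparam_reparam hθ.2] at this
  rw [tendstoInMeasure_iff_norm]
  intro ε hε
  rw [ENNReal.tendsto_nhds_zero]
  intro ρ hρ
  obtain ⟨R, hR, htight⟩ := exists_norm_bound_of_tendstoInDistribution
    (tendstoInDistribution_influence hm hθ hmom) (ENNReal.half_pos hρ.ne')
  obtain ⟨l, hl, hlow⟩ := exists_posDef_lower_bound hI
  set δ := ε / 2 with hδ
  have hδ0 : 0 < δ := half_pos hε
  set R' := R + δ with hR'
  have hR'0 : 0 < R' := by positivity
  -- Any value below `l * δ ^ 2 / 4` serves in `norm_sub_lt_of_concaveOn`.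
  set η := l * δ ^ 2 / 5 with hη
  have hη0 : 0 < η := by positivity
  have hexp := probTendstoOne_expansion hm hθ hmom hZ hR'0 hη0
  -- Local parameters in the ball of radius `R'` correspond to parameters in `Θ`.
  have hloc : ∀ᶠ φ in 𝓝 ψ, φ ∈ ordered K d ∧ slope φ ≠ 0 ∧ reparam φ ∈ Θ := by
    have h1 : ContinuousAt (reparam : Param K d → Param K d) ψ :=
      (contDiffAt_reparam hψs).continuousAt
    have h2 : ∀ᶠ φ in 𝓝 ψ, reparam φ ∈ Θ := h1.eventually (by
      rw [hψ, reparam_reparam hθ.2]; exact mem_interior_iff_mem_nhds.1 hroot.mem_interior)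
    filter_upwards [isOpen_ordered.mem_nhds (reparam_mem_ordered hθ), slope_ne_zero_nhds hψs, h2]
      with φ h3 h4 h5 using ⟨h3, h4, h5⟩
  have hdiff : ∀ᶠ φ in 𝓝 ψ, ‖reparam φ - reparam ψ - J' (φ - ψ)‖ ≤
      δ / (‖J‖ * R' + 1) * ‖φ - ψ‖ :=
    (hasFDerivAt_reparam hψs).isLittleO.def (by positivity)
  have hevent : ProbTendstoOne μ fun n ω => ‖k₀ n ω‖ < R →
      ‖√n • (θhat n ω - θs) - k₀ n ω‖ < ε := by
    refine (hexp.and hmle.2).mono_eventually ?_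
    filter_upwards [eventually_forall_norm_le_local hloc J R',
      eventually_forall_norm_le_local hdiff J R', eventually_gt_atTop 0]
      with n hn1 hn2 hn0 ω ⟨hE, hmem, hmax⟩ hkR
    have hn : (0 : ℝ) < n := by positivity
    have hsn : 0 < √n := Real.sqrt_pos.2 hn
    have hdom := hroot.subset_domain hmem
    -- The estimator as a local parameter.
    set k : Param K d := √n • J' (reparam (θhat n ω) - ψ) with hk
    have hJk : J ((√n)⁻¹ • k) = reparam (θhat n ω) - ψ := by
      rw [hk, smul_smul, inv_mul_cancel₀ hsn.ne', one_smul, hJJ']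
    have hψk : ψ + J ((√n)⁻¹ • k) = reparam (θhat n ω) := by rw [hJk]; abel
    have hk₀R' : ‖k₀ n ω‖ ≤ R' := by linarith
    have hge : increment (fun i : Fin n => Y i ω) (Zhat n ω) (fun i : Fin n => g (V i ω)) θs
        (k₀ n ω) ≤ increment (fun i : Fin n => Y i ω) (Zhat n ω)
        (fun i : Fin n => g (V i ω)) θs k := by
      obtain ⟨_, h2, h3⟩ := hn1 _ hk₀R'
      have h4 := isMaxOn_iff.1 hmax _ h3
      rw [sampleLogLik_eq _ _ _ (hroot.subset_domain h3), sampleLogLik_eq _ _ _ hdom,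
        reparam_reparam h2] at h4
      simp only [increment, Finset.sum_sub_distrib, ← hψ, ← hJ, hψk]
      linarith
    have hclose : ‖k - k₀ n ω‖ < δ := by
      refine norm_sub_lt_of_concaveOn (Q := fun v : Param K d => v.ofLp ⬝ᵥ S.mulVec v.ofLp)
        (c := (k₀ n ω).ofLp ⬝ᵥ S.mulVec (k₀ n ω).ofLp / 2) (η := η) (R := R')
        (concaveOn_increment (fun i : Fin n => Y i ω) (Zhat n ω)
        (fun i : Fin n => g (V i ω)) θs) ?_ hδ0 (by linarith) (by simp) hlow ?_ ?_ ?_ hge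
      · intro h hh
        exact (hn1 h (by simpa using hh)).1
      · rw [hη]; nlinarith [mul_pos hl (pow_pos hδ0 2)]
      · intro h hh
        rw [← inner_sub_quadratic hI.isHermitian, hk₀, inner_sum_influence hI hθ
          (fun i => ζ (V i ω)) (fun i => g (V i ω)) (fun i => Y i ω)]
        exact hE h hh
      · change ψ + J ((√n)⁻¹ • k) ∈ ordered K d
        rw [hψk]; exact reparam_mem_ordered hdom
    have hkR' : ‖k‖ ≤ R' := by
      have := norm_add_le (k - k₀ n ω) (k₀ n ω)
      rw [sub_add_cancel] at this
      linarith
    -- Back to the coordinates `θ`, by the differentiability of `reparam` at `ψ`.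
    have hdelta : ‖√n • (θhat n ω - θs) - k‖ ≤ δ := by
      have h1 := hn2 k hkR'
      rw [hψk, reparam_reparam hdom.2, hψ, reparam_reparam hθ.2, ← hψ] at h1
      have h2 : ‖reparam (θhat n ω) - ψ‖ ≤ (√n)⁻¹ * (‖J‖ * R') := by
        rw [← hJk, map_smul, norm_smul, norm_inv, Real.norm_eq_abs, abs_of_pos hsn]
        exact mul_le_mul_of_nonneg_left ((J.le_opNorm k).trans
          (mul_le_mul_of_nonneg_left hkR' (norm_nonneg _))) (inv_nonneg.2 hsn.le)
      have h3 : √n • (θhat n ω - θs) - k =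
          √n • (θhat n ω - θs - J' (reparam (θhat n ω) - ψ)) := by
        rw [hk, ← smul_sub]
      rw [h3, norm_smul, Real.norm_eq_abs, abs_of_pos hsn]
      calc √n * ‖θhat n ω - θs - J' (reparam (θhat n ω) - ψ)‖
          ≤ √n * (δ / (‖J‖ * R' + 1) * ((√n)⁻¹ * (‖J‖ * R'))) := by
            refine mul_le_mul_of_nonneg_left (h1.trans ?_) hsn.le
            exact mul_le_mul_of_nonneg_left h2 (by positivity)
        _ = δ * ((‖J‖ * R') / (‖J‖ * R' + 1)) := by field_simp
        _ ≤ δ * 1 := by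
            refine mul_le_mul_of_nonneg_left ?_ hδ0.le
            rw [div_le_one (by positivity)]
            linarith
        _ = δ := mul_one _
    calc ‖√n • (θhat n ω - θs) - k₀ n ω‖
        = ‖(√n • (θhat n ω - θs) - k) + (k - k₀ n ω)‖ := by rw [sub_add_sub_cancel]
      _ ≤ ‖√n • (θhat n ω - θs) - k‖ + ‖k - k₀ n ω‖ := norm_add_le _ _
      _ < ε := by linarith
  filter_upwards [htight, (ENNReal.tendsto_nhds_zero.1 hevent) _ (ENNReal.half_pos hρ.ne')]
    with n h1 h2
  calc _ ≤ μ ({ω | R ≤ ‖k₀ n ω‖} ∪ {ω | ¬ (‖k₀ n ω‖ < R →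
        ‖√n • (θhat n ω - θs) - k₀ n ω‖ < ε)}) := by
        refine measure_mono fun ω hω => ?_
        simp only [Pi.sub_apply, Pi.zero_apply, sub_zero, Set.mem_ofPred_eq, Set.mem_union,
          Classical.not_imp, not_lt] at hω ⊢
        rcases le_or_gt R ‖k₀ n ω‖ with h | h
        · exact Or.inl h
        · exact Or.inr ⟨h, hω⟩
    _ ≤ ρ / 2 + ρ / 2 := (measure_union_le _ _).trans (add_le_add h1 h2)
    _ = ρ := ENNReal.add_halves ρ

/-- The projection `θ ↦ (β, γ)` as a continuous linear map. -/
def betaGammaL (K d : ℕ) : Param K d →L[ℝ] EuclideanSpace ℝ (Unit ⊕ Fin d) :=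
  LinearMap.toContinuousLinearMap
    { toFun := betaGamma
      map_add' := fun _ _ => rfl
      map_smul' := fun _ _ => rfl }

omit [IsProbabilityMeasure μ] in
lemma map_betaGamma_multivariateGaussian {S : Matrix (ParamIdx K d) (ParamIdx K d) ℝ}
    (hS : S.PosSemidef) :
    (multivariateGaussian (0 : Param K d) S).map (betaGammaL K d) =
      multivariateGaussian 0 (S.submatrix Sum.inr Sum.inr) := by
  refine Measure.ext_of_charFun ?_
  ext t
  have hadj (x : Param K d) : inner ℝ (betaGammaL K d x) t =
      inner ℝ x (WithLp.toLp 2 (Sum.elim (fun _ => 0) t.ofLp) : Param K d) := by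
    simp [PiLp.inner_apply, betaGammaL]
    rfl
  rw [charFun_multivariateGaussian (hS.submatrix _), charFun_apply,
    integral_map (betaGammaL K d).continuous.measurable.aemeasurable
      (by fun_prop)]
  simp_rw [hadj]
  rw [← charFun_apply, charFun_multivariateGaussian hS]
  simp [dotProduct, Matrix.mulVec]

/-- Asymptotic normality of the maximum likelihood estimator computed with approximate latent
scores, provided the total squared error of the scores tends to zero in probability. -/
theorem asympNormal_of_isMLE (hm : HumanModel μ V Y g ζ θs) {Θ : Set (Param K d)}
    (hroot : InteriorUniqueRoot μ V Y g ζ Θ θs) (hmom : MomentsAndInformation μ V Y g ζ θs)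
    {Zhat : (n : ℕ) → Ω → Fin n → ℝ}
    (hZ : ∀ δ > 0, ProbTendstoOne μ fun n ω => ∑ i, (Zhat n ω i - ζ (V i ω)) ^ 2 < δ)
    {θhat : ℕ → Ω → Param K d} (hmle : IsMLE μ V Y g Θ Zhat θhat) :
    AsympNormal μ (fisher μ V Y g ζ θs) θs θhat := by
  have hθ : θs ∈ paramDomain K d := hroot.subset_domain (interior_subset hroot.mem_interior)
  have h1 : TendstoInDistribution (fun (n : ℕ) ω => √n • (θhat n ω - θs)) atTop id (fun _ => μ)
      (multivariateGaussian 0 (fisher μ V Y g ζ θs)⁻¹) :=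
    tendstoInDistribution_of_tendstoInMeasure_sub _ _
      (tendstoInDistribution_influence hm hθ hmom) (tendstoInMeasure_mle hm hroot hmom hZ hmle)
      fun n => ((hmle.1 n).sub_const θs).const_smul (√n)
  refine ⟨h1, ?_⟩
  have h2 := h1.continuous_comp (betaGammaL K d).continuous
  refine ⟨fun n => ?_, aemeasurable_id, ?_⟩
  · exact h2.forall_aemeasurable n
  · have h3 := h2.tendsto
    convert! h3 using 2
    refine congrArg 𝓝 (Subtype.ext ?_)
    simp only [Measure.map_id, Function.comp_id]
    exact (map_betaGamma_multivariateGaussian hmom.information.inv.posSemidef).symm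

end Human

end

/-! ### Recovering the scores from label frequencies -/

section

variable {K n : ℕ}

/-- The logistic function expands distances on `[-M, M]` at least by `exp (-M) / 4`. -/
lemma abs_sub_le_mul_sigmoid {M s t : ℝ} (hs : |s| ≤ M) (ht : |t| ≤ M) :
    |s - t| ≤ 4 * Real.exp M * |Real.sigmoid s - Real.sigmoid t| := by
  wlog h : t < s generalizing s t
  · rcases (not_lt.1 h).eq_or_lt with rfl | h'
    · simp
    · rw [abs_sub_comm, abs_sub_comm (Real.sigmoid s)]
      exact this ht hs h'
  obtain ⟨x, hx, hslope⟩ := exists_hasDerivAt_eq_slope Real.sigmoid sigVar h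
    (fun x _ => (hasDerivAt_sigmoid' x).continuousAt.continuousWithinAt) fun x _ => hasDerivAt_sigmoid' x
  have hxM : |x| ≤ M := by
    rw [abs_le] at hs ht ⊢
    exact ⟨ht.1.trans hx.1.le, hx.2.le.trans hs.2⟩
  have h1 : 1 / 4 ≤ Real.exp M * sigVar x := by
    have h2 := sigVar_le_exp_mul 0 x
    have h3 : sigVar 0 = 1 / 4 := by
      rw [sigVar, neg_zero, Real.sigmoid_def]; norm_num
    rw [h3, zero_sub, abs_neg] at h2
    exact h2.trans (mul_le_mul_of_nonneg_right (Real.exp_le_exp.2 hxM) (sigVar_pos x).le)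
  rw [eq_div_iff (sub_pos.2 h).ne'] at hslope
  rw [← hslope, abs_of_pos (sub_pos.2 h),
    abs_of_pos (mul_pos (sigVar_pos x) (sub_pos.2 h))]
  nlinarith [sub_pos.2 h]

/-- The distance of two cutoffs, measured in probability, changes at most by the factor
`exp |s - t|` when the latent score moves from `t` to `s`. -/
lemma abs_sigmoid_shift_le (a b s t : ℝ) :
    |Real.sigmoid (a - s) - Real.sigmoid (b - s)| ≤
      Real.exp |s - t| * |Real.sigmoid (a - t) - Real.sigmoid (b - t)| := by
  wlog h : b ≤ a generalizing a b
  · rw [abs_sub_comm, abs_sub_comm (Real.sigmoid (a - t))]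
    exact this b a (not_le.1 h).le
  have hd (x : ℝ) : HasDerivAt
      (fun x => Real.exp |s - t| * Real.sigmoid (x - t) - Real.sigmoid (x - s))
      (Real.exp |s - t| * sigVar (x - t) - sigVar (x - s)) x :=
    (((hasDerivAt_sigmoid' (x - t)).comp_sub_const x t).const_mul _).sub
      ((hasDerivAt_sigmoid' (x - s)).comp_sub_const x s)
  have hmono : Monotone
      (fun x => Real.exp |s - t| * Real.sigmoid (x - t) - Real.sigmoid (x - s)) := by
    refine monotone_of_deriv_nonneg (fun x => (hd x).differentiableAt) fun x => ?_
    rw [(hd x).deriv, sub_nonneg]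
    have := sigVar_le_exp_mul (x - s) (x - t)
    rwa [show x - s - (x - t) = -(s - t) by ring, abs_neg] at this
  have h1 := hmono h
  have h2 := Real.sigmoid_monotone (sub_le_sub_right h s)
  have h3 := Real.sigmoid_monotone (sub_le_sub_right h t)
  rw [abs_of_nonneg (sub_nonneg.2 h2), abs_of_nonneg (sub_nonneg.2 h3), mul_sub]
  simp only at h1
  linarith

lemma cumProb_succ (η : Fin K → ℝ) (z : ℝ) (j : Fin K) :
    cumProb η z (j.val + 1) = Real.sigmoid (η j - z) := by
  simp [cumProb]

lemma ordProb_zero (hK : 0 < K) {η : Fin K → ℝ} (hη : Normalized η) (z : ℝ) :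
    ordProb η z 0 = Real.sigmoid (-z) := by
  have h : η ⟨0, hK⟩ = 0 := hη _ rfl
  simp [ordProb, cumProb, hK, h]

/-- The total variation of the label laws bounds the differences of the cumulative probabilities. -/
lemma abs_cumProb_sub_le (η η' : Fin K → ℝ) (z z' : ℝ) {j : ℕ} (hj : j ≤ K + 1) :
    |cumProb η z j - cumProb η' z' j| ≤ ∑ k, |ordProb η z k - ordProb η' z' k| := by
  have hsum (η : Fin K → ℝ) (z : ℝ) : cumProb η z j =
      ∑ k ∈ Finset.range j, (cumProb η z (k + 1) - cumProb η z k) := by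
    rw [Finset.sum_range_sub]; simp [cumProb]
  rw [hsum η z, hsum η' z', ← Finset.sum_sub_distrib]
  refine (Finset.abs_sum_le_sum_abs _ _).trans ?_
  simp only [ordProb]
  rw [Fin.sum_univ_eq_sum_range (fun k => |cumProb η z (k + 1) - cumProb η z k -
    (cumProb η' z' (k + 1) - cumProb η' z' k)|)]
  exact Finset.sum_le_sum_of_subset_of_nonneg (Finset.range_subset_range.2 hj)
    fun _ _ _ => abs_nonneg _

lemma sum_abs_ordProb_sub_le {η η' : Fin K → ℝ} {z B : ℝ} (hB : 0 ≤ B)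
    (h : ∀ j, |Real.sigmoid (η j - z) - Real.sigmoid (η' j - z)| ≤ B) :
    ∑ k, |ordProb η z k - ordProb η' z k| ≤ 2 * (K + 1) * B := by
  have hc : ∀ j, |cumProb η z j - cumProb η' z j| ≤ B := by
    rintro (_ | j)
    · simpa [cumProb] using hB
    · by_cases hj : j < K
      · simpa [cumProb, hj] using h ⟨j, hj⟩
      · simpa [cumProb, hj] using hB
  have hk (k : Fin (K + 1)) : |ordProb η z k - ordProb η' z k| ≤ 2 * B := by
    rw [ordProb, ordProb, sub_sub_sub_comm]
    refine (abs_sub _ _).trans ?_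
    linarith [hc (k.val + 1), hc k.val]
  refine (Finset.sum_le_sum fun k _ => hk k).trans ?_
  simp
  linarith

/-- The loss of a single pair. -/
def pairLoss (η : Fin K → ℝ) (z : ℝ) (q : Fin (K + 1) → ℝ) : ℝ := ∑ k, |ordProb η z k - q k|

lemma stageLoss_eq (q : Fin n → Fin (K + 1) → ℝ) (v : Fin K ⊕ Fin n → ℝ) :
    stageLoss q v = ∑ i, pairLoss (stageEta v) (stageZ v i) (q i) := rfl

lemma pairLoss_nonneg (η : Fin K → ℝ) (z : ℝ) (q : Fin (K + 1) → ℝ) : 0 ≤ pairLoss η z q :=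
  Finset.sum_nonneg fun _ _ => abs_nonneg _

lemma pairLoss_le_add (η : Fin K → ℝ) (z : ℝ) (q q' : Fin (K + 1) → ℝ) :
    pairLoss η z q ≤ pairLoss η z q' + ∑ k, |q' k - q k| := by
  rw [pairLoss, pairLoss, ← Finset.sum_add_distrib]
  exact Finset.sum_le_sum fun k _ => abs_sub_le _ _ _

/-- A minimizer of the stage-one loss also minimizes the loss of each pair in its own score. -/
lemma IsStageArgmin.pairLoss_le {S : Set ℝ} {q : Fin n → Fin (K + 1) → ℝ}
    {v : Fin K ⊕ Fin n → ℝ} (h : IsStageArgmin S q v) (i : Fin n) {z : ℝ} (hz : z ∈ S) :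
    pairLoss (stageEta v) (stageZ v i) (q i) ≤ pairLoss (stageEta v) z (q i) := by
  set w : Fin K ⊕ Fin n → ℝ := Sum.elim (stageEta v) (Function.update (stageZ v) i z) with hw
  have hwη : stageEta w = stageEta v := rfl
  have hwz : stageZ w = Function.update (stageZ v) i z := rfl
  have hmem : w ∈ stageSet K n S := by
    refine ⟨h.1.1, h.1.2.1, fun j => ?_⟩
    rw [hwz]
    rcases eq_or_ne j i with rfl | hj
    · simpa using hz
    · simpa [hj] using h.1.2.2 j
  have h1 := isMinOn_iff.1 h.2 w hmem
  rw [stageLoss_eq, stageLoss_eq, hwη, hwz, ← Finset.add_sum_erase _ _ (Finset.mem_univ i),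
    ← Finset.add_sum_erase _ _ (Finset.mem_univ i), Function.update_self] at h1
  have h2 : ∑ j ∈ Finset.univ.erase i,
      pairLoss (stageEta v) (Function.update (stageZ v) i z j) (q j) =
      ∑ j ∈ Finset.univ.erase i, pairLoss (stageEta v) (stageZ v j) (q j) :=
    Finset.sum_congr rfl fun j hj => by rw [Function.update_of_ne (Finset.ne_of_mem_erase hj)]
  rw [h2] at h1
  linarith

/-- A minimizer of the exact loss recovers the scores: the minimal loss is `0`, and the probability
of the label `0` alone determines the score, because `η₁ = 0`. -/
lemma IsStageArgmin.stageZ_eq (hK : 0 < K) {S : Set ℝ} {q : Fin n → Fin (K + 1) → ℝ}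
    {v vs : Fin K ⊕ Fin n → ℝ} (h : IsStageArgmin S q v) (hvs : vs ∈ stageSet K n S)
    (hq : ∀ i k, q i k = ordProb (stageEta vs) (stageZ vs i) k) : stageZ v = stageZ vs := by
  have h1 := isMinOn_iff.1 h.2 vs hvs
  have h2 : stageLoss q vs = 0 := by simp [stageLoss, hq]
  rw [h2] at h1
  ext i
  have h3 : pairLoss (stageEta v) (stageZ v i) (q i) ≤ 0 :=
    (Finset.single_le_sum (fun j _ => pairLoss_nonneg _ _ _) (Finset.mem_univ i)).trans h1
  have h4 : |ordProb (stageEta v) (stageZ v i) 0 - q i 0| ≤ 0 :=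
    (Finset.single_le_sum (f := fun k => |ordProb (stageEta v) (stageZ v i) k - q i k|)
      (fun k _ => abs_nonneg _) (Finset.mem_univ 0)).trans h3
  rw [abs_nonpos_iff, hq, ordProb_zero hK h.1.1, ordProb_zero hK hvs.1, sub_eq_zero] at h4
  exact neg_injective (Real.sigmoid_injective h4)

/-- The estimated scores on `[-M, M]` are Lipschitz in the label frequencies: the squared error of
all scores is bounded by the squared error of all frequencies.

The total loss of the minimizer is of the order of the total error of the frequencies. Hence some
pair has a loss of the order of the average error, and this pair fixes the cutoffs, up to the
average error. Each score minimizes the loss of its pair, so that its error is of the order of the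
error of its own frequencies plus the average error. -/
lemma exists_stage_bound (hK : 0 < K) (M : ℝ) :
    ∃ C, 0 < C ∧ ∀ (n : ℕ) (q : Fin n → Fin (K + 1) → ℝ) (v vs : Fin K ⊕ Fin n → ℝ),
      vs ∈ stageSet K n (Set.Icc (-M) M) → IsStageArgmin (Set.Icc (-M) M) q v →
      ∑ i, (stageZ v i - stageZ vs i) ^ 2 ≤
        C * ∑ i, ∑ k, (q i k - ordProb (stageEta vs) (stageZ vs i) k) ^ 2 := by
  set a := 4 * Real.exp M with ha
  have ha0 : 0 < a := by positivity
  set b := 2 * (K + 1) * (Real.exp (2 * M) * ((1 + a) * 2)) with hb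
  have hb0 : 0 < b := by positivity
  set c := a * (2 + b) with hc
  have hc0 : 0 < c := by positivity
  refine ⟨4 * c ^ 2 * (K + 1), by positivity, fun n q v vs hvs hv => ?_⟩
  rcases Nat.eq_zero_or_pos n with rfl | hn
  · simp
  have : Nonempty (Fin n) := ⟨⟨0, hn⟩⟩
  have hnR : (0 : ℝ) < n := by exact_mod_cast hn
  set p : Fin n → Fin (K + 1) → ℝ := fun i k => ordProb (stageEta vs) (stageZ vs i) k with hp
  set ε : Fin n → ℝ := fun i => ∑ k, |q i k - p i k| with hε
  have hε0 (i) : 0 ≤ ε i := Finset.sum_nonneg fun _ _ => abs_nonneg _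
  set e := (∑ i, ε i) / n with he
  have he0 : 0 ≤ e := div_nonneg (Finset.sum_nonneg fun i _ => hε0 i) hnR.le
  have hne : (n : ℝ) * e = ∑ i, ε i := by rw [he]; field_simp
  set r : Fin n → ℝ := fun i => pairLoss (stageEta v) (stageZ v i) (p i) with hr
  have habs {z : ℝ} (h : z ∈ Set.Icc (-M) M) : |z| ≤ M := abs_le.2 h
  -- The first label probability determines the score, because `η₁ = 0`.
  have hscore (i) : |stageZ v i - stageZ vs i| ≤ a * r i := by
    have h1 := abs_sub_le_mul_sigmoid (M := M) (s := -stageZ v i) (t := -stageZ vs i)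
      (by rw [abs_neg]; exact habs (hv.1.2.2 i)) (by rw [abs_neg]; exact habs (hvs.2.2 i))
    have h2 : |ordProb (stageEta v) (stageZ v i) 0 - p i 0| ≤ r i :=
      Finset.single_le_sum (f := fun k => |ordProb (stageEta v) (stageZ v i) k - p i k|)
        (fun k _ => abs_nonneg _) (Finset.mem_univ 0)
    rw [hp] at h2
    simp only at h2
    rw [ordProb_zero hK hv.1.1, ordProb_zero hK hvs.1] at h2
    rw [neg_sub_neg, abs_sub_comm] at h1
    exact h1.trans (mul_le_mul_of_nonneg_left h2 ha0.le)
  have hrsum : ∑ i, r i ≤ ∑ _i : Fin n, 2 * e := by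
    have h1 := isMinOn_iff.1 hv.2 vs hvs
    have h2 : stageLoss q vs = ∑ i, ε i := by
      refine Finset.sum_congr rfl fun i _ => Finset.sum_congr rfl fun k _ => ?_
      rw [abs_sub_comm]
    rw [h2, stageLoss_eq] at h1
    have h3 : ∑ i, r i ≤ ∑ i, (pairLoss (stageEta v) (stageZ v i) (q i) + ε i) :=
      Finset.sum_le_sum fun i _ => pairLoss_le_add _ _ _ _
    rw [Finset.sum_add_distrib] at h3
    simp only [Finset.sum_const, Finset.card_univ, Fintype.card_fin, nsmul_eq_mul]
    linarith
  obtain ⟨i₀, -, hi₀⟩ := Finset.exists_le_of_sum_le Finset.univ_nonempty hrsum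
  have hcut (j : Fin K) : |Real.sigmoid (stageEta v j - stageZ vs i₀) -
      Real.sigmoid (stageEta vs j - stageZ vs i₀)| ≤ (1 + a) * 2 * e := by
    have h1 := abs_cumProb_sub_le (stageEta v) (stageEta vs) (stageZ v i₀) (stageZ vs i₀)
      (j := j.val + 1) (by omega)
    rw [cumProb_succ, cumProb_succ] at h1
    have h2 := abs_sigmoid_sub_le (stageEta v j - stageZ vs i₀) (stageEta v j - stageZ v i₀)
    rw [sub_sub_sub_cancel_left] at h2
    have h3 := hscore i₀
    have h4 := abs_sub_le (Real.sigmoid (stageEta v j - stageZ vs i₀))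
      (Real.sigmoid (stageEta v j - stageZ v i₀)) (Real.sigmoid (stageEta vs j - stageZ vs i₀))
    have h5 : a * r i₀ ≤ a * (2 * e) := mul_le_mul_of_nonneg_left hi₀ ha0.le
    have h6 : |Real.sigmoid (stageEta v j - stageZ v i₀) -
      Real.sigmoid (stageEta vs j - stageZ vs i₀)| ≤ r i₀ := h1
    linarith
  have hcut' (i : Fin n) : pairLoss (stageEta v) (stageZ vs i) (p i) ≤ b * e := by
    have h1 : ∀ j, |Real.sigmoid (stageEta v j - stageZ vs i) -
        Real.sigmoid (stageEta vs j - stageZ vs i)| ≤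
          Real.exp (2 * M) * ((1 + a) * 2 * e) := by
      intro j
      refine (abs_sigmoid_shift_le _ _ _ (stageZ vs i₀)).trans ?_
      refine mul_le_mul (Real.exp_le_exp.2 ?_) (hcut j) (abs_nonneg _) (Real.exp_pos _).le
      refine (abs_sub _ _).trans ?_
      linarith [habs (hvs.2.2 i), habs (hvs.2.2 i₀)]
    refine (sum_abs_ordProb_sub_le (by positivity) h1).trans_eq ?_
    rw [hb]; ring
  have hri (i) : r i ≤ 2 * ε i + b * e := by
    have h1 := pairLoss_le_add (stageEta v) (stageZ v i) (p i) (q i)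
    have h2 := hv.pairLoss_le i (hvs.2.2 i)
    have h3 := pairLoss_le_add (stageEta v) (stageZ vs i) (q i) (p i)
    have h4 : ∑ k, |p i k - q i k| = ε i := Finset.sum_congr rfl fun k _ => abs_sub_comm _ _
    have h5 := hcut' i
    rw [h4] at h3
    change r i ≤ _ + ε i at h1
    linarith
  have hsq (i) : (stageZ v i - stageZ vs i) ^ 2 ≤ 2 * c ^ 2 * (ε i ^ 2 + e ^ 2) := by
    have h1 : |stageZ v i - stageZ vs i| ≤ c * (ε i + e) := by
      refine (hscore i).trans ((mul_le_mul_of_nonneg_left (hri i) ha0.le).trans ?_)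
      rw [hc, mul_assoc a]
      refine mul_le_mul_of_nonneg_left ?_ ha0.le
      nlinarith [mul_nonneg hb0.le (hε0 i)]
    rw [← sq_abs]
    calc |stageZ v i - stageZ vs i| ^ 2 ≤ (c * (ε i + e)) ^ 2 :=
          pow_le_pow_left₀ (abs_nonneg _) h1 2
      _ = c ^ 2 * (ε i + e) ^ 2 := mul_pow _ _ _
      _ ≤ c ^ 2 * (2 * (ε i ^ 2 + e ^ 2)) :=
          mul_le_mul_of_nonneg_left add_sq_le (sq_nonneg c)
      _ = _ := by ring
  have he2 : n * e ^ 2 ≤ ∑ i, ε i ^ 2 := by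
    have h1 := sq_sum_le_card_mul_sum_sq (s := Finset.univ) (f := ε)
    rw [← hne, Finset.card_univ, Fintype.card_fin, mul_pow, sq (n : ℝ), mul_assoc] at h1
    exact le_of_mul_le_mul_left h1 hnR
  have hε2 (i) : ε i ^ 2 ≤ (K + 1) * ∑ k, (q i k - p i k) ^ 2 := by
    have h1 := sq_sum_le_card_mul_sum_sq (s := Finset.univ) (f := fun k => |q i k - p i k|)
    simpa using h1
  calc ∑ i, (stageZ v i - stageZ vs i) ^ 2 ≤ ∑ i, 2 * c ^ 2 * (ε i ^ 2 + e ^ 2) :=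
        Finset.sum_le_sum fun i _ => hsq i
    _ = 2 * c ^ 2 * (∑ i, ε i ^ 2 + n * e ^ 2) := by
        rw [← Finset.mul_sum, Finset.sum_add_distrib]; simp
    _ ≤ 2 * c ^ 2 * (∑ i, ε i ^ 2 + ∑ i, ε i ^ 2) := by
        refine mul_le_mul_of_nonneg_left ?_ (by positivity)
        linarith
    _ = 4 * c ^ 2 * ∑ i, ε i ^ 2 := by ring
    _ ≤ 4 * c ^ 2 * ∑ i, ((K + 1) * ∑ k, (q i k - p i k) ^ 2) :=
        mul_le_mul_of_nonneg_left (Finset.sum_le_sum fun i _ => hε2 i) (by positivity)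
    _ = _ := by rw [← Finset.mul_sum]; ring

end

/-! ### Errors of the empirical frequencies -/

section

section LLM

variable {Ω 𝓥 : Type*} [MeasurableSpace Ω] [MeasurableSpace 𝓥] {μ : Measure Ω}
  {V : ℕ → Ω → 𝓥} {K : ℕ} {κ : Kernel 𝓥 (Fin (K + 1))} {n m : ℕ} {L : ℕ → ℕ → Ω → Fin (K + 1)}

lemma measurable_kernel_real (κ : Kernel 𝓥 (Fin (K + 1))) (k : Fin (K + 1)) :
    Measurable fun w => (κ w).real {k} :=
  (κ.measurable_coe (measurableSet_singleton k)).ennreal_toReal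

/-- Expectations of functions of the sampled labels and the pairs, by conditioning on the pairs. -/
lemma IsCoTSample.integral_eq [IsFiniteMeasure μ] (hL : IsCoTSample μ V κ n m L)
    (hV : ∀ i, Measurable (V i))
    {f : (Fin n → Fin m → Fin (K + 1)) → (Fin n → 𝓥) → ℝ} (hf : ∀ y, Measurable (f y)) {C : ℝ}
    (hC : ∀ y v, |f y v| ≤ C) :
    ∫ ω, f (fun i j => L i j ω) (fun i => V i ω) ∂μ =
      ∫ ω, ∑ y : Fin n → Fin m → Fin (K + 1),
        (∏ i : Fin n, ∏ j : Fin m, (κ (V i ω)).real {y i j}) * f y (fun i => V i ω) ∂μ := by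
  have hW : Measurable fun ω (i : Fin n) => V i ω := measurable_pi_lambda _ fun i => hV i
  have hle := hW.comap_le
  set E : (Fin n → Fin m → Fin (K + 1)) → Set Ω :=
    fun y => {ω | ∀ (i : Fin n) (j : Fin m), L i j ω = y i j} with hE
  have hEm (y) : MeasurableSet (E y) := by
    simp only [hE, Set.ofPred_forall]
    exact MeasurableSet.iInter fun i => MeasurableSet.iInter fun j =>
      hL.meas i j (measurableSet_singleton _)
  set ind : (Fin n → Fin m → Fin (K + 1)) → Ω → ℝ :=
    fun y => (E y).indicator (fun _ => (1 : ℝ)) with hind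
  have hind_int (y) : Integrable (ind y) μ := (integrable_const (1 : ℝ)).indicator (hEm y)
  have hfW (y) : Measurable fun ω => f y (fun i => V i ω) := (hf y).comp hW
  have hf_int (y) : Integrable (fun ω => f y (fun i => V i ω)) μ :=
    (integrable_const C).mono' (hfW y).aestronglyMeasurable (ae_of_all _ fun ω => hC y _)
  have hprod (y) : ind y * (fun ω => f y (fun i => V i ω)) =
      (E y).indicator (fun ω => f y (fun i => V i ω)) := by
    ext ω
    by_cases h : ω ∈ E y <;> simp [hind, h]
  have hprod_int (y) : Integrable (ind y * (fun ω => f y (fun i => V i ω))) μ := by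
    rw [hprod]; exact (hf_int y).indicator (hEm y)
  have hfm (y) : StronglyMeasurable[MeasurableSpace.comap (fun ω (i : Fin n) => V i ω)
      inferInstance] (fun ω => f y (fun i => V i ω)) :=
    ((hf y).comp (comap_measurable (fun ω (i : Fin n) => V i ω))).stronglyMeasurable
  have hce (y) : μ[ind y * (fun ω => f y (fun i => V i ω)) |
      MeasurableSpace.comap (fun ω (i : Fin n) => V i ω) inferInstance] =ᵐ[μ]
      fun ω => (∏ i : Fin n, ∏ j : Fin m, (κ (V i ω)).real {y i j}) * f y (fun i => V i ω) := by
    refine (condExp_mul_of_stronglyMeasurable_right (hfm y) (hprod_int y) (hind_int y)).trans ?_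
    filter_upwards [hL.cond_law y] with ω hω
    rw [Pi.mul_apply, hω]
  have hce_int (y) := (integrable_condExp
    (m := MeasurableSpace.comap (fun ω (i : Fin n) => V i ω) inferInstance)
    (f := ind y * (fun ω => f y (fun i => V i ω))) (μ := μ)).congr (hce y)
  calc ∫ ω, f (fun i j => L i j ω) (fun i => V i ω) ∂μ
      = ∫ ω, ∑ y, (ind y * (fun ω => f y (fun i => V i ω))) ω ∂μ := by
        congr 1
        ext ω
        rw [Finset.sum_eq_single (fun (i : Fin n) (j : Fin m) => L i j ω)]
        · simp [hind, hE]
        · intro y _ hy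
          have : ω ∉ E y := fun h => hy (by ext i j; rw [h i j])
          simp [hind, this]
        · simp
    _ = ∑ y, ∫ ω, (ind y * (fun ω => f y (fun i => V i ω))) ω ∂μ :=
        integral_finsetSum _ fun y _ => hprod_int y
    _ = ∑ y, ∫ ω, (∏ i : Fin n, ∏ j : Fin m, (κ (V i ω)).real {y i j}) *
          f y (fun i => V i ω) ∂μ := by
        refine Finset.sum_congr rfl fun y _ => ?_
        rw [← integral_condExp hle]
        exact integral_congr_ae (hce y)
    _ = _ := (integral_finsetSum _ fun y _ => hce_int y).symm

/-- The variance of an empirical frequency of `m` independent labels is at most `1 / m`. -/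
lemma sum_prod_mul_sq_le (P : Fin n → Measure (Fin (K + 1))) [∀ i, IsProbabilityMeasure (P i)]
    (i : Fin n) (k : Fin (K + 1)) (hm : 0 < m) :
    ∑ y : Fin n → Fin m → Fin (K + 1), (∏ i, ∏ j, (P i).real {y i j}) *
      ((∑ j, if y i j = k then (1 : ℝ) else 0) / m - (P i).real {k}) ^ 2 ≤ 1 / m := by
  have hmR : (0 : ℝ) < m := by exact_mod_cast hm
  set u : Fin (K + 1) → ℝ := fun l => if l = k then 1 else 0 with hu
  have hum : Measurable u := measurable_of_finite u
  have hub (l) : u l ∈ Set.Icc (0 : ℝ) 1 := by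
    simp only [hu]; split_ifs <;> simp
  have hu2 : MemLp u 2 (P i) :=
    memLp_of_bounded (ae_of_all _ hub) hum.aestronglyMeasurable 2
  have humean : ∫ l, u l ∂(P i) = (P i).real {k} := by
    have : u = Set.indicator {k} (fun _ => (1 : ℝ)) := by
      ext l; simp [hu, Set.indicator_apply]
    rw [this, integral_indicator_const _ (measurableSet_singleton k)]
    simp
  set ρ : Measure (Fin m → Fin (K + 1)) := Measure.pi fun _ => P i with hρ
  set F : (Fin m → Fin (K + 1)) → ℝ := fun y => ((∑ j, u (y j)) / m - (P i).real {k}) ^ 2 with hF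
  -- The sum over the arrays of labels is an integral over a product measure, of which only row `i`
  -- matters.
  have h1 : ∑ y : Fin n → Fin m → Fin (K + 1), (∏ i, ∏ j, (P i).real {y i j}) * F (y i) =
      ∫ y, F (y i) ∂Measure.pi fun i => Measure.pi fun _ : Fin m => P i := by
    rw [integral_fintype (Integrable.of_finite)]
    refine Finset.sum_congr rfl fun y _ => ?_
    rw [smul_eq_mul]
    congr 1
    simp [Measure.real, Measure.pi_singleton, ENNReal.toReal_prod]
  have h2 : ∫ y, F (y i) ∂(Measure.pi fun i => Measure.pi fun _ : Fin m => P i) =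
      ∫ w, F w ∂ρ :=
    integral_comp_eval (μ := fun i => Measure.pi fun _ : Fin m => P i) (i := i)
      (measurable_of_finite F).aestronglyMeasurable
  have h3 : ∫ y, (∑ j, u (y j)) ∂ρ = m * (P i).real {k} := by
    rw [integral_finsetSum _ fun j _ => Integrable.of_finite]
    have (j : Fin m) : ∫ y, u (y j) ∂ρ = (P i).real {k} := by
      rw [← humean]
      exact integral_comp_eval (μ := fun _ : Fin m => P i) (i := j) hum.aestronglyMeasurable
    simp [this]
  have h4 : Var[∑ j : Fin m, fun y : Fin m → Fin (K + 1) => u (y j); ρ] ≤ m := by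
    rw [hρ, variance_sum_pi (μ := fun _ : Fin m => P i) (X := fun _ => u) fun _ => hu2]
    have h5 := variance_le_sq_of_bounded (ae_of_all (P i) hub) hum.aemeasurable
    simp only [Finset.sum_const, Finset.card_univ, Fintype.card_fin, nsmul_eq_mul]
    nlinarith
  rw [variance_eq_integral (measurable_of_finite _).aemeasurable] at h4
  simp only [Finset.sum_apply] at h4
  rw [h3] at h4
  have h5 (y : Fin m → Fin (K + 1)) :
      F y = (1 / m ^ 2) * (∑ j, u (y j) - m * (P i).real {k}) ^ 2 := by
    simp only [hF]; field_simp
  change ∑ y : Fin n → Fin m → Fin (K + 1), (∏ i, ∏ j, (P i).real {y i j}) * F (y i) ≤ _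
  rw [h1, h2]
  simp_rw [h5]
  rw [integral_const_mul]
  calc _ ≤ 1 / (m : ℝ) ^ 2 * m := mul_le_mul_of_nonneg_left h4 (by positivity)
    _ = 1 / m := by field_simp

omit [MeasurableSpace Ω] in
lemma empProb_mem_Icc (L : ℕ → ℕ → Ω → Fin (K + 1)) (n m : ℕ) (ω : Ω) (i : Fin n)
    (k : Fin (K + 1)) : empProb L n m ω i k ∈ Set.Icc (0 : ℝ) 1 := by
  have h0 : ∀ j : Fin m, (0 : ℝ) ≤ if L i j ω = k then 1 else 0 := fun j => by split_ifs <;> simp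
  have h1 : (∑ j : Fin m, if L i j ω = k then (1 : ℝ) else 0) ≤ m := by
    refine (Finset.sum_le_sum (g := fun _ => (1 : ℝ)) fun j _ => ?_).trans (by simp)
    split_ifs <;> simp
  exact ⟨div_nonneg (Finset.sum_nonneg fun j _ => h0 j) (Nat.cast_nonneg m),
    div_le_one_of_le₀ h1 (Nat.cast_nonneg m)⟩

lemma IsCoTSample.measurable_empProb (hL : IsCoTSample μ V κ n m L) (i : Fin n)
    (k : Fin (K + 1)) : Measurable fun ω => empProb L n m ω i k := by
  refine (Finset.measurable_sum _ fun j _ => ?_).div_const _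
  exact Measurable.ite (hL.meas i j (measurableSet_singleton k)) measurable_const measurable_const

variable [IsMarkovKernel κ]

/-- The mean squared error of an empirical frequency is at most `1 / m`. -/
lemma IsCoTSample.integral_sq_le [IsProbabilityMeasure μ] (hL : IsCoTSample μ V κ n m L)
    (hV : ∀ i, Measurable (V i)) (hm : 0 < m) (i : Fin n) (k : Fin (K + 1)) :
    ∫ ω, (empProb L n m ω i k - llmProb κ V n ω i k) ^ 2 ∂μ ≤ 1 / m := by
  set f : (Fin n → Fin m → Fin (K + 1)) → (Fin n → 𝓥) → ℝ := fun y v =>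
    ((∑ j, if y i j = k then (1 : ℝ) else 0) / m - (κ (v i)).real {k}) ^ 2 with hf
  have hfm (y) : Measurable (f y) :=
    (((measurable_kernel_real κ k).comp (measurable_pi_apply i)).const_sub _).pow_const 2
  have hfb (y v) : |f y v| ≤ 1 := by
    -- The array `y` as a deterministic sample.
    have h1 := empProb_mem_Icc (Ω := Unit)
      (fun i' j' _ => if h : i' < n ∧ j' < m then y ⟨i', h.1⟩ ⟨j', h.2⟩ else 0) n m () i k
    simp only [empProb, Fin.is_lt, and_self, dite_true, Fin.eta] at h1
    have h2 : (κ (v i)).real {k} ≤ 1 := measureReal_le_one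
    have h3 : 0 ≤ (κ (v i)).real {k} := measureReal_nonneg
    rw [hf, abs_of_nonneg (sq_nonneg _), sq_le_one_iff_abs_le_one, abs_le]
    constructor <;> linarith [h1.1, h1.2]
  have h1 := hL.integral_eq hV hfm hfb
  change ∫ ω, f (fun i j => L i j ω) (fun i => V i ω) ∂μ ≤ _
  rw [h1]
  have h2 (ω : Ω) := sum_prod_mul_sq_le (fun i : Fin n => κ (V i ω)) i k hm
  calc _ ≤ ∫ _, (1 / m : ℝ) ∂μ := by
        refine integral_mono_of_nonneg (ae_of_all _ fun ω => ?_) (integrable_const _)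
          (ae_of_all _ h2)
        exact Finset.sum_nonneg fun y _ => mul_nonneg (Finset.prod_nonneg fun i _ =>
          Finset.prod_nonneg fun j _ => measureReal_nonneg) (sq_nonneg _)
    _ = 1 / m := by simp

lemma IsCoTSample.integrable_sq [IsProbabilityMeasure μ] (hL : IsCoTSample μ V κ n m L)
    (hV : ∀ i, Measurable (V i)) (i : Fin n) (k : Fin (K + 1)) :
    Integrable (fun ω => (empProb L n m ω i k - llmProb κ V n ω i k) ^ 2) μ := by
  have hmeas : Measurable fun ω => (empProb L n m ω i k - llmProb κ V n ω i k) ^ 2 :=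
    ((hL.measurable_empProb i k).sub ((measurable_kernel_real κ k).comp (hV i))).pow_const 2
  refine (integrable_const (1 : ℝ)).mono' hmeas.aestronglyMeasurable (ae_of_all _ fun ω => ?_)
  have h1 := empProb_mem_Icc L n m ω i k
  have h2 : llmProb κ V n ω i k ≤ 1 := measureReal_le_one
  have h3 : 0 ≤ llmProb κ V n ω i k := measureReal_nonneg
  rw [Real.norm_eq_abs, abs_of_nonneg (sq_nonneg _), sq_le_one_iff_abs_le_one, abs_le]
  constructor <;> linarith [h1.1, h1.2]

/-- The total squared error of the empirical frequencies tends to zero in probability when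
`n / m n → 0`. -/
lemma probTendstoOne_empProb [IsProbabilityMeasure μ] (hV : ∀ i, Measurable (V i)) {m : ℕ → ℕ}
    {L : ℕ → ℕ → ℕ → Ω → Fin (K + 1)} (hm : ∀ n, 0 < m n)
    (hlim : Tendsto (fun n : ℕ => (n : ℝ) / (m n : ℝ)) atTop (𝓝 0))
    (hL : ∀ n, IsCoTSample μ V κ n (m n) (L n)) {δ : ℝ} (hδ : 0 < δ) :
    ProbTendstoOne μ fun n ω =>
      ∑ i, ∑ k, (empProb (L n) n (m n) ω i k - llmProb κ V n ω i k) ^ 2 < δ := by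
  have hint (n : ℕ) (i : Fin n) := integrable_finsetSum Finset.univ
    fun k _ => (hL n).integrable_sq hV i k
  refine probTendstoOne_of_integral (X := fun n ω =>
    ∑ i, ∑ k, (empProb (L n) n (m n) ω i k - llmProb κ V n ω i k) ^ 2)
    (fun n => ae_of_all _ fun ω => Finset.sum_nonneg fun i _ => Finset.sum_nonneg fun k _ =>
      sq_nonneg _)
    (fun n => integrable_finsetSum _ fun i _ => hint n i) ?_ hδ
  have hup : Tendsto (fun n : ℕ => (K + 1 : ℝ) * ((n : ℝ) / (m n : ℝ))) atTop (𝓝 0) := by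
    simpa using hlim.const_mul (K + 1 : ℝ)
  refine squeeze_zero (fun n => integral_nonneg fun ω => Finset.sum_nonneg fun i _ =>
    Finset.sum_nonneg fun k _ => sq_nonneg _) (fun n => ?_) hup
  rw [integral_finsetSum _ fun i _ => hint n i]
  calc _ ≤ ∑ _i : Fin n, ∑ _k : Fin (K + 1), (1 / (m n) : ℝ) := by
        refine Finset.sum_le_sum fun i _ => ?_
        rw [integral_finsetSum _ fun k _ => (hL n).integrable_sq hV i k]
        exact Finset.sum_le_sum fun k _ => (hL n).integral_sq_le hV (hm n) i k
    _ = _ := by simp; ring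

end LLM

section Scores

variable {Ω 𝓥 : Type*} [MeasurableSpace Ω] [MeasurableSpace 𝓥] {μ : Measure Ω}
  {V : ℕ → Ω → 𝓥} {K : ℕ} {κ : Kernel 𝓥 (Fin (K + 1))} {ζ : 𝓥 → ℝ} {ηs : Fin K → ℝ}
  {vhat : (n : ℕ) → Ω → Fin K ⊕ Fin n → ℝ}

lemma LLMModel.ae_llmProb (hLLM : LLMModel μ V κ ζ ηs) :
    ∀ᵐ ω ∂μ, ∀ n (i : Fin n) k, llmProb κ V n ω i k =
      ordProb (stageEta (trueStage ηs ζ V n ω)) (stageZ (trueStage ηs ζ V n ω) i) k := by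
  have h : ∀ᵐ ω ∂μ, ∀ i k, (κ (V i ω)).real {k} = ordProb ηs (ζ (V i ω)) k :=
    ae_all_iff.2 fun i => ae_all_iff.2 fun k => hLLM.model i k
  filter_upwards [h] with ω hω n i k
  exact hω i k

/-- Exact label probabilities determine the scores. -/
lemma probTendstoOne_scores_of_exact (hK : 0 < K) (hLLM : LLMModel μ V κ ζ ηs)
    (hv : ProbTendstoOne μ fun n ω => IsStageArgmin Set.univ (llmProb κ V n ω) (vhat n ω))
    {δ : ℝ} (hδ : 0 < δ) :
    ProbTendstoOne μ fun n ω => ∑ i, (stageZ (vhat n ω) i - ζ (V i ω)) ^ 2 < δ := by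
  refine (hv.and (probTendstoOne_of_ae (Eventually.of_forall fun _ => hLLM.ae_llmProb))).mono
    fun n ω ⟨h1, h2⟩ => ?_
  have h3 : trueStage ηs ζ V n ω ∈ stageSet K n Set.univ :=
    ⟨hLLM.normalized, hLLM.strictMono, fun _ => trivial⟩
  have h4 := h1.stageZ_eq hK h3 (h2 n)
  have h5 (i : Fin n) : stageZ (vhat n ω) i = ζ (V i ω) := by rw [h4]; rfl
  simpa [h5] using hδ

/-- The total squared error of the scores estimated from samples of size `m n` tends to zero in
probability when `n / m n → 0`. -/
lemma probTendstoOne_scores_of_sample [IsProbabilityMeasure μ] [IsMarkovKernel κ] (hK : 0 < K)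
    (hV : ∀ i, Measurable (V i)) (hLLM : LLMModel μ V κ ζ ηs) {M : ℝ}
    (hid : ∀ n, 0 < n → ∀ᵐ ω ∂μ,
      trueStage ηs ζ V n ω ∈ stageSet K n (Set.Icc (-M) M))
    {m : ℕ → ℕ} {L : ℕ → ℕ → ℕ → Ω → Fin (K + 1)} (hm : ∀ n, 0 < m n)
    (hlim : Tendsto (fun n : ℕ => (n : ℝ) / (m n : ℝ)) atTop (𝓝 0))
    (hL : ∀ n, IsCoTSample μ V κ n (m n) (L n))
    (hv : ProbTendstoOne μ fun n ω =>
      IsStageArgmin (Set.Icc (-M) M) (empProb (L n) n (m n) ω) (vhat n ω))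
    {δ : ℝ} (hδ : 0 < δ) :
    ProbTendstoOne μ fun n ω => ∑ i, (stageZ (vhat n ω) i - ζ (V i ω)) ^ 2 < δ := by
  obtain ⟨C, hC, hbound⟩ := exists_stage_bound hK M
  have h1 := probTendstoOne_empProb hV hm hlim hL (div_pos hδ hC)
  have h2 := probTendstoOne_of_ae ((eventually_gt_atTop 0).mono fun n hn =>
    (hid n hn).and hLLM.ae_llmProb)
  refine ((hv.and h1).and h2).mono fun n ω ⟨⟨h3, h4⟩, h5, h6⟩ => ?_
  have h7 := hbound n _ _ _ h5 h3
  refine lt_of_le_of_lt h7 ?_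
  simp_rw [← h6 n]
  rwa [lt_div_iff₀' hC] at h4

end Scores

end

end Bridge

end

/-! ### The three sources of the scores -/

theorem theorem1 {Ω 𝓘 𝓞 : Type*} [MeasurableSpace Ω] [MeasurableSpace 𝓘] [MeasurableSpace 𝓞]
    (μ : Measure Ω) [IsProbabilityMeasure μ] (K d : ℕ) (hK : 1 ≤ K)
    (V : ℕ → Ω → 𝓘 × 𝓞) (Y : ℕ → Ω → Fin (K + 1))
    (g : 𝓘 × 𝓞 → EuclideanSpace ℝ (Fin d)) (ζ : 𝓘 × 𝓞 → ℝ)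
    (Θ : Set (Bridge.Param K d)) (θs : Bridge.Param K d)
    (hmodel : Bridge.HumanModel μ V Y g ζ θs)
    (hroot : Bridge.InteriorUniqueRoot μ V Y g ζ Θ θs)
    (hmom : Bridge.MomentsAndInformation μ V Y g ζ θs) :
    -- known latent scores
    (∀ θhat : ℕ → Ω → Bridge.Param K d,
      Bridge.IsMLE μ V Y g Θ (fun n ω (i : Fin n) => ζ (V i ω)) θhat →
      Bridge.AsympNormal μ (Bridge.fisher μ V Y g ζ θs) θs θhat) ∧
    -- latent scores recovered from the exact LLM probabilities
    (∀ (κ : Kernel (𝓘 × 𝓞) (Fin (K + 1))) [IsMarkovKernel κ] (ηs : Fin K → ℝ)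
      (vhat : (n : ℕ) → Ω → Fin K ⊕ Fin n → ℝ) (θhat : ℕ → Ω → Bridge.Param K d),
      Bridge.LLMModel μ V κ ζ ηs →
      (∀ n, AEMeasurable (vhat n) μ) →
      Bridge.ProbTendstoOne μ (fun n ω =>
        Bridge.IsStageArgmin Set.univ (Bridge.llmProb κ V n ω) (vhat n ω)) →
      Bridge.IsMLE μ V Y g Θ (fun n ω => Bridge.stageZ (vhat n ω)) θhat →
      Bridge.AsympNormal μ (Bridge.fisher μ V Y g ζ θs) θs θhat) ∧
    -- latent scores estimated from `m n` CoT samples per pair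
    (∀ (κ : Kernel (𝓘 × 𝓞) (Fin (K + 1))) [IsMarkovKernel κ] (ηs : Fin K → ℝ) (M : ℝ)
      (m : ℕ → ℕ) (L : ℕ → ℕ → ℕ → Ω → Fin (K + 1))
      (vhat : (n : ℕ) → Ω → Fin K ⊕ Fin n → ℝ) (θhat : ℕ → Ω → Bridge.Param K d),
      Bridge.LLMModel μ V κ ζ ηs →
      (∀ n, 0 < n → ∀ᵐ ω ∂μ,
        Bridge.StageIdentified (Set.Icc (-M) M) (Bridge.llmProb κ V n ω)
          (Bridge.trueStage ηs ζ V n ω)) →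
      (∀ n, 0 < n → ∀ᵐ ω ∂μ, Bridge.StageRegular (Bridge.trueStage ηs ζ V n ω)) →
      (∀ n, 0 < m n) →
      Tendsto (fun n : ℕ => (n : ℝ) / (m n : ℝ)) atTop (𝓝 0) →
      (∀ n, Bridge.IsCoTSample μ V κ n (m n) (L n)) →
      (∀ n, AEMeasurable (vhat n) μ) →
      Bridge.ProbTendstoOne μ (fun n ω =>
        Bridge.IsStageArgmin (Set.Icc (-M) M) (Bridge.empProb (L n) n (m n) ω) (vhat n ω)) →
      Bridge.IsMLE μ V Y g Θ (fun n ω => Bridge.stageZ (vhat n ω)) θhat →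
      Bridge.AsympNormal μ (Bridge.fisher μ V Y g ζ θs) θs θhat) := by
  have hK0 : 0 < K := hK
  refine ⟨fun θhat hmle => ?_, fun κ _ ηs vhat θhat hLLM _ hv hmle => ?_,
    fun κ _ ηs M m L vhat θhat hLLM hid _ hm hlim hL _ hv hmle => ?_⟩
  · refine Bridge.asympNormal_of_isMLE hmodel hroot hmom (fun δ hδ => ?_) hmle
    exact Bridge.probTendstoOne_of_ae (Eventually.of_forall fun n => ae_of_all _ fun ω => by
      simpa using hδ)
  · exact Bridge.asympNormal_of_isMLE hmodel hroot hmom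
      (fun δ hδ => Bridge.probTendstoOne_scores_of_exact hK0 hLLM hv hδ) hmle
  -- The true scores lie in `[-M, M]`, because the true stage-one parameter is a minimizer.
  · exact Bridge.asympNormal_of_isMLE hmodel hroot hmom
      (fun δ hδ => Bridge.probTendstoOne_scores_of_sample hK0 hmodel.meas_V hLLM
        (fun n hn => (hid n hn).mono fun ω h => h.argmin.1) hm hlim hL hv hδ) hmle
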